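/- **Setting.** Let $U$ be a smooth (Hausdorff, second countable) manifold of dimension $m+1$ with a smooth Lorentzian metric $g$ of signature $(-,+,\dots,+)$, let $\Phi:U\to\mathbb R$ be smooth with $d\Phi\neq 0$ on $\Phi^{-1}(0)$, and let $M=\Phi^{-1}(0)$, an embedded hypersurface of dimension $m$, equipped with a metric $d$ inducing its topology ("bounded" refers to $d$). Assume that the restriction $g^M$ of $g$ to $TM$ has constant corank $k\ge 1$, and let $\mathcal N=\ker g^M\subset TM$ be the null distribution, of rank $k$. Let $V$ be a $C^2$ vector field on $M$. **Theorem 2 (dimension bound).** Suppose that 1. the equation $\dot X=V(X)$ defines a continuous semiflow $(\varphi_t)_{t\ge 0}$ on $M$ which is asymptotically compact (for every bounded sequence $(X_j)$ in $M$ and all $t_j\to\infty$, the sequence $\varphi_{t_j}(X_j)$ has a subsequence converging in $M$) and has a bounded absorbing set (a bounded set $B$ such that for every bounded $D\subset M$ there is $T_D\ge0$ with $\varphi_t(D)\subset B$ for all $t\ge T_D$); 2. $\mathcal N$ is involutive, the leaves of the foliation $\mathscr F$ tangent to $\mathcal N$ are compact embedded ($k$-dimensional) submanifolds of $M$, and the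 leaf space $M_{\mathrm{red}}=M/\mathscr F$, with the quotient topology, is Hausdorff; 3. $V$ is projectable with respect to $\mathscr F$, that is, $[V,W]$ takes values in $\mathcal N$ for every smooth section $W$ of $\mathcal N$. Then $\varphi$ has a unique global attractor $A$, i.e. there is a unique compact set $A\subset M$ with $\varphi_t(A)=A$ for all $t\ge 0$ which attracts every bounded set $D\subset M$: for every $\varepsilon>0$, $\varphi_t(D)$ lies in the $\varepsilon$-neighbourhood of $A$ for all large $t$. Let $\pi:M\to M_{\mathrm{red}}$ be the canonical projection. There is a unique continuous semiflow $\psi$ on $M_{\mathrm{red}}$ with $\psi_t\circ\pi=\pi\circ\varphi_t$ for all $t\ge0$, and the projected attractor $A_*=\pi(A)$ is a compact subset of $M_{\mathrm{red}}$ with $\psi_t(A_*)=A_*$ for all $t\ge 0$ whose (Lebesgue) covering dimension satisfies $$\dim_T(A_*)\le m-k .$$ (If $M$ is empty then so is $A_*$ and the bound is void; otherwise $k\le m$.) -/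

import Mathlib

open Set Filter Topology Bundle
open scoped Manifold ContDiff NNReal

noncomputable section

/-! ### Lorentzian ambient space, induced form and null distribution -/

/-- A smooth symmetric `(0,2)`-tensor field of Lorentzian signature `(-,+,…,+)` on an
`n`-dimensional smooth manifold `U`. -/
structure LorentzianMetric (n : ℕ) [NeZero n] (U : Type*) [TopologicalSpace U]
    [ChartedSpace (EuclideanSpace ℝ (Fin n)) U] [IsManifold (𝓡 n) ∞ U] where
  /-- The bilinear form on each tangent space. -/
  form (p : U) : TangentSpace (𝓡 n) p →L[ℝ] TangentSpace (𝓡 n) p →L[ℝ] ℝ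
  symm (p : U) (v w : TangentSpace (𝓡 n) p) : form p v w = form p w v
  /-- Every tangent space has a basis in which the form is `diag(-1, 1, …, 1)`. -/
  signature (p : U) : ∃ b : Module.Basis (Fin n) ℝ (TangentSpace (𝓡 n) p),
    ∀ i j, form p (b i) (b j) = if i = j then (if i = 0 then -1 else 1) else 0
  contMDiff : ContMDiff (𝓡 n)
    ((𝓡 n).prod 𝓘(ℝ, EuclideanSpace ℝ (Fin n) →L[ℝ] EuclideanSpace ℝ (Fin n) →L[ℝ] ℝ)) ∞
    (fun p ↦ TotalSpace.mk' (EuclideanSpace ℝ (Fin n) →L[ℝ] EuclideanSpace ℝ (Fin n) →L[ℝ] ℝ)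
      p (form p))

/-- The form induced by `g` at `x : M` along `ι : M → U`, i.e. the restriction of `g` to the
tangent space of the submanifold when `ι` is an embedding. -/
def inducedForm {n m : ℕ} [NeZero n] {U M : Type*} [TopologicalSpace U]
    [ChartedSpace (EuclideanSpace ℝ (Fin n)) U] [IsManifold (𝓡 n) ∞ U]
    [TopologicalSpace M] [ChartedSpace (EuclideanSpace ℝ (Fin m)) M]
    (g : LorentzianMetric n U) (ι : M → U) (x : M) (v w : TangentSpace (𝓡 m) x) : ℝ :=
  g.form (ι x) (mfderiv (𝓡 m) (𝓡 n) ι x v) (mfderiv (𝓡 m) (𝓡 n) ι x w)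

/-- The null distribution: the pointwise kernel of the induced form. -/
def nullDistribution {n m : ℕ} [NeZero n] {U M : Type*} [TopologicalSpace U]
    [ChartedSpace (EuclideanSpace ℝ (Fin n)) U] [IsManifold (𝓡 n) ∞ U]
    [TopologicalSpace M] [ChartedSpace (EuclideanSpace ℝ (Fin m)) M]
    (g : LorentzianMetric n U) (ι : M → U) (x : M) :
    Submodule ℝ (TangentSpace (𝓡 m) x) where
  carrier := {v | ∀ w : TangentSpace (𝓡 m) x, inducedForm g ι x v w = 0}
  add_mem' := by
    intro a b ha hb w
    have h1 := ha w
    have h2 := hb w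
    simp only [inducedForm] at h1 h2 ⊢
    rw [map_add, map_add, add_apply, h1, h2, add_zero]
  zero_mem' := by
    intro w
    simp only [inducedForm]
    rw [map_zero, map_zero, zero_apply]
  smul_mem' := by
    intro c a ha w
    have h1 := ha w
    simp only [inducedForm] at h1 ⊢
    rw [map_smul, map_smul, smul_apply, h1, smul_zero]

/-! ### Vector fields, distributions, leaves and the leaf space -/

section Foliation

variable {m : ℕ} {M : Type*} [TopologicalSpace M] [ChartedSpace (EuclideanSpace ℝ (Fin m)) M]
  [IsManifold (𝓡 m) ∞ M]

/-- `W` is a vector field of class `C^r` on `M`. -/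
def IsVectorFieldOfClass (r : WithTop ℕ∞) (W : ∀ x : M, TangentSpace (𝓡 m) x) : Prop :=
  ContMDiff (𝓡 m) (𝓡 m).tangent r (fun x ↦ (⟨x, W x⟩ : TangentBundle (𝓡 m) M))

/-- `W ∈ Γ(N)`: a smooth vector field with values in the distribution `N`. -/
def IsSmoothSection (N : ∀ x : M, Submodule ℝ (TangentSpace (𝓡 m) x))
    (W : ∀ x : M, TangentSpace (𝓡 m) x) : Prop :=
  IsVectorFieldOfClass ∞ W ∧ ∀ x, W x ∈ N x

/-- `[W₁, W₂] ∈ Γ(N)` for all `W₁, W₂ ∈ Γ(N)`. -/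
def IsInvolutive (N : ∀ x : M, Submodule ℝ (TangentSpace (𝓡 m) x)) : Prop :=
  ∀ W₁ W₂ : ∀ x : M, TangentSpace (𝓡 m) x, IsSmoothSection N W₁ → IsSmoothSection N W₂ →
    ∀ x, VectorField.mlieBracket (𝓡 m) W₁ W₂ x ∈ N x

/-- The vector field `V` is projectable with respect to `N` (it preserves the foliation tangent
to `N`): `[V, W]` takes values in `N` for every `W ∈ Γ(N)`. -/
def IsProjectable (N : ∀ x : M, Submodule ℝ (TangentSpace (𝓡 m) x))
    (V : ∀ x : M, TangentSpace (𝓡 m) x) : Prop :=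
  ∀ W : ∀ x : M, TangentSpace (𝓡 m) x, IsSmoothSection N W →
    ∀ x, VectorField.mlieBracket (𝓡 m) V W x ∈ N x

/-- `x` and `y` are the endpoints of a smooth arc that is everywhere tangent to `N`. -/
def JoinedByTangentArc (N : ∀ x : M, Submodule ℝ (TangentSpace (𝓡 m) x)) (x y : M) : Prop :=
  ∃ γ : ℝ → M, ContMDiffOn 𝓘(ℝ, ℝ) (𝓡 m) ∞ γ (Icc 0 1) ∧ γ 0 = x ∧ γ 1 = y ∧
    ∀ t ∈ Icc (0 : ℝ) 1, mfderivWithin 𝓘(ℝ, ℝ) (𝓡 m) γ (Icc 0 1) t (1 : ℝ) ∈ N (γ t)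

/-- Two points lie on the same leaf of the foliation tangent to `N` iff they are joined by a
piecewise smooth curve tangent to `N`. For an involutive distribution of constant rank the classes
are exactly the maximal connected integral manifolds of `N`. -/
def leafSetoid (N : ∀ x : M, Submodule ℝ (TangentSpace (𝓡 m) x)) : Setoid M :=
  Relation.EqvGen.setoid (JoinedByTangentArc N)

/-- The leaf through `x`. -/
def leaf (N : ∀ x : M, Submodule ℝ (TangentSpace (𝓡 m) x)) (x : M) : Set M :=
  {y | leafSetoid N x y}

/-- The leaf space `M / 𝓕` with the quotient topology. -/
abbrev LeafSpace (N : ∀ x : M, Submodule ℝ (TangentSpace (𝓡 m) x)) : Type _ :=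
  Quotient (leafSetoid N)

/-- The canonical projection onto the leaf space. -/
def leafProj (N : ∀ x : M, Submodule ℝ (TangentSpace (𝓡 m) x)) (x : M) : LeafSpace N :=
  Quotient.mk (leafSetoid N) x

/-- `S` is an embedded `k`-dimensional submanifold of `M`: around each of its points there is a
smooth chart of `M` in which `S` is a `k`-dimensional coordinate slice. -/
def IsEmbeddedSubmanifold (k : ℕ) (S : Set M) : Prop :=
  ∀ p ∈ S, ∃ e ∈ IsManifold.maximalAtlas (𝓡 m) ∞ M, p ∈ e.source ∧
    ∀ q ∈ e.source, q ∈ S ↔ ∀ i : Fin m, k ≤ (i : ℕ) → e q i = e p i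

/-- The semiflow `φ` is the evolution of `Ẋ = V(X)`: for each `x` the curve `t ↦ φ t x`, `t ≥ 0`,
is an integral curve of `V` (with the one-sided derivative at `t = 0`). -/
def IsEvolutionOf (φ : Flow ℝ≥0 M) (V : ∀ x : M, TangentSpace (𝓡 m) x) : Prop :=
  ∀ x, IsMIntegralCurveOn (I := 𝓡 m) (fun t : ℝ ↦ φ t.toNNReal x) V (Ici 0)

end Foliation

/-! ### Semiflows on metric spaces and global attractors -/

section Attractor

variable {M : Type*} [MetricSpace M]

/-- For every bounded sequence `X` and all times `t j → ∞`, the sequence `φ (t j) (X j)` has a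
convergent subsequence. -/
def IsAsymptoticallyCompact (φ : Flow ℝ≥0 M) : Prop :=
  ∀ X : ℕ → M, Bornology.IsBounded (range X) → ∀ t : ℕ → ℝ≥0, Tendsto t atTop atTop →
    ∃ (y : M) (s : ℕ → ℕ), StrictMono s ∧
      Tendsto (fun j ↦ φ (t (s j)) (X (s j))) atTop (𝓝 y)

/-- There is a bounded set that absorbs every bounded set. -/
def HasBoundedAbsorbingSet (φ : Flow ℝ≥0 M) : Prop :=
  ∃ B : Set M, Bornology.IsBounded B ∧
    ∀ D : Set M, Bornology.IsBounded D → ∃ T : ℝ≥0, ∀ t ≥ T, φ t '' D ⊆ B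

/-- `A` is a global attractor: compact, invariant (`φ_t(A) = A` for all `t ≥ 0`), and attracting
every bounded set in the Hausdorff semidistance. -/
structure IsGlobalAttractor (φ : Flow ℝ≥0 M) (A : Set M) : Prop where
  isCompact : IsCompact A
  invariant : ∀ t, φ t '' A = A
  attracts : ∀ D : Set M, Bornology.IsBounded D → ∀ ε > 0, ∃ T : ℝ≥0, ∀ t ≥ T,
    φ t '' D ⊆ Metric.thickening ε A

end Attractor

/-! ### Covering dimension -/

/-- Every finite open cover of `X` has a finite open refinement such that each point lies in at
most `d + 1` of its members. For `d = ⊥` (read as `-1`) this says that `X` is empty. -/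
def CoveringDimLE (X : Type*) [TopologicalSpace X] (d : WithBot ℕ∞) : Prop :=
  ∀ 𝒰 : Set (Set X), 𝒰.Finite → (∀ O ∈ 𝒰, IsOpen O) → ⋃₀ 𝒰 = univ →
    ∃ 𝒱 : Set (Set X), 𝒱.Finite ∧ (∀ O ∈ 𝒱, IsOpen O) ∧ ⋃₀ 𝒱 = univ ∧
      (∀ O ∈ 𝒱, ∃ O' ∈ 𝒰, O ⊆ O') ∧
      ∀ x, (({O ∈ 𝒱 | x ∈ O}.encard : ℕ∞) : WithBot ℕ∞) ≤ d + 1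

/-- The Lebesgue covering dimension (`⊥` for the empty space, `⊤` if infinite). -/
def coveringDim (X : Type*) [TopologicalSpace X] : WithBot ℕ∞ :=
  sInf {d | CoveringDimLE X d}

end

/-! A nondegenerate form maps the kernel of its restriction to a hyperplane injectively into the
annihilator of that hyperplane, which is a line. So if M is nonempty, k = 1
(`finrank_nullDistribution_le_one`) and the null distribution is a line field. In a chart it is
spanned by a smooth field w with ℓ(w) = 1 (`exists_smooth_generator_ker`). Projecting along the flow
lines of w onto a hyperplane ℓ = c gives each flow box a transversal coordinate with values in
dimension m - 1, and the plaques are its fibres.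

The attractor is the ω-limit set of the absorbing set. The semiflow descends because it carries
leaves into leaves (`leafSetoid_evolution`). Projectability makes [V, w] a multiple of w, so a
Gronwall argument shows that the deviation from the direction of w, if o(s) initially along an arc,
stays o(s) (`exists_tangential_gronwall`). The transversal coordinate of an evolved plaque therefore
has derivative zero and is constant.

For the dimension bound no manifold structure on the leaf space is built; the argument goes through
Hausdorff dimension. Changes of transversal coordinate are locally Lipschitz, and by second
countability countably many Lipschitz holonomy relations describe the leaves
(`exists_countable_holonomy`). Maximising a transversal bump over the points of a compact
transversal on a given leaf yields a continuous function on the leaf space that is Lipschitz in the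
transversal coordinates on countably many pieces (`exists_separating_function`). The image of any
finite family of such functions has Hausdorff dimension at most m - 1 (`dimH_range_le`).

This bounds the covering dimension (`coveringDimLE_of_dimH_le`): functions subordinate to a cover
map the compact space into a nonnegative orthant. Since the image is too small to fill a
high-dimensional face, it can be pushed off rays, face by face, until at most m coordinates are
nonzero. The sets where the coordinates are positive form the refinement. -/

open Set Filter Topology Bundle
open scoped Manifold ContDiff NNReal

noncomputable section

/-! ### Existence and uniqueness of the global attractor -/

section AttractorExistence

variable {M : Type*} [MetricSpace M]

/-- The `ω`-limit set of `B`: all limits of `φ (t j) (b j)` with `b j ∈ B` and `t j → ∞`. -/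
def omegaSet (φ : Flow ℝ≥0 M) (B : Set M) : Set M :=
  {y | ∀ n : ℕ, ∃ t : ℝ≥0, (n : ℝ≥0) ≤ t ∧ ∃ b ∈ B, dist (φ t b) y < 1 / ((n : ℝ) + 1)}

theorem tendsto_atTop_of_natCast_le {t : ℕ → ℝ≥0} (h : ∀ n : ℕ, (n : ℝ≥0) ≤ t n) :
    Tendsto t atTop atTop :=
  tendsto_atTop_mono h tendsto_natCast_atTop_atTop

theorem mem_omegaSet_of_tendsto {φ : Flow ℝ≥0 M} {B : Set M} {t : ℕ → ℝ≥0} {b : ℕ → M} {y : M}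
    (ht : Tendsto t atTop atTop) (hb : ∀ n, b n ∈ B)
    (hy : Tendsto (fun n ↦ φ (t n) (b n)) atTop (𝓝 y)) : y ∈ omegaSet φ B := by
  intro n
  have h1 : ∀ᶠ j in atTop, dist (φ (t j) (b j)) y < 1 / ((n : ℝ) + 1) :=
    (tendsto_iff_dist_tendsto_zero.1 hy).eventually_lt_const (by positivity)
  obtain ⟨j, hj1, hj2⟩ := (h1.and (ht.eventually_ge_atTop (n : ℝ≥0))).exists
  exact ⟨t j, hj2, b j, hb j, hj1⟩

theorem exists_tendsto_of_mem_omegaSet {φ : Flow ℝ≥0 M} {B : Set M} {y : M}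
    (hy : y ∈ omegaSet φ B) : ∃ (t : ℕ → ℝ≥0) (b : ℕ → M), Tendsto t atTop atTop ∧
      (∀ n, b n ∈ B) ∧ Tendsto (fun n ↦ φ (t n) (b n)) atTop (𝓝 y) := by
  choose t ht b hb h using hy
  refine ⟨t, b, tendsto_atTop_of_natCast_le ht, hb, ?_⟩
  rw [tendsto_iff_dist_tendsto_zero]
  exact squeeze_zero (fun _ ↦ dist_nonneg) (fun n ↦ (h n).le)
    tendsto_one_div_add_atTop_nhds_zero_nat

/-- A diagonal choice: the n-th point of the sequence is approximated within 1/(n+1) by an orbit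
point at time at least n. Asymptotic compactness applies to the approximants, and the sequence
follows them. -/
theorem isCompact_omegaSet {φ : Flow ℝ≥0 M} (hac : IsAsymptoticallyCompact φ) {B : Set M}
    (hB : Bornology.IsBounded B) : IsCompact (omegaSet φ B) := by
  rw [isCompact_iff_isSeqCompact]
  intro y hy
  choose t ht b hb h using fun n ↦ hy n n
  have htt := tendsto_atTop_of_natCast_le ht
  obtain ⟨z, s, hs, hz⟩ := hac b (hB.subset (range_subset_iff.2 hb)) t htt
  refine ⟨z, mem_omegaSet_of_tendsto (htt.comp hs.tendsto_atTop) (fun n ↦ hb (s n)) hz, s, hs, ?_⟩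
  refine (tendsto_iff_of_dist ?_).1 hz
  exact squeeze_zero (fun _ ↦ dist_nonneg) (fun n ↦ (h (s n)).le)
    (tendsto_one_div_add_atTop_nhds_zero_nat.comp hs.tendsto_atTop)

theorem image_omegaSet {φ : Flow ℝ≥0 M} (hac : IsAsymptoticallyCompact φ) {B : Set M}
    (hB : Bornology.IsBounded B) (t : ℝ≥0) : φ t '' omegaSet φ B = omegaSet φ B := by
  apply Subset.antisymm
  · rintro _ ⟨y, hy, rfl⟩
    obtain ⟨u, b, hu, hb, h⟩ := exists_tendsto_of_mem_omegaSet hy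
    refine mem_omegaSet_of_tendsto (t := fun n ↦ t + u n)
      (tendsto_atTop_mono (fun n ↦ le_add_self) hu) hb ?_
    simp_rw [φ.map_add]
    exact ((φ.continuous_toFun t).tendsto y).comp h
  · intro y hy
    obtain ⟨u, b, hu, hb, h⟩ := exists_tendsto_of_mem_omegaSet hy
    -- A preimage under `φ t` is a limit of the orbits stopped t earlier. The truncated subtraction
    -- is genuine for large n.
    have hu' : Tendsto (fun n ↦ u n - t) atTop atTop := by
      refine tendsto_atTop.2 fun c ↦ ?_
      filter_upwards [hu.eventually_ge_atTop (c + t)] with n hn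
      exact le_tsub_of_add_le_right hn
    obtain ⟨z, s, hs, hz⟩ := hac b (hB.subset (range_subset_iff.2 hb)) _ hu'
    refine ⟨z, mem_omegaSet_of_tendsto (hu'.comp hs.tendsto_atTop) (fun n ↦ hb (s n)) hz, ?_⟩
    refine tendsto_nhds_unique (((φ.continuous_toFun t).tendsto z).comp hz)
      ((h.comp hs.tendsto_atTop).congr' ?_)
    filter_upwards [(hu.comp hs.tendsto_atTop).eventually_ge_atTop t] with n hn
    simp only [Function.comp_apply] at hn ⊢
    rw [← φ.map_add, add_tsub_cancel_of_le hn]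

theorem exists_isGlobalAttractor {φ : Flow ℝ≥0 M} (hac : IsAsymptoticallyCompact φ)
    (habs : HasBoundedAbsorbingSet φ) : ∃ A, IsGlobalAttractor φ A := by
  obtain ⟨B, hB, habs⟩ := habs
  refine ⟨omegaSet φ B, isCompact_omegaSet hac hB, image_omegaSet hac hB, fun D hD ε hε ↦ ?_⟩
  by_contra! hcon
  have hcon' : ∀ n : ℕ, ∃ t : ℝ≥0, (n : ℝ≥0) ≤ t ∧ ∃ x ∈ D,
      φ t x ∉ Metric.thickening ε (omegaSet φ B) := by
    intro n
    obtain ⟨t, ht, h⟩ := hcon n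
    obtain ⟨_, ⟨x, hx, rfl⟩, h⟩ := not_subset.1 h
    exact ⟨t, ht, x, hx, h⟩
  choose t ht x hx h using hcon'
  have htt := tendsto_atTop_of_natCast_le ht
  obtain ⟨y, s, hs, hy⟩ := hac x (hD.subset (range_subset_iff.2 hx)) t htt
  obtain ⟨T, hT⟩ := habs D hD
  have hyA : y ∈ omegaSet φ B := by
    -- The first T units of time bring the points of D into B; the remaining time still tends to
    -- infinity.
    refine mem_omegaSet_of_tendsto (t := fun n ↦ t (s n) - T) (b := fun n ↦ φ T (x (s n))) ?_
      (fun n ↦ hT T le_rfl ⟨_, hx _, rfl⟩) (hy.congr' ?_)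
    · refine tendsto_atTop.2 fun c ↦ ?_
      filter_upwards [(htt.comp hs.tendsto_atTop).eventually_ge_atTop (c + T)] with n hn
      exact le_tsub_of_add_le_right hn
    · filter_upwards [(htt.comp hs.tendsto_atTop).eventually_ge_atTop T] with n hn
      simp only [Function.comp_apply] at hn
      rw [← φ.map_add, tsub_add_cancel_of_le hn]
  obtain ⟨n, hn⟩ := (hy.eventually (Metric.isOpen_thickening.mem_nhds
    (Metric.self_subset_thickening hε _ hyA))).exists
  exact h (s n) hn

/-- An attractor is itself bounded and equal to its images, so attraction by A places it in every
thickening of the closed set A. -/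
theorem IsGlobalAttractor.subset {φ : Flow ℝ≥0 M} {A A' : Set M} (hA : IsGlobalAttractor φ A)
    (hA' : IsGlobalAttractor φ A') : A' ⊆ A := by
  rw [← hA.isCompact.isClosed.closure_eq, Metric.closure_eq_iInter_thickening]
  refine subset_iInter₂ fun ε hε ↦ ?_
  obtain ⟨T, hT⟩ := hA.attracts A' hA'.isCompact.isBounded ε hε
  exact (hA'.invariant T).symm.subset.trans (hT T le_rfl)

theorem IsGlobalAttractor.eq {φ : Flow ℝ≥0 M} {A A' : Set M} (hA : IsGlobalAttractor φ A)
    (hA' : IsGlobalAttractor φ A') : A' = A :=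
  (hA.subset hA').antisymm (hA'.subset hA)

end AttractorExistence

/-! ### Semiflows on quotients -/

section QuotientFlow

variable {M : Type*} [TopologicalSpace M]

/-- The semiflow induced on a quotient by a semiflow that respects the equivalence relation. -/
def quotientFlow (φ : Flow ℝ≥0 M) (r : Setoid M) (h : ∀ t x y, r x y → r (φ t x) (φ t y)) :
    Flow ℝ≥0 (Quotient r) where
  toFun t := Quotient.map (φ t) (fun x y ↦ h t x y)
  cont' := by
    -- Joint continuity descends because ℝ≥0 is locally compact: its product with a quotient map is
    -- again a quotient map.
    refine isQuotientMap_quotient_mk'.continuous_lift_prod_right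
      (f := (Quotient.mk r)) ?_
    exact continuous_quotient_mk'.comp φ.cont'
  map_add' t₁ t₂ ξ := by
    induction ξ using Quotient.inductionOn with
    | h x => exact congrArg (Quotient.mk r) (φ.map_add t₁ t₂ x)
  map_zero' ξ := by
    induction ξ using Quotient.inductionOn with
    | h x => exact congrArg (Quotient.mk r) (φ.map_zero_apply x)

theorem isSemiconjugacy_quotientFlow (φ : Flow ℝ≥0 M) (r : Setoid M)
    (h : ∀ t x y, r x y → r (φ t x) (φ t y)) :
    Flow.IsSemiconjugacy (Quotient.mk r) φ (quotientFlow φ r h) :=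
  ⟨continuous_quotient_mk', Quotient.mk_surjective, fun _ _ ↦ rfl⟩

theorem existsUnique_isSemiconjugacy_quotient (φ : Flow ℝ≥0 M) (r : Setoid M)
    (h : ∀ t x y, r x y → r (φ t x) (φ t y)) :
    ∃! ψ : Flow ℝ≥0 (Quotient r), Flow.IsSemiconjugacy (Quotient.mk r) φ ψ := by
  refine ⟨quotientFlow φ r h, isSemiconjugacy_quotientFlow φ r h, fun ψ hψ ↦ Flow.ext fun t ξ ↦ ?_⟩
  obtain ⟨x, rfl⟩ := Quotient.mk_surjective ξ
  rw [← (hψ.semiconj t) x, ← ((isSemiconjugacy_quotientFlow φ r h).semiconj t) x]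

theorem Flow.IsSemiconjugacy.image_invariant {X : Type*} [TopologicalSpace X] {q : M → X}
    {φ : Flow ℝ≥0 M} {ψ : Flow ℝ≥0 X} (h : Flow.IsSemiconjugacy q φ ψ) {A : Set M} {t : ℝ≥0}
    (hA : φ t '' A = A) : ψ t '' (q '' A) = q '' A := by
  rw [← (h.semiconj t).set_image A, hA]

end QuotientFlow

/-! ### A criterion for the covering dimension through Hausdorff dimension -/

section CoveringDimension

open Finset in
/-- A set of small Hausdorff dimension misses a ray in the interior of each coordinate face of
large dimension. -/
theorem exists_ray_notMem {ι : Type*} [Fintype ι] [DecidableEq ι] {K : Set (ι → ℝ)} {n : ℕ}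
    (hK : dimH K ≤ n) {S : Finset ι} (hS : n + 2 ≤ #S) :
    ∃ v : ι → ℝ, (∀ i ∈ S, 0 < v i) ∧ (∀ i ∉ S, v i = 0) ∧
      ∀ y ∈ K, ∀ c : ℝ, 0 < c → ¬ ∀ i ∈ S, y i = c * v i := by
  obtain ⟨i₀, hi₀⟩ : S.Nonempty := Finset.card_pos.1 (by omega)
  -- Ratios to the i₀-th coordinate turn a ray of the open face into a point of a space of dimension
  -- #S - 1 > n. The C¹ image of K there has dense complement, and a positive u in that complement
  -- determines a missed ray.
  let f : (ι → ℝ) → (↥(S.erase i₀) → ℝ) := fun y i ↦ y i / y i₀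
  have hf : ContDiffOn ℝ 1 f {y | 0 < y i₀} := by
    refine contDiffOn_pi.2 fun i ↦ ContDiffOn.div (by fun_prop) (by fun_prop) fun y hy ↦ ?_
    exact (show 0 < y i₀ from hy).ne'
  have hc : Convex ℝ {y : ι → ℝ | 0 < y i₀} :=
    convex_halfSpace_gt (LinearMap.proj (R := ℝ) (φ := fun _ : ι ↦ ℝ) i₀).isLinear 0
  have hlt : dimH (K ∩ {y | 0 < y i₀}) < Module.finrank ℝ (↥(S.erase i₀) → ℝ) := by
    refine ((dimH_mono inter_subset_left).trans hK).trans_lt ?_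
    rw [Module.finrank_fintype_fun_eq_card, Fintype.card_coe, Finset.card_erase_of_mem hi₀]
    exact_mod_cast (by omega : n < #S - 1)
  have hdense := hf.dense_compl_image_of_dimH_lt_finrank hc inter_subset_right hlt
  have hopen : IsOpen {u : ↥(S.erase i₀) → ℝ | ∀ i, 0 < u i} := by
    simp only [Set.ofPred_forall]
    exact isOpen_iInter_of_finite fun i ↦ isOpen_lt continuous_const (continuous_apply i)
  obtain ⟨u, hu, hu'⟩ := hdense.inter_open_nonempty _ hopen ⟨fun _ ↦ 1, fun _ ↦ one_pos⟩
  refine ⟨fun i ↦ if h : i ∈ S.erase i₀ then u ⟨i, h⟩ else if i = i₀ then 1 else 0, ?_, ?_, ?_⟩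
  · intro i hi
    by_cases h : i = i₀
    · simp [h]
    · have : i ∈ S.erase i₀ := Finset.mem_erase.2 ⟨h, hi⟩
      simp only [this, dif_pos]
      exact hu _
  · intro i hi
    have h1 : i ∉ S.erase i₀ := fun h ↦ hi (Finset.mem_of_mem_erase h)
    have h2 : i ≠ i₀ := fun h ↦ hi (h ▸ hi₀)
    simp only [h1, h2, dif_neg, not_false_eq_true, if_neg]
  · intro y hy c hc0 h
    have h0 : y i₀ = c := by simpa using h i₀ hi₀
    refine hu' ⟨y, ⟨hy, by simpa [h0] using hc0⟩, funext fun i ↦ ?_⟩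
    have hi := h i (Finset.mem_of_mem_erase i.2)
    simp only [i.2, dif_pos] at hi
    simp only [f, h0, hi]
    field_simp

theorem exists_lipschitzWith_inf' {α ι : Type*} [PseudoEMetricSpace α] (S : Finset ι)
    (hS : S.Nonempty) (f : ι → α → ℝ) (hf : ∀ i ∈ S, ∃ C, LipschitzWith C (f i)) :
    ∃ C, LipschitzWith C (fun x ↦ S.inf' hS (fun i ↦ f i x)) := by
  have : (fun x ↦ S.inf' hS (fun i ↦ f i x)) = S.inf' hS f := by
    ext x; rw [Finset.inf'_apply]
  rw [this]
  exact Finset.inf'_induction hS f (p := fun g ↦ ∃ C, LipschitzWith C g)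
    (fun g₁ ⟨C₁, h₁⟩ g₂ ⟨C₂, h₂⟩ ↦ ⟨_, h₁.min h₂⟩) hf

theorem exists_lipschitzWith_sum {α ι E : Type*} [PseudoEMetricSpace α]
    [SeminormedAddCommGroup E] (S : Finset ι) (f : ι → α → E)
    (hf : ∀ i ∈ S, ∃ C, LipschitzWith C (f i)) :
    ∃ C, LipschitzWith C (fun x ↦ ∑ i ∈ S, f i x) := by
  have : (fun x ↦ ∑ i ∈ S, f i x) = ∑ i ∈ S, f i := by ext x; rw [Finset.sum_apply]
  rw [this]
  exact Finset.sum_induction f (fun g ↦ ∃ C, LipschitzWith C g)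
    (fun g₁ g₂ ⟨C₁, h₁⟩ ⟨C₂, h₂⟩ ↦ ⟨_, h₁.add h₂⟩) ⟨0, LipschitzWith.const _⟩ hf

theorem exists_lipschitzWith_apply_div {ι : Type*} [Fintype ι] (i : ι) (c : ℝ) :
    ∃ C, LipschitzWith C (fun y : ι → ℝ ↦ y i / c) := by
  refine ⟨‖c⁻¹‖₊, LipschitzWith.of_dist_le_mul fun x y ↦ ?_⟩
  rw [dist_eq_norm, ← sub_div, div_eq_inv_mul, norm_mul, coe_nnnorm, ← dist_eq_norm]
  exact mul_le_mul_of_nonneg_left (dist_le_pi_dist x y i) (norm_nonneg _)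

open Finset in
/-- Points of the nonnegative orthant with at most `d` nonzero coordinates can be pushed to points
with at most `d - 1` nonzero coordinates if they form a set of small Hausdorff dimension. -/
theorem exists_lipschitzWith_push {ι : Type*} [Fintype ι] [DecidableEq ι] {K : Set (ι → ℝ)}
    {n d : ℕ} (hdim : dimH K ≤ n) (hnd : n + 2 ≤ d) (hpos : ∀ y ∈ K, ∀ i, 0 ≤ y i)
    (hne : ∀ y ∈ K, y ≠ 0) (hd : ∀ y ∈ K, #{i | y i ≠ 0} ≤ d) :
    ∃ (g : (ι → ℝ) → (ι → ℝ)) (C : ℝ≥0), LipschitzWith C g ∧ ∀ y ∈ K, (∀ i, 0 ≤ g y i) ∧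
      g y ≠ 0 ∧ (∀ i, g y i ≠ 0 → y i ≠ 0) ∧ #{i | g y i ≠ 0} ≤ d - 1 := by
  have hray : ∀ S : {S : Finset ι // #S = d}, ∃ v : ι → ℝ,
      (∀ i ∈ S.1, 0 < v i) ∧ (∀ i ∉ S.1, v i = 0) ∧
      ∀ y ∈ K, ∀ c : ℝ, 0 < c → ¬ ∀ i ∈ S.1, y i = c * v i := fun S ↦
    exists_ray_notMem hdim (S.2.symm ▸ hnd)
  choose v hv0 hv1 hv2 using hray
  have hcard : ∀ S : {S : Finset ι // #S = d}, #S.1 = d :=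
    fun S ↦ S.2
  have hSne : ∀ S : {S : Finset ι // #S = d}, S.1.Nonempty :=
    fun S ↦ card_pos.1 (by rw [hcard S]; omega)
  -- The largest multiple of v S that can be subtracted from y leaving the coordinates in S
  -- nonnegative. On K it vanishes as soon as one of these coordinates does.
  let μ : {S : Finset ι // #S = d} → (ι → ℝ) → ℝ :=
    fun S y ↦ S.1.inf' (hSne S) (fun i ↦ y i / v S i)
  have hμ : ∀ S, ∃ C, LipschitzWith C (μ S) := fun S ↦
    exists_lipschitzWith_inf' S.1 (hSne S) (fun i (y : ι → ℝ) ↦ y i / v S i) fun i _ ↦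
      exists_lipschitzWith_apply_div i (v S i)
  have hμ0 : ∀ S, ∀ y ∈ K, (∃ i ∈ S.1, y i = 0) → μ S y = 0 := by
    rintro S y hy ⟨i, hi, hyi⟩
    have h1 : μ S y ≤ y i / v S i := inf'_le (fun i ↦ y i / v S i) hi
    have h2 : 0 ≤ μ S y :=
      le_inf' (hSne S) _ fun j hj ↦ div_nonneg (hpos y hy j) (hv0 S j hj).le
    rw [hyi, zero_div] at h1
    exact le_antisymm h1 h2
  -- Points of K have at most d nonzero coordinates, so only the term with S equal to the support of
  -- y can survive. Summing over all S yields one globally Lipschitz formula for all faces.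
  let g : (ι → ℝ) → (ι → ℝ) := fun y ↦ y - ∑ S, μ S y • v S
  have hg : ∃ C, LipschitzWith C g := by
    obtain ⟨C, hC⟩ := exists_lipschitzWith_sum univ (fun S y ↦ μ S y • v S) fun S _ ↦ by
      obtain ⟨C, hC⟩ := hμ S
      exact ⟨_, (ContinuousLinearMap.toSpanSingleton ℝ (v S)).lipschitz.comp hC⟩
    exact ⟨_, LipschitzWith.id.sub hC⟩
  obtain ⟨C, hC⟩ := hg
  refine ⟨g, C, hC, fun y hy ↦ ?_⟩
  set T : Finset ι := {i | y i ≠ 0} with hT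
  have hmemT : ∀ i, i ∈ T ↔ y i ≠ 0 := fun i ↦ by simp [hT]
  have hnotsub : ∀ S : {S : Finset ι // #S = d}, S.1 ≠ T → μ S y = 0 := by
    intro S hST
    refine hμ0 S y hy ?_
    by_contra! hcon
    exact hST (eq_of_subset_of_card_le (fun i hi ↦ (hmemT i).2 (hcon i hi))
      (by rw [hcard S]; exact hd y hy))
  by_cases hTd : #T = d
  · let S₀ : {S : Finset ι // #S = d} := ⟨T, hTd⟩
    have hgy : g y = y - μ S₀ y • v S₀ := by
      simp only [g]
      rw [sum_eq_single S₀ (fun S _ hS ↦ by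
        rw [hnotsub S fun h ↦ hS (Subtype.ext h), zero_smul]) (by simp)]
    have hle : ∀ i ∈ T, μ S₀ y * v S₀ i ≤ y i := fun i hi ↦
      (le_div_iff₀ (hv0 S₀ i hi)).1 (inf'_le (s := S₀.1) (fun i ↦ y i / v S₀ i) hi)
    have hzero : ∀ i ∉ T, g y i = 0 := fun i hi ↦ by
      have : y i = 0 := by simpa [hmemT] using hi
      rw [hgy]; simp [this, hv1 S₀ i hi]
    obtain ⟨j, hj, hjμ⟩ := exists_mem_eq_inf' (hSne S₀) (fun i ↦ y i / v S₀ i)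
    have hjμ' : μ S₀ y = y j / v S₀ j := hjμ
    have hjz : g y j = 0 := by
      have := (hv0 S₀ j hj).ne'
      rw [hgy]
      simp only [Pi.sub_apply, Pi.smul_apply, smul_eq_mul, hjμ']
      field_simp; ring
    refine ⟨fun i ↦ ?_, fun h0 ↦ ?_, fun i hi ↦ ?_, ?_⟩
    · by_cases hi : i ∈ T
      · rw [hgy]; simpa using hle i hi
      · exact (hzero i hi).ge
    · have hjT : y j ≠ 0 := (hmemT j).1 hj
      have hjp : 0 < μ S₀ y := by
        rw [hjμ']; exact div_pos (lt_of_le_of_ne (hpos y hy j) hjT.symm) (hv0 S₀ j hj)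
      -- If the push reached the origin, y would lie on the ray that K misses.
      refine hv2 S₀ y hy _ hjp fun i _ ↦ ?_
      have := congrFun (hgy.symm.trans h0) i
      simpa [sub_eq_zero] using this
    · by_contra hyi
      exact hi (hzero i (by simpa [hmemT] using hyi))
    · have hsub : ({i | g y i ≠ 0} : Finset ι) ⊆ T.erase j := fun i hi ↦ by
        have hi' : g y i ≠ 0 := by simpa using hi
        refine mem_erase.2 ⟨fun h ↦ hi' (h ▸ hjz), ?_⟩
        by_contra h
        exact hi' (hzero i h)
      calc _ ≤ #(T.erase j) := card_le_card hsub
        _ = d - 1 := by rw [card_erase_of_mem hj, hTd]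
  · have hgy : g y = y := by
      simp only [g]
      rw [sum_eq_zero fun S _ ↦ by
        rw [hnotsub S fun h ↦ hTd (h ▸ hcard S), zero_smul], sub_zero]
    rw [hgy]
    refine ⟨hpos y hy, hne y hy, fun i h ↦ h, ?_⟩
    have := hd y hy
    have h1 : #T ≤ d := this
    change #T ≤ d - 1
    omega

-- A push lowers the maximal number of nonzero coordinates by one, and a Lipschitz image has no
-- larger `dimH`. The hypotheses thus hold again for the pushed set, and the descent runs until n +
-- 1 coordinates remain.
open Finset in
theorem exists_lipschitzWith_push_iterate {ι : Type*} [Fintype ι] [DecidableEq ι] {n : ℕ} (d : ℕ)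
    {K : Set (ι → ℝ)} (hdim : dimH K ≤ n) (hpos : ∀ y ∈ K, ∀ i, 0 ≤ y i)
    (hne : ∀ y ∈ K, y ≠ 0) (hd : ∀ y ∈ K, #{i | y i ≠ 0} ≤ d) :
    ∃ (g : (ι → ℝ) → (ι → ℝ)) (C : ℝ≥0), LipschitzWith C g ∧ ∀ y ∈ K, (∀ i, 0 ≤ g y i) ∧
      g y ≠ 0 ∧ (∀ i, g y i ≠ 0 → y i ≠ 0) ∧ #{i | g y i ≠ 0} ≤ n + 1 := by
  induction d generalizing K with
  | zero =>
    exact ⟨id, 1, LipschitzWith.id, fun y hy ↦ ⟨hpos y hy, hne y hy, fun _ h ↦ h,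
      (hd y hy).trans (Nat.zero_le _)⟩⟩
  | succ d ih =>
    by_cases hnd : n + 2 ≤ d + 1
    · obtain ⟨g, C, hC, hg⟩ := exists_lipschitzWith_push hdim hnd hpos hne hd
      obtain ⟨g', C', hC', hg'⟩ := ih (K := g '' K) ((hC.dimH_image_le K).trans hdim)
        (forall_mem_image.2 fun y hy ↦ (hg y hy).1) (forall_mem_image.2 fun y hy ↦ (hg y hy).2.1)
        (forall_mem_image.2 fun y hy ↦ (hg y hy).2.2.2)
      refine ⟨g' ∘ g, _, hC'.comp hC, fun y hy ↦ ?_⟩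
      obtain ⟨h1, h2, h3, h4⟩ := hg' (g y) (mem_image_of_mem g hy)
      exact ⟨h1, h2, fun i hi ↦ (hg y hy).2.2.1 i (h3 i hi), h4⟩
    · exact ⟨id, 1, LipschitzWith.id, fun y hy ↦ ⟨hpos y hy, hne y hy, fun _ h ↦ h,
        (hd y hy).trans (by omega)⟩⟩

/-- If a compact space has enough continuous functions such that every finite family of them has
an image of Hausdorff dimension at most `n`, then its covering dimension is at most `n`. -/
theorem coveringDimLE_of_dimH_le {X : Type*} [TopologicalSpace X] [CompactSpace X] {n : ℕ}
    (L : Set (X → ℝ)) (hcont : ∀ f ∈ L, Continuous f) (hpos : ∀ f ∈ L, ∀ x, 0 ≤ f x)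
    (hsep : ∀ x, ∀ O : Set X, IsOpen O → x ∈ O → ∃ f ∈ L, 0 < f x ∧ ∀ y, f y ≠ 0 → y ∈ O)
    (hdim : ∀ (ι : Type) [Fintype ι] (f : ι → X → ℝ), (∀ i, f i ∈ L) →
      dimH (range fun x i ↦ f i x) ≤ n) :
    CoveringDimLE X (n : ℕ) := by
  classical
  intro 𝒰 h𝒰 hop hcov
  have hx : ∀ x, ∃ O ∈ 𝒰, ∃ f ∈ L, 0 < f x ∧ ∀ y, f y ≠ 0 → y ∈ O := by
    intro x
    obtain ⟨O, hO, hxO⟩ := mem_sUnion.1 (hcov ▸ mem_univ x)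
    obtain ⟨f, hf⟩ := hsep x O (hop O hO) hxO
    exact ⟨O, hO, f, hf⟩
  choose O hO f hfL hfx hfO using hx
  obtain ⟨t, ht⟩ := isCompact_univ.elim_finite_subcover (fun x ↦ {y | 0 < f x y})
    (fun x ↦ isOpen_lt continuous_const (hcont _ (hfL x))) (fun x _ ↦ mem_iUnion.2 ⟨x, hfx x⟩)
  let e : Fin t.card ≃ t := t.equivFin.symm
  let F : X → Fin t.card → ℝ := fun x i ↦ f (e i) x
  have hFne : ∀ x, F x ≠ 0 := by
    intro x h0
    obtain ⟨a, ha⟩ := mem_iUnion.1 (ht (mem_univ x))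
    obtain ⟨hat, hax⟩ := mem_iUnion.1 ha
    have := congrFun h0 (e.symm ⟨a, hat⟩)
    simp only [F, Equiv.apply_symm_apply, Pi.zero_apply] at this
    exact (show 0 < f a x from hax).ne' this
  obtain ⟨g, C, hg, hgF⟩ := exists_lipschitzWith_push_iterate (n := n) t.card (K := range F)
    (hdim (Fin t.card) (fun i ↦ f (e i)) fun i ↦ hfL _)
    (forall_mem_range.2 fun x i ↦ hpos _ (hfL _) _) (forall_mem_range.2 hFne)
    (fun y _ ↦ (Finset.card_le_univ _).trans (by simp))
  have hFcont : Continuous F := continuous_pi fun i ↦ hcont _ (hfL _)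
  -- The push creates no new nonzero coordinate, so each W i stays inside the member of 𝒰 that
  -- contains the support of its function; at most n + 1 coordinates are nonzero at any point.
  let W : Fin t.card → Set X := fun i ↦ {x | 0 < g (F x) i}
  have hWmem : ∀ x i, x ∈ W i ↔ g (F x) i ≠ 0 := fun x i ↦
    ⟨fun h ↦ (show 0 < g (F x) i from h).ne',
      fun h ↦ lt_of_le_of_ne ((hgF _ (mem_range_self x)).1 i) h.symm⟩
  refine ⟨range W, finite_range W, ?_, ?_, ?_, ?_⟩
  · rintro _ ⟨i, rfl⟩
    exact isOpen_lt continuous_const ((continuous_apply i).comp (hg.continuous.comp hFcont))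
  · refine eq_univ_of_forall fun x ↦ ?_
    obtain ⟨i, hi⟩ := Function.ne_iff.1 (hgF _ (mem_range_self x)).2.1
    exact mem_sUnion.2 ⟨W i, mem_range_self i, (hWmem x i).2 hi⟩
  · rintro _ ⟨i, rfl⟩
    refine ⟨O (e i), hO _, fun x hx ↦ hfO _ _ ?_⟩
    exact (hgF _ (mem_range_self x)).2.2.1 i ((hWmem x i).1 hx)
  · intro x
    have hsub : {V ∈ range W | x ∈ V} ⊆
        W '' (({i | g (F x) i ≠ 0} : Finset (Fin t.card)) : Set (Fin t.card)) := by
      rintro _ ⟨⟨i, rfl⟩, hi⟩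
      exact ⟨i, by simpa using (hWmem x i).1 hi, rfl⟩
    have h1 : {V ∈ range W | x ∈ V}.encard ≤ ((n + 1 : ℕ) : ℕ∞) := by
      refine (encard_le_encard hsub).trans ((encard_image_le _ _).trans ?_)
      rw [encard_coe_eq_coe_finsetCard]
      exact_mod_cast (hgF _ (mem_range_self x)).2.2.2
    exact_mod_cast h1

end CoveringDimension

/-! ### Plaque atlases and the dimension of the leaf space -/

section PlaqueAtlas

/-- Points `x` and `y` lie on a common plaque of one of the boxes `B j`, `j ∈ J'`. -/
def SamePlaque {M E J : Type*} (B : J → Set M) (p : J → M → E) (J' : Set J) (x y : M) : Prop :=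
  ∃ j ∈ J', x ∈ B j ∧ y ∈ B j ∧ p j x = p j y

/-- An atlas of boxes `B j` with transversal coordinates `p j` for the partition of `M` into the
classes of `r`: the fibres of `p j` are the plaques, the transversal coordinates of two boxes are
locally Lipschitz functions of each other, and the transversals have dimension at most `n`. -/
structure PlaqueAtlas {M E J : Type*} [TopologicalSpace M] [MetricSpace E] (r : Setoid M)
    (B : J → Set M) (p : J → M → E) (n : ℕ) : Prop where
  isOpen : ∀ j, IsOpen (B j)
  continuousOn : ∀ j, ContinuousOn (p j) (B j)
  rel : ∀ j, ∀ x ∈ B j, ∀ y ∈ B j, p j x = p j y → r x y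
  generated : ∀ J' : Set J, (∀ x, ∃ j ∈ J', x ∈ B j) → ∀ x y, r x y →
    Relation.EqvGen (SamePlaque B p J') x y
  lipschitz : ∀ i j, ∀ z ∈ B i ∩ B j, ∃ O ∈ 𝓝 z, ∃ K : ℝ≥0, ∀ x ∈ O, ∀ y ∈ O,
    dist (p j x) (p j y) ≤ K * dist (p i x) (p i y)
  plaque_open : ∀ j, ∀ y ∈ B j, ∀ z ∈ B j, p j y = p j z → ∀ O ∈ 𝓝 z,
    ∀ᶠ y' in 𝓝 y, ∃ z' ∈ O, r y' z'
  exists_transversal : ∀ x, ∃ j, x ∈ B j ∧ ∃ S ⊆ B j, IsCompact S ∧ x ∈ S ∧ InjOn (p j) S ∧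
    ∃ ε > 0, ∀ z ∈ B j, dist (p j z) (p j x) < ε → ∃ z' ∈ S, p j z' = p j z
  dimH_le : ∀ j, dimH (p j '' B j) ≤ n

/-- On Z the map f factors through p: equal values of p force equal values of f, and the induced map
on the image of p is Lipschitz. -/
theorem dimH_image_le_of_dist_le {M E F : Type*} [MetricSpace E] [MetricSpace F] {Z : Set M}
    {f : M → F} {p : M → E} {K : ℝ≥0}
    (h : ∀ x ∈ Z, ∀ y ∈ Z, dist (f x) (f y) ≤ K * dist (p x) (p y)) :
    dimH (f '' Z) ≤ dimH (p '' Z) := by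
  rcases isEmpty_or_nonempty M with hM | hM
  · simp [Set.eq_empty_of_isEmpty Z]
  have hinv : ∀ a ∈ p '' Z, Function.invFunOn p Z a ∈ Z ∧ p (Function.invFunOn p Z a) = a :=
    fun a ha ↦ ⟨Function.invFunOn_mem ha, Function.invFunOn_eq ha⟩
  have hL : LipschitzOnWith K (f ∘ Function.invFunOn p Z) (p '' Z) :=
    LipschitzOnWith.of_dist_le_mul fun a ha b hb ↦ by
      have := h _ (hinv a ha).1 _ (hinv b hb).1
      rwa [(hinv a ha).2, (hinv b hb).2] at this
  refine (dimH_mono ?_).trans hL.dimH_image_le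
  rintro _ ⟨x, hx, rfl⟩
  refine ⟨p x, mem_image_of_mem p hx, ?_⟩
  have hx' := mem_image_of_mem p hx
  refine dist_le_zero.1 ?_
  have := h _ (hinv _ hx').1 x hx
  rwa [(hinv _ hx').2, dist_self, mul_zero] at this

/-- The relation composed of the relations `R l` for the letters `l` of a word. -/
def wordRel {E Λ : Type*} (R : Λ → E → E → Prop) : List Λ → E → E → Prop
  | [] => Eq
  | l :: w => Relation.Comp (R l) (wordRel R w)

theorem wordRel_append {E Λ : Type*} {R : Λ → E → E → Prop} {w w' : List Λ} {a b c : E}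
    (h : wordRel R w a b) (h' : wordRel R w' b c) : wordRel R (w ++ w') a c := by
  induction w generalizing a with
  | nil => cases h; exact h'
  | cons l w ih =>
    obtain ⟨d, hd, h⟩ := h
    exact ⟨d, hd, ih h⟩

/-- Each letter is the graph of a partial Lipschitz map, as a = a' forces b = b'. Constants multiply
along a word; no bound uniform in the word is claimed. -/
theorem wordRel_dist_le {E Λ : Type*} [MetricSpace E] {R : Λ → E → E → Prop}
    (hR : ∀ l, ∃ K : ℝ≥0, ∀ a b a' b', R l a b → R l a' b' → dist b b' ≤ K * dist a a')
    (w : List Λ) :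
    ∃ K : ℝ≥0, ∀ a b a' b', wordRel R w a b → wordRel R w a' b' → dist b b' ≤ K * dist a a' := by
  induction w with
  | nil => exact ⟨1, by rintro a b a' b' rfl rfl; simp⟩
  | cons l w ih =>
    obtain ⟨K, hK⟩ := hR l
    obtain ⟨K', hK'⟩ := ih
    refine ⟨K' * K, ?_⟩
    rintro a b a' b' ⟨c, hc, h⟩ ⟨c', hc', h'⟩
    calc dist b b' ≤ K' * dist c c' := hK' _ _ _ _ h h'
      _ ≤ K' * (K * dist a a') := by gcongr; exact hK _ _ _ _ hc hc'
      _ = _ := by push_cast; ring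

/-- Functions on the quotient whose pullbacks are, on countably many pieces of each box, Lipschitz
functions of the transversal coordinate. -/
def IsPiecewiseTransverselyLipschitz {M E J X : Type*} [MetricSpace E]
    (B : J → Set M) (p : J → M → E) (q : M → X) (f : X → ℝ) : Prop :=
  ∀ j, ∃ 𝒬 : Set (Set M), 𝒬.Countable ∧ B j ⊆ ⋃₀ 𝒬 ∧ ∀ Q ∈ 𝒬, ∃ K : ℝ≥0, ∀ x ∈ Q ∩ B j,
    ∀ y ∈ Q ∩ B j, dist (f (q x)) (f (q y)) ≤ K * dist (p j x) (p j y)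

/-! ### Holonomy and countability -/

namespace PlaqueAtlas

variable {M E J : Type*} [TopologicalSpace M] [MetricSpace E] {r : Setoid M}
    {B : J → Set M} {p : J → M → E} {n : ℕ}

/-- `plaque_open` is the case of a single plaque, and steps compose along a chain. Chains may be
reversed, so the induction carries both directions. -/
theorem eventually_exists_rel (h : PlaqueAtlas r B p n) {y z : M} (hyz : r y z) {O : Set M}
    (hO : O ∈ 𝓝 z) : ∀ᶠ y' in 𝓝 y, ∃ z' ∈ O, r y' z' := by
  have key : ∀ y z, Relation.EqvGen (SamePlaque B p univ) y z →
      (∀ O ∈ 𝓝 z, ∀ᶠ y' in 𝓝 y, ∃ z' ∈ O, r y' z') ∧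
      (∀ O ∈ 𝓝 y, ∀ᶠ z' in 𝓝 z, ∃ y' ∈ O, r z' y') := by
    intro y z hyz
    induction hyz with
    | rel y z hyz =>
      obtain ⟨j, -, hy, hz, he⟩ := hyz
      exact ⟨h.plaque_open j y hy z hz he, h.plaque_open j z hz y hy he.symm⟩
    | refl y =>
      have : ∀ O ∈ 𝓝 y, ∀ᶠ y' in 𝓝 y, ∃ z' ∈ O, r y' z' := fun O hO ↦ by
        filter_upwards [hO] with y' hy'
        exact ⟨y', hy', r.refl y'⟩
      exact ⟨this, this⟩
    | symm y z _ ih => exact ⟨ih.2, ih.1⟩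
    | trans x y z _ _ ih₁ ih₂ =>
      constructor
      · intro O hO
        filter_upwards [ih₁.1 _ (ih₂.1 O hO)] with x' ⟨y', ⟨z', hz', hyz'⟩, hxy'⟩
        exact ⟨z', hz', r.trans hxy' hyz'⟩
      · intro O hO
        filter_upwards [ih₂.2 _ (ih₁.2 O hO)] with x' ⟨y', ⟨z', hz', hyz'⟩, hxy'⟩
        exact ⟨z', hz', r.trans hxy' hyz'⟩
  refine (key y z (h.generated univ (fun x ↦ ?_) y z hyz)).1 O hO
  obtain ⟨j, hj, -⟩ := h.exists_transversal x
  exact ⟨j, mem_univ j, hj⟩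

theorem isOpenMap_mk (h : PlaqueAtlas r B p n) : IsOpenMap (Quotient.mk r) := by
  intro O hO
  rw [← (isQuotientMap_quotient_mk' (s := r)).isOpen_preimage, isOpen_iff_mem_nhds]
  rintro y ⟨z, hz, hzy⟩
  have hyz : r y z := r.symm (Quotient.exact hzy)
  filter_upwards [h.eventually_exists_rel hyz (hO.mem_nhds hz)] with y' ⟨z', hz', h'⟩
  exact ⟨z', hz', Quotient.sound (r.symm h')⟩

variable [SecondCountableTopology M]

theorem exists_countable_cover (h : PlaqueAtlas r B p n) :
    ∃ J₀ : Set J, J₀.Countable ∧ ∀ x, ∃ j ∈ J₀, x ∈ B j := by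
  choose j hj using fun x ↦ h.exists_transversal x
  obtain ⟨s, hs, hcov⟩ := TopologicalSpace.countable_cover_nhds
    (fun x ↦ (h.isOpen (j x)).mem_nhds (hj x).1)
  refine ⟨j '' s, hs.image j, fun x ↦ ?_⟩
  obtain ⟨y, hy, hxy⟩ := mem_iUnion₂.1 (hcov ▸ mem_univ x)
  exact ⟨j y, mem_image_of_mem j hy, hxy⟩

/-- Holonomy: being on the same leaf is described by countably many Lipschitz relations between the
transversal coordinates. -/
theorem exists_countable_holonomy (h : PlaqueAtlas r B p n) {J₀ : Set J} (hJ₀ : J₀.Countable)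
    (hcov : ∀ x, ∃ j ∈ J₀, x ∈ B j) :
    ∃ ℋ : Set (E → E → Prop), ℋ.Countable ∧
      (∀ R ∈ ℋ, ∃ K : ℝ≥0, ∀ a b a' b', R a b → R a' b' → dist b b' ≤ K * dist a a') ∧
      ∀ x y, ∀ i ∈ J₀, ∀ j ∈ J₀, r x y → x ∈ B i → y ∈ B j → ∃ R ∈ ℋ, R (p i x) (p j y) := by
  have : Countable J₀ := hJ₀.to_subtype
  choose! O hO K hK using h.lipschitz
  -- Countably many neighbourhoods with a Lipschitz coordinate change cover each overlap. A letter
  -- is a change of box inside one of them, so the alphabet, and with it the set of words, is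
  -- countable.
  have hT : ∀ i j, ∃ T ⊆ B i ∩ B j, T.Countable ∧ B i ∩ B j ⊆ ⋃ z ∈ T, O i j z := fun i j ↦
    TopologicalSpace.countable_cover_nhdsWithin fun z hz ↦ mem_nhdsWithin_of_mem_nhds (hO i j z hz)
  choose T hTB hTc hTcov using hT
  have : ∀ i j, Countable (T i j) := fun i j ↦ (hTc i j).to_subtype
  let Λ := Σ ij : J₀ × J₀, T ij.1 ij.2
  let R : Λ → E → E → Prop := fun l a b ↦
    ∃ z ∈ O l.1.1 l.1.2 l.2, p l.1.1 z = a ∧ p l.1.2 z = b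
  have hR : ∀ l, ∃ K : ℝ≥0, ∀ a b a' b', R l a b → R l a' b' → dist b b' ≤ K * dist a a' := by
    intro l
    refine ⟨K l.1.1 l.1.2 l.2, ?_⟩
    rintro _ _ _ _ ⟨z, hz, rfl, rfl⟩ ⟨z', hz', rfl, rfl⟩
    exact hK _ _ _ (hTB _ _ l.2.2) z hz z' hz'
  have hletter : ∀ x, ∀ i ∈ J₀, ∀ j ∈ J₀, x ∈ B i → x ∈ B j →
      ∃ w, wordRel R w (p i x) (p j x) := by
    intro x i hi j hj hxi hxj
    obtain ⟨z, hz, hxz⟩ := mem_iUnion₂.1 (hTcov i j ⟨hxi, hxj⟩)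
    exact ⟨[⟨(⟨i, hi⟩, ⟨j, hj⟩), ⟨z, hz⟩⟩], p j x, ⟨x, hxz, rfl, rfl⟩, rfl⟩
  have key : ∀ x y, Relation.EqvGen (SamePlaque B p J₀) x y → ∀ i ∈ J₀, ∀ j ∈ J₀,
      (x ∈ B i → y ∈ B j → ∃ w, wordRel R w (p i x) (p j y)) ∧
      (y ∈ B i → x ∈ B j → ∃ w, wordRel R w (p i y) (p j x)) := by
    intro x y hxy
    induction hxy with
    | rel x y hxy =>
      obtain ⟨k, hk, hx, hy, he⟩ := hxy
      intro i hi j hj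
      constructor
      · intro hxi hyj
        obtain ⟨w, hw⟩ := hletter x i hi k hk hxi hx
        obtain ⟨w', hw'⟩ := hletter y k hk j hj hy hyj
        exact ⟨w ++ w', wordRel_append hw (he ▸ hw')⟩
      · intro hyi hxj
        obtain ⟨w, hw⟩ := hletter y i hi k hk hyi hy
        obtain ⟨w', hw'⟩ := hletter x k hk j hj hx hxj
        exact ⟨w ++ w', wordRel_append hw (he ▸ hw')⟩
    | refl x => exact fun i hi j hj ↦ ⟨hletter x i hi j hj, hletter x i hi j hj⟩
    | symm x y _ ih => exact fun i hi j hj ↦ ⟨(ih i hi j hj).2, (ih i hi j hj).1⟩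
    | trans x y z _ _ ih₁ ih₂ =>
      obtain ⟨k, hk, hyk⟩ := hcov y
      intro i hi j hj
      constructor
      · intro hxi hzj
        obtain ⟨w, hw⟩ := (ih₁ i hi k hk).1 hxi hyk
        obtain ⟨w', hw'⟩ := (ih₂ k hk j hj).1 hyk hzj
        exact ⟨w ++ w', wordRel_append hw hw'⟩
      · intro hzi hxj
        obtain ⟨w, hw⟩ := (ih₂ i hi k hk).2 hzi hyk
        obtain ⟨w', hw'⟩ := (ih₁ k hk j hj).2 hyk hxj
        exact ⟨w ++ w', wordRel_append hw hw'⟩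
  refine ⟨range (wordRel R), countable_range _, forall_mem_range.2 (wordRel_dist_le hR), ?_⟩
  intro x y i hi j hj hxy hx hy
  obtain ⟨w, hw⟩ := (key x y (h.generated J₀ hcov x y hxy) i hi j hj).1 hx hy
  exact ⟨_, mem_range_self w, hw⟩

/-- M splits into countably many pieces, each in one box, on which all f i are Lipschitz in its
transversal coordinate. `dimH` of a countable union is the supremum over the pieces. -/
theorem dimH_range_le (h : PlaqueAtlas r B p n) {ι : Type*} [Fintype ι]
    (f : ι → Quotient r → ℝ)
    (hf : ∀ i, IsPiecewiseTransverselyLipschitz B p (Quotient.mk r) (f i)) :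
    dimH (range fun ξ i ↦ f i ξ) ≤ n := by
  obtain ⟨J₀, hJ₀, hcov⟩ := h.exists_countable_cover
  have : Countable J₀ := hJ₀.to_subtype
  choose 𝒬 h𝒬c h𝒬B h𝒬 using hf
  have : ∀ i j, Countable (𝒬 i j) := fun i j ↦ (h𝒬c i j).to_subtype
  let Z : (Σ j : J₀, ∀ i, 𝒬 i j) → Set M := fun a ↦ B a.1 ∩ ⋂ i, (a.2 i : Set M)
  let F : M → ι → ℝ := fun x i ↦ f i (Quotient.mk r x)
  have hsub : (range fun ξ i ↦ f i ξ) ⊆ ⋃ a, F '' Z a := by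
    rintro _ ⟨ξ, rfl⟩
    obtain ⟨x, rfl⟩ := Quotient.mk_surjective ξ
    obtain ⟨j, hj, hxj⟩ := hcov x
    choose Q hQ hxQ using fun i ↦ mem_sUnion.1 (h𝒬B i j hxj)
    exact mem_iUnion.2 ⟨⟨⟨j, hj⟩, fun i ↦ ⟨Q i, hQ i⟩⟩, x, ⟨hxj, mem_iInter.2 hxQ⟩, rfl⟩
  refine (dimH_mono hsub).trans ?_
  rw [dimH_iUnion]
  refine iSup_le fun a ↦ ?_
  choose K hK using fun i ↦ h𝒬 i a.1 (a.2 i) (a.2 i).2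
  refine (dimH_image_le_of_dist_le (p := p a.1) (K := Finset.univ.sup K) ?_).trans
    ((dimH_mono (image_mono inter_subset_left)).trans (h.dimH_le a.1))
  intro x hx y hy
  refine (dist_pi_le_iff (by positivity)).2 fun i ↦ ?_
  refine (hK i x ⟨mem_iInter.1 hx.2 i, hx.1⟩ y ⟨mem_iInter.1 hy.2 i, hy.1⟩).trans ?_
  gcongr
  exact Finset.le_sup (f := K) (Finset.mem_univ i)

end PlaqueAtlas

/-- The largest value of `h` on the part of `S` over `ξ`. -/
def fibreSup {M X : Type*} (q : M → X) (S : Set M) (h : M → ℝ) (ξ : X) : ℝ :=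
  sSup (h '' (S ∩ q ⁻¹' {ξ}))

theorem fibreSup_nonneg {M X : Type*} {q : M → X} {S : Set M} {h : M → ℝ}
    (hpos : ∀ z, 0 ≤ h z) (ξ : X) : 0 ≤ fibreSup q S h ξ :=
  Real.sSup_nonneg (by rintro _ ⟨z, -, rfl⟩; exact hpos z)

/-! ### Suprema over the fibres of a map to a Hausdorff space -/

section FibreSup

variable {M X : Type*} [TopologicalSpace M] [TopologicalSpace X] [T2Space X] {q : M → X}
  {S : Set M} {h : M → ℝ}

theorem isCompact_inter_fibre (hq : Continuous q) (hS : IsCompact S) (ξ : X) :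
    IsCompact (S ∩ q ⁻¹' {ξ}) :=
  hS.inter_right (isClosed_singleton.preimage hq)

theorem le_fibreSup (hq : Continuous q) (hS : IsCompact S) (hh : ContinuousOn h S) {z : M}
    (hz : z ∈ S) : h z ≤ fibreSup q S h (q z) :=
  le_csSup ((isCompact_inter_fibre hq hS _).image_of_continuousOn
    (hh.mono inter_subset_left)).bddAbove ⟨z, ⟨hz, rfl⟩, rfl⟩

/-- The first alternative covers fibres that miss S, where the supremum of the empty set is 0 by
convention; a nonempty compact fibre attains its supremum. -/
theorem fibreSup_eq_zero_or_exists (hq : Continuous q) (hS : IsCompact S) (hh : ContinuousOn h S)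
    (ξ : X) : fibreSup q S h ξ = 0 ∨ ∃ z ∈ S, q z = ξ ∧ fibreSup q S h ξ = h z := by
  rcases (S ∩ q ⁻¹' {ξ}).eq_empty_or_nonempty with he | hne
  · left; simp [fibreSup, he]
  · right
    obtain ⟨z, hz, hzh⟩ := (isCompact_inter_fibre hq hS ξ).exists_sSup_image_eq hne
      (hh.mono inter_subset_left)
    exact ⟨z, hz.1, hz.2, hzh⟩

/-- Closed superlevel sets of positive level are images of compact sets, hence closed in a Hausdorff
space. Openness of the strict superlevel sets is what `hopen` supplies; the remaining levels are
trivial by nonnegativity. -/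
theorem continuous_fibreSup (hq : Continuous q) (hS : IsCompact S) (hh : ContinuousOn h S)
    (hpos : ∀ z, 0 ≤ h z) (hopen : ∀ a : ℝ, 0 ≤ a → IsOpen (q '' {z ∈ S | a < h z})) :
    Continuous (fibreSup q S h) := by
  rw [continuous_iff_lower_upperSemicontinuous]
  constructor
  · rw [lowerSemicontinuous_iff_isOpen_preimage]
    intro a
    rcases lt_or_ge a 0 with ha | ha
    · convert isOpen_univ
      exact eq_univ_of_forall fun ξ ↦ ha.trans_le (fibreSup_nonneg hpos ξ)
    · convert hopen a ha using 1
      ext ξ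
      constructor
      · intro hξ
        have hξ' : a < fibreSup q S h ξ := hξ
        rcases fibreSup_eq_zero_or_exists hq hS hh ξ with h0 | ⟨z, hz, rfl, hzh⟩
        · linarith
        · exact ⟨z, ⟨hz, hzh ▸ hξ'⟩, rfl⟩
      · rintro ⟨z, ⟨hz, hza⟩, rfl⟩
        exact hza.trans_le (le_fibreSup hq hS hh hz)
  · rw [upperSemicontinuous_iff_isClosed_preimage]
    intro a
    rcases le_or_gt a 0 with ha | ha
    · convert isClosed_univ
      exact eq_univ_of_forall fun ξ ↦ ha.trans (fibreSup_nonneg hpos ξ)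
    · have : fibreSup q S h ⁻¹' Ici a = q '' (S ∩ h ⁻¹' Ici a) := by
        ext ξ
        constructor
        · intro hξ
          have hξ' : a ≤ fibreSup q S h ξ := hξ
          rcases fibreSup_eq_zero_or_exists hq hS hh ξ with h0 | ⟨z, hz, rfl, hzh⟩
          · linarith
          · exact ⟨z, ⟨hz, by rw [hzh] at hξ'; exact hξ'⟩, rfl⟩
        · rintro ⟨z, ⟨hz, hza⟩, rfl⟩
          exact (show a ≤ h z from hza).trans (le_fibreSup hq hS hh hz)
      rw [this]
      have hcl : IsCompact (S ∩ h ⁻¹' Ici a) := by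
        obtain ⟨C, hC, hCe⟩ := continuousOn_iff_isClosed.1 hh (Ici a) isClosed_Ici
        rw [inter_comm, hCe, inter_comm]
        exact hS.inter_right hC
      exact (hcl.image hq).isClosed

end FibreSup

/-! ### Separating functions on the leaf space -/

namespace PlaqueAtlas

variable {M E J : Type*} [TopologicalSpace M] [SecondCountableTopology M]
  [MetricSpace E] {r : Setoid M} {B : J → Set M} {p : J → M → E} {n : ℕ}

/-- A leaf may meet the transversal S at several points, so a bump in the transversal coordinate is
made a function of the leaf by taking its maximum over those points. The maximum is attained at some
z in S, whose coordinate is related to that of any other point of the leaf by one of countably many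
holonomy relations; this gives the Lipschitz pieces. -/
theorem exists_separating_function (h : PlaqueAtlas r B p n) [T2Space (Quotient r)]
    (ξ : Quotient r) {O : Set (Quotient r)} (hO : IsOpen O) (hξ : ξ ∈ O) :
    ∃ f : Quotient r → ℝ, Continuous f ∧ (∀ η, 0 ≤ f η) ∧ 0 < f ξ ∧ (∀ η, f η ≠ 0 → η ∈ O) ∧
      IsPiecewiseTransverselyLipschitz B p (Quotient.mk r) f := by
  obtain ⟨x, rfl⟩ := Quotient.mk_surjective ξ
  have hq : Continuous (Quotient.mk r) := continuous_quotient_mk'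
  obtain ⟨j₁, hxj, S, hSB, hS, hxS, hinj, ε₁, hε₁, hsurj⟩ := h.exists_transversal x
  have hpS : ContinuousOn (p j₁) S := (h.continuousOn j₁).mono hSB
  obtain ⟨ε, hε, hεO, hεε₁⟩ : ∃ ε > 0,
      (∀ z ∈ S, dist (p j₁ z) (p j₁ x) < ε → Quotient.mk r z ∈ O) ∧ ε ≤ ε₁ := by
    -- Injectivity of the coordinate on S separates x from this compact image, which leaves room for
    -- the support of the bump.
    have hC : IsCompact (p j₁ '' (S \ Quotient.mk r ⁻¹' O)) :=
      (hS.diff (hO.preimage hq)).image_of_continuousOn (hpS.mono sdiff_subset)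
    have hx : p j₁ x ∈ (p j₁ '' (S \ Quotient.mk r ⁻¹' O))ᶜ := by
      rintro ⟨z, hz, hzx⟩
      exact hz.2 (hinj hz.1 hxS hzx ▸ hξ)
    obtain ⟨ε, hε, hball⟩ := Metric.isOpen_iff.1 hC.isClosed.isOpen_compl _ hx
    refine ⟨min ε ε₁, lt_min hε hε₁, fun z hz hzε ↦ ?_, min_le_right _ _⟩
    by_contra hzO
    exact hball (Metric.mem_ball.2 (hzε.trans_le (min_le_left _ _))) ⟨z, ⟨hz, hzO⟩, rfl⟩
  let ρ : E → ℝ := fun a ↦ max 0 (ε - dist a (p j₁ x))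
  have hρL : ∀ a b, dist (ρ a) (ρ b) ≤ dist a b := by
    intro a b
    have : LipschitzWith 1 ρ := by
      refine LipschitzWith.const_max ?_ 0
      simpa using (LipschitzWith.const (α := E) ε).sub (LipschitzWith.dist_left (p j₁ x))
    simpa using this.dist_le_mul a b
  have hρc : Continuous ρ := by fun_prop
  let g : M → ℝ := fun z ↦ ρ (p j₁ z)
  have hgpos : ∀ z, 0 ≤ g z := fun z ↦ le_max_left _ _
  have hgB : ContinuousOn g (B j₁) := hρc.comp_continuousOn (h.continuousOn j₁)
  have hgS : ContinuousOn g S := hgB.mono hSB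
  refine ⟨fibreSup (Quotient.mk r) S g, continuous_fibreSup hq hS hgS hgpos ?_,
    fibreSup_nonneg hgpos, ?_, ?_, ?_⟩
  · intro a ha
    -- S is not open, but the bump lives over coordinates that S attains. Sliding along plaques
    -- replaces S by the open box, and the quotient map is open.
    have : Quotient.mk r '' {z ∈ S | a < g z} = Quotient.mk r '' {z ∈ B j₁ | a < g z} := by
      apply Subset.antisymm (image_mono (inter_subset_inter_left _ hSB))
      rintro _ ⟨z, ⟨hz, hza⟩, rfl⟩
      have hza' : a < ρ (p j₁ z) := hza
      have hzε : dist (p j₁ z) (p j₁ x) < ε₁ := by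
        rcases lt_max_iff.1 hza' with h1 | h1 <;> linarith
      obtain ⟨z', hz', he⟩ := hsurj z hz hzε
      refine ⟨z', ⟨hz', ?_⟩, Quotient.sound (h.rel j₁ z' (hSB hz') z hz he)⟩
      rw [← he] at hza'
      exact hza'
    rw [this]
    exact h.isOpenMap_mk _ (hgB.isOpen_inter_preimage (h.isOpen j₁) isOpen_Ioi)
  · refine lt_of_lt_of_le ?_ (le_fibreSup hq hS hgS hxS)
    simp [g, ρ, hε]
  · intro η hη
    rcases fibreSup_eq_zero_or_exists hq hS hgS η with h0 | ⟨z, hz, rfl, hzh⟩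
    · exact absurd h0 hη
    · refine hεO z hz ?_
      by_contra hcon
      refine hη (hzh.trans ?_)
      simp only [g, ρ]
      exact max_eq_left (by linarith)
  · intro j
    obtain ⟨J₀, hJ₀, hcov⟩ := h.exists_countable_cover
    obtain ⟨ℋ, hHc, hHL, hH⟩ := h.exists_countable_holonomy (J₀ := insert j (insert j₁ J₀))
      ((hJ₀.insert _).insert _)
      (fun x ↦ (hcov x).imp fun k hk ↦ ⟨mem_insert_of_mem _ (mem_insert_of_mem _ hk.1), hk.2⟩)
    let f := fibreSup (Quotient.mk r) S g
    -- The points are sorted by the holonomy relation leading to a maximiser. On one piece the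
    -- Lipschitz constant of R bounds the variation, since the bump is 1-Lipschitz.
    let Q : (E → E → Prop) → Set M := fun R ↦
      {y | ∃ z ∈ S, R (p j y) (p j₁ z) ∧ f (Quotient.mk r y) = g z}
    refine ⟨insert {y | f (Quotient.mk r y) = 0} (Q '' ℋ), (hHc.image Q).insert _, ?_, ?_⟩
    · intro y hy
      rcases fibreSup_eq_zero_or_exists hq hS hgS (Quotient.mk r y) with h0 | ⟨z, hz, hzy, hzh⟩
      · exact mem_sUnion.2 ⟨_, mem_insert _ _, h0⟩
      · obtain ⟨R, hR, hRyz⟩ := hH y z j (mem_insert _ _) j₁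
          (mem_insert_of_mem _ (mem_insert _ _)) (r.symm (Quotient.exact hzy)) hy (hSB hz)
        exact mem_sUnion.2 ⟨Q R, mem_insert_of_mem _ (mem_image_of_mem Q hR), z, hz, hRyz, hzh⟩
    · rintro _ (rfl | ⟨R, hR, rfl⟩)
      · refine ⟨0, fun y hy y' hy' ↦ ?_⟩
        have h1 : f (Quotient.mk r y) = 0 := hy.1
        have h2 : f (Quotient.mk r y') = 0 := hy'.1
        change dist (f (Quotient.mk r y)) (f (Quotient.mk r y')) ≤ _
        simp [h1, h2]
      · obtain ⟨K, hK⟩ := hHL R hR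
        refine ⟨K, ?_⟩
        rintro y ⟨⟨z, hz, hRz, hfz⟩, -⟩ y' ⟨⟨z', hz', hRz', hfz'⟩, -⟩
        change dist (f (Quotient.mk r y)) (f (Quotient.mk r y')) ≤ _
        rw [hfz, hfz']
        exact (hρL _ _).trans (hK _ _ _ _ hRz hRz')

theorem coveringDimLE (h : PlaqueAtlas r B p n) [T2Space (Quotient r)] {A : Set (Quotient r)}
    (hA : IsCompact A) : CoveringDimLE A (n : ℕ) := by
  have : CompactSpace A := isCompact_iff_compactSpace.1 hA
  let L : Set (A → ℝ) := {f | ∃ g : Quotient r → ℝ, Continuous g ∧ (∀ η, 0 ≤ g η) ∧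
    IsPiecewiseTransverselyLipschitz B p (Quotient.mk r) g ∧ f = fun a ↦ g a.1}
  refine coveringDimLE_of_dimH_le L ?_ ?_ ?_ ?_
  · rintro _ ⟨g, hg, -, -, rfl⟩
    exact hg.comp continuous_subtype_val
  · rintro _ ⟨g, -, hg, -, rfl⟩ x
    exact hg x
  · rintro x O hO hx
    obtain ⟨O', hO', rfl⟩ := isOpen_induced_iff.1 hO
    obtain ⟨g, h1, h2, h3, h4, h5⟩ := h.exists_separating_function x.1 hO' hx
    exact ⟨fun a ↦ g a.1, ⟨g, h1, h2, h5, rfl⟩, h3, fun y hy ↦ h4 y hy⟩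
  · intro ι _ f hf
    choose g h1 h2 h3 h4 using hf
    refine (dimH_mono ?_).trans (h.dimH_range_le g h3)
    rintro _ ⟨a, rfl⟩
    exact ⟨a, funext fun i ↦ (congrFun (h4 i) a).symm⟩

end PlaqueAtlas

end PlaqueAtlas

/-! ### The flow of a bounded Lipschitz vector field with a transverse linear form -/

section TransverseFlow

variable {E : Type*} [NormedAddCommGroup E] [NormedSpace ℝ E]

/-- The global bound on w lets Picard–Lindelöf run on [-a, a] for every a, with a ball of radius L *
a. By uniqueness these solutions agree, and near t the glued curve is the solution for |t| + 2. -/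
theorem exists_integralCurve_of_lipschitzWith [CompleteSpace E] {w : E → E} {K L : ℝ≥0}
    (hK : LipschitzWith K w) (hL : ∀ x, ‖w x‖ ≤ L) (x : E) :
    ∃ β : ℝ → E, β 0 = x ∧ ∀ t, HasDerivAt β (w (β t)) t := by
  have hloc : ∀ a : ℝ, 0 < a → ∃ β : ℝ → E, β 0 = x ∧
      ∀ t ∈ Ioo (-a) a, HasDerivAt β (w (β t)) t := by
    intro a ha
    have hPL : IsPicardLindelof (fun _ ↦ w) (tmin := -a) (tmax := a)
        ⟨0, by constructor <;> linarith⟩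
        x (L * a.toNNReal) 0 L K :=
      { lipschitzOnWith := fun t _ ↦ hK.lipschitzOnWith
        continuousOn := fun _ _ ↦ continuousOn_const
        norm_le := fun _ _ y _ ↦ hL y
        mul_max_le := by simp [ha.le] }
    obtain ⟨β, h0, hβ⟩ := hPL.exists_eq_forall_mem_Icc_hasDerivWithinAt₀
    exact ⟨β, h0, fun t ht ↦ (hβ t (Ioo_subset_Icc_self ht)).hasDerivAt (Icc_mem_nhds ht.1 ht.2)⟩
  choose! β hβ0 hβ using hloc
  have heq : ∀ a b, 0 < a → a ≤ b → EqOn (β a) (β b) (Ioo (-a) a) := by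
    intro a b ha hab
    refine ODE_solution_unique_of_mem_Ioo (v := fun _ ↦ w) (s := fun _ ↦ univ) (K := K) (t₀ := 0)
      (fun t _ ↦ hK.lipschitzOnWith) (by constructor <;> linarith)
      (fun t ht ↦ ⟨hβ a ha t ht, trivial⟩)
      (fun t ht ↦ ⟨hβ b (ha.trans_le hab) t ⟨by linarith [ht.1], by linarith [ht.2]⟩, trivial⟩) ?_
    rw [hβ0 a ha, hβ0 b (ha.trans_le hab)]
  have hmem : ∀ t : ℝ, t ∈ Ioo (-(|t| + 1)) (|t| + 1) := fun t ↦ abs_lt.1 (by linarith)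
  refine ⟨fun t ↦ β (|t| + 1) t, by simpa using hβ0 1 one_pos, fun t ↦ ?_⟩
  have hev : (fun s ↦ β (|s| + 1) s) =ᶠ[𝓝 t] β (|t| + 2) := by
    have : ∀ᶠ s in 𝓝 t, |s| < |t| + 1 :=
      (continuous_abs.tendsto t).eventually_lt_const (by linarith)
    filter_upwards [this] with s hs
    exact heq _ _ (by positivity) (by linarith) (hmem s)
  have hd := hβ (|t| + 2) (by positivity) t (abs_lt.1 (by linarith))
  have hval : β (|t| + 1) t = β (|t| + 2) t := heq _ _ (by positivity) (by linarith) (hmem t)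
  simp only [hval]
  exact hd.congr_of_eventuallyEq hev

/-- `α` is the flow of the bounded Lipschitz field `w`, and `ℓ (w x) = 1` everywhere. -/
structure IsTransverseFlow (ℓ : E →L[ℝ] ℝ) (w : E → E) (α : E → ℝ → E) (K L : ℝ≥0) : Prop where
  lipschitzWith : LipschitzWith K w
  norm_le : ∀ x, ‖w x‖ ≤ L
  normalized : ∀ x, ℓ (w x) = 1
  zero : ∀ x, α x 0 = x
  hasDerivAt : ∀ x t, HasDerivAt (α x) (w (α x t)) t

/-- The projection along the flow lines of `α` onto the hyperplane `ℓ = c`. -/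
def flowProj (ℓ : E →L[ℝ] ℝ) (α : E → ℝ → E) (c : ℝ) (x : E) : E := α x (c - ℓ x)

namespace IsTransverseFlow

variable {ℓ : E →L[ℝ] ℝ} {w : E → E} {α : E → ℝ → E} {K L : ℝ≥0}

theorem eq_of_hasDerivAt (h : IsTransverseFlow ℓ w α K L) {β γ : ℝ → E}
    (hβ : ∀ t, HasDerivAt β (w (β t)) t) (hγ : ∀ t, HasDerivAt γ (w (γ t)) t) (h0 : β 0 = γ 0) :
    β = γ :=
  ODE_solution_unique_univ (v := fun _ ↦ w) (s := fun _ ↦ univ) (t₀ := 0)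
    (fun _ ↦ h.lipschitzWith.lipschitzOnWith) (fun t ↦ ⟨hβ t, trivial⟩)
    (fun t ↦ ⟨hγ t, trivial⟩) h0

theorem add (h : IsTransverseFlow ℓ w α K L) (x : E) (s t : ℝ) : α (α x s) t = α x (s + t) := by
  refine congrFun (h.eq_of_hasDerivAt (h.hasDerivAt (α x s)) (γ := fun t ↦ α x (s + t))
    (fun t ↦ ?_) (by simp [h.zero])) t
  exact (h.hasDerivAt x (s + t)).comp_const_add s t

theorem dist_le_abs (h : IsTransverseFlow ℓ w α K L) (x : E) (s t : ℝ) :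
    dist (α x s) (α x t) ≤ L * |s - t| := by
  have := Convex.norm_image_sub_le_of_norm_hasDerivWithin_le (f := α x) (C := L) (s := univ)
    (fun t _ ↦ (h.hasDerivAt x t).hasDerivWithinAt) (fun t _ ↦ h.norm_le _) convex_univ
    (mem_univ t) (mem_univ s)
  rwa [dist_eq_norm, ← Real.norm_eq_abs]

/-- The normalization turns ℓ into a clock, which is why `flowProj` uses the time c - ℓ x. -/
theorem form_apply (h : IsTransverseFlow ℓ w α K L) (x : E) (t : ℝ) : ℓ (α x t) = ℓ x + t := by
  have hd : ∀ t, HasDerivAt (fun t ↦ ℓ (α x t) - t) 0 t := fun t ↦ by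
    have := (ℓ.hasFDerivAt.comp_hasDerivAt t (h.hasDerivAt x t)).sub (hasDerivAt_id t)
    rw [h.normalized, sub_self] at this
    exact this
  have := is_const_of_deriv_eq_zero (fun t ↦ (hd t).differentiableAt) (fun t ↦ (hd t).deriv) t 0
  simp only [h.zero, sub_zero] at this
  linarith

theorem dist_le_of_nonneg (h : IsTransverseFlow ℓ w α K L) (x y : E) {t : ℝ} (ht : 0 ≤ t) :
    dist (α x t) (α y t) ≤ dist x y * Real.exp (K * t) := by
  have := dist_le_of_trajectories_ODE (v := fun _ ↦ w) (K := K) (a := 0) (b := t) (f := α x)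
    (g := α y) (δ := dist x y) (fun _ ↦ h.lipschitzWith)
    (fun s _ ↦ (h.hasDerivAt x s).continuousAt.continuousWithinAt)
    (fun s _ ↦ (h.hasDerivAt x s).hasDerivWithinAt)
    (fun s _ ↦ (h.hasDerivAt y s).continuousAt.continuousWithinAt)
    (fun s _ ↦ (h.hasDerivAt y s).hasDerivWithinAt) (by rw [h.zero, h.zero]) t ⟨ht, le_rfl⟩
  simpa using this

/-- Transfers forward estimates to negative times; reversing w requires replacing ℓ by -ℓ. -/
theorem reverse (h : IsTransverseFlow ℓ w α K L) :
    IsTransverseFlow (-ℓ) (fun x ↦ -w x) (fun x t ↦ α x (-t)) K L where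
  lipschitzWith := h.lipschitzWith.neg
  norm_le x := by simpa using h.norm_le x
  normalized x := by simp [h.normalized]
  zero x := by simp [h.zero]
  hasDerivAt x t := by
    have := (h.hasDerivAt x (-t)).scomp t (hasDerivAt_neg t)
    rw [neg_one_smul] at this
    exact this

theorem dist_le (h : IsTransverseFlow ℓ w α K L) (x y : E) (t : ℝ) :
    dist (α x t) (α y t) ≤ dist x y * Real.exp (K * |t|) := by
  rcases le_total 0 t with ht | ht
  · rw [abs_of_nonneg ht]; exact h.dist_le_of_nonneg x y ht
  · rw [abs_of_nonpos ht]
    simpa using h.reverse.dist_le_of_nonneg x y (t := -t) (by linarith)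

theorem flowProj_flow (h : IsTransverseFlow ℓ w α K L) (c : ℝ) (x : E) (s : ℝ) :
    flowProj ℓ α c (α x s) = flowProj ℓ α c x := by
  rw [flowProj, flowProj, h.add, h.form_apply]
  congr 1; ring

theorem form_flowProj (h : IsTransverseFlow ℓ w α K L) (c : ℝ) (x : E) :
    ℓ (flowProj ℓ α c x) = c := by
  rw [flowProj, h.form_apply]; ring

theorem flowProj_of_form_eq (h : IsTransverseFlow ℓ w α K L) {c : ℝ} {x : E} (hx : ℓ x = c) :
    flowProj ℓ α c x = x := by
  rw [flowProj, hx, sub_self, h.zero]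

theorem flow_flowProj (h : IsTransverseFlow ℓ w α K L) (c : ℝ) (x : E) (s : ℝ) :
    α (flowProj ℓ α c x) (s - c) = α x (s - ℓ x) := by
  rw [flowProj, h.add]; congr 1; ring

theorem eq_flow_of_flowProj_eq (h : IsTransverseFlow ℓ w α K L) {c : ℝ} {x y : E}
    (hxy : flowProj ℓ α c x = flowProj ℓ α c y) : y = α x (ℓ y - ℓ x) := by
  have h1 := h.flow_flowProj c x (ℓ y)
  have h2 := h.flow_flowProj c y (ℓ y)
  rw [hxy] at h1
  rw [sub_self, h.zero] at h2
  rw [← h1, h2]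

/-- The point x enters twice: as starting point, costing the Gronwall factor, and through the
hitting time, costing L * ‖ℓ‖. The Gronwall factor is controlled only for bounded times, hence the
restriction to a ball. -/
theorem exists_lipschitzOnWith_flowProj (h : IsTransverseFlow ℓ w α K L) (u : E) (R : ℝ) :
    ∃ C, LipschitzOnWith C (flowProj ℓ α (ℓ u)) (Metric.closedBall u R) := by
  refine ⟨(Real.exp (K * (‖ℓ‖ * R))).toNNReal + L * ‖ℓ‖₊,
    LipschitzOnWith.of_dist_le_mul fun x hx y hy ↦ ?_⟩
  have habs : |ℓ u - ℓ x| ≤ ‖ℓ‖ * R := by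
    rw [← map_sub, ← Real.norm_eq_abs]
    refine (ℓ.le_opNorm _).trans ?_
    gcongr
    rw [← dist_eq_norm, dist_comm]; exact hx
  calc dist (flowProj ℓ α (ℓ u) x) (flowProj ℓ α (ℓ u) y)
      ≤ dist (α x (ℓ u - ℓ x)) (α y (ℓ u - ℓ x)) + dist (α y (ℓ u - ℓ x)) (α y (ℓ u - ℓ y)) :=
        dist_triangle _ _ _
    _ ≤ dist x y * Real.exp (K * (‖ℓ‖ * R)) + L * (‖ℓ‖ * dist x y) := by
        refine add_le_add ((h.dist_le _ _ _).trans ?_) ((h.dist_le_abs _ _ _).trans ?_)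
        · gcongr
        · gcongr
          rw [sub_sub_sub_cancel_left, ← map_sub, ← Real.norm_eq_abs, dist_comm, dist_eq_norm]
          exact ℓ.le_opNorm _
    _ = _ := by
        push_cast
        rw [Real.coe_toNNReal _ (Real.exp_nonneg _)]; ring

theorem continuous_flowProj (h : IsTransverseFlow ℓ w α K L) (u : E) :
    Continuous (flowProj ℓ α (ℓ u)) := by
  refine continuous_iff_continuousAt.2 fun x ↦ ?_
  obtain ⟨C, hC⟩ := h.exists_lipschitzOnWith_flowProj u (dist x u + 1)
  exact hC.continuousOn.continuousAt
    (Metric.closedBall_mem_nhds_of_mem (Metric.mem_ball.2 (by linarith)))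

theorem continuous_flow_left (h : IsTransverseFlow ℓ w α K L) (t : ℝ) :
    Continuous (fun x ↦ α x t) := by
  have : LipschitzWith (Real.exp (K * |t|)).toNNReal (fun x ↦ α x t) :=
    LipschitzWith.of_dist_le_mul fun x y ↦ by
      rw [Real.coe_toNNReal _ (Real.exp_nonneg _), mul_comm]
      exact h.dist_le x y t
  exact this.continuous

theorem contDiff_flow [CompleteSpace E] (h : IsTransverseFlow ℓ w α K L) (hw : ContDiff ℝ ∞ w)
    (x : E) : ContDiff ℝ ∞ (α x) := by
  rw [contDiff_iff_contDiffAt]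
  intro t
  have hon : ContDiffOn ℝ ((⊤ : ℕ∞) : WithTop ℕ∞) (α x) (Icc (t - 1) (t + 1)) :=
    ODE.contDiffOn_enat_Icc_of_hasDerivWithinAt (f := fun _ ↦ w) (u := univ)
      (hw.comp contDiff_snd).contDiffOn (fun s _ ↦ (h.hasDerivAt x s).hasDerivWithinAt)
      (fun _ _ ↦ mem_univ _)
  exact hon.contDiffAt (Icc_mem_nhds (by linarith) (by linarith))

open Asymptotics in
/-- The projection along flow lines has zero derivative along curves that are tangent to the flow
lines to first order. -/
theorem hasDerivWithinAt_flowProj_comp (h : IsTransverseFlow ℓ w α K L) (u : E) {c : ℝ → E}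
    {J : Set ℝ} {s₀ : ℝ}
    (hO : (fun s ↦ c s - c s₀) =O[𝓝[J] s₀] fun s ↦ s - s₀)
    (ho : (fun s ↦ c s - c s₀ - ℓ (c s - c s₀) • w (c s₀)) =o[𝓝[J] s₀] fun s ↦ s - s₀) :
    HasDerivWithinAt (fun s ↦ flowProj ℓ α (ℓ u) (c s)) 0 J s₀ := by
  -- Flowing from c s₀ for time σ s reproduces c s up to o(s - s₀). The projection is constant on
  -- that flow line and locally Lipschitz, so it changes only by o(s - s₀) along c.
  set σ : ℝ → ℝ := fun s ↦ ℓ (c s - c s₀) with hσ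
  have hσO : σ =O[𝓝[J] s₀] fun s ↦ s - s₀ := (ℓ.isBigO_comp _ _).trans hO
  have hs0 : Tendsto (fun s ↦ s - s₀) (𝓝[J] s₀) (𝓝 0) := by
    have : Tendsto (fun s : ℝ ↦ s - s₀) (𝓝 s₀) (𝓝 (s₀ - s₀)) :=
      (continuous_id.sub continuous_const).tendsto s₀
    rw [sub_self] at this
    exact this.mono_left nhdsWithin_le_nhds
  have hσ0 : Tendsto σ (𝓝[J] s₀) (𝓝 0) := hσO.trans_tendsto hs0
  have hc : Tendsto c (𝓝[J] s₀) (𝓝 (c s₀)) := by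
    have := (hO.trans_tendsto hs0).add_const (c s₀)
    simpa using this
  have hα : Tendsto (fun s ↦ α (c s₀) (σ s)) (𝓝[J] s₀) (𝓝 (c s₀)) := by
    have h1 : Tendsto (α (c s₀)) (𝓝 0) (𝓝 (α (c s₀) 0)) := (h.hasDerivAt (c s₀) 0).continuousAt
    rw [h.zero] at h1
    exact h1.comp hσ0
  have hαd : (fun s ↦ α (c s₀) (σ s) - c s₀ - σ s • w (c s₀)) =o[𝓝[J] s₀] fun s ↦ s - s₀ := by
    have h1 := (hasDerivAt_iff_isLittleO.1 (h.hasDerivAt (c s₀) 0)).comp_tendsto hσ0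
    simp only [Function.comp_def, h.zero, sub_zero] at h1
    exact h1.trans_isBigO hσO
  have hdiff : (fun s ↦ c s - α (c s₀) (σ s)) =o[𝓝[J] s₀] fun s ↦ s - s₀ := by
    refine (ho.sub hαd).congr_left fun s ↦ ?_
    simp only [hσ]; abel
  obtain ⟨C, hC⟩ := h.exists_lipschitzOnWith_flowProj u (dist (c s₀) u + 1)
  have hball : Metric.closedBall u (dist (c s₀) u + 1) ∈ 𝓝 (c s₀) :=
    Metric.closedBall_mem_nhds_of_mem (Metric.mem_ball.2 (by linarith))
  rw [hasDerivWithinAt_iff_isLittleO]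
  simp only [smul_zero, sub_zero]
  refine IsBigO.trans_isLittleO (IsBigO.of_bound C ?_) hdiff
  filter_upwards [hc hball, hα hball] with s h1 h2
  have := hC.dist_le_mul _ h1 _ h2
  rwa [h.flowProj_flow, dist_eq_norm, dist_eq_norm] at this

end IsTransverseFlow

/-- A vector field with `ℓ w = 1` near `u` agrees near `u` with one that has a global flow. -/
theorem exists_isTransverseFlow [FiniteDimensional ℝ E] {ℓ : E →L[ℝ] ℝ} {w : E → E} {u : E}
    {O : Set E} (hO : O ∈ 𝓝 u) (hw : ContDiffOn ℝ ∞ w O) (hℓ : ∀ x ∈ O, ℓ (w x) = 1) :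
    ∃ (w' : E → E) (α : E → ℝ → E) (K L : ℝ≥0), ContDiff ℝ ∞ w' ∧ w' =ᶠ[𝓝 u] w ∧
      IsTransverseFlow ℓ w' α K L := by
  have : CompleteSpace E := FiniteDimensional.complete ℝ E
  obtain ⟨ε, hε, hεO⟩ := Metric.nhds_basis_closedBall.mem_iff.1 (interior_mem_nhds.2 hO)
  let b : ContDiffBump u := ⟨ε / 2, ε, by positivity, by linarith⟩
  -- Cutting off the difference from w u, rather than w itself, preserves ℓ = 1 everywhere.
  let w' : E → E := fun x ↦ w u + b x • (w x - w u)
  have hint : ∀ x ∈ interior O, ContDiffAt ℝ ∞ w x := fun x hx ↦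
    hw.contDiffAt (mem_interior_iff_mem_nhds.1 hx)
  have hw' : ContDiff ℝ ∞ w' := by
    refine contDiff_const.add (contDiff_iff_contDiffAt.2 fun x ↦ ?_)
    by_cases hx : x ∈ interior O
    · exact b.contDiff.contDiffAt.smul ((hint x hx).sub contDiffAt_const)
    · have hx' : x ∉ tsupport b := fun h ↦ hx (hεO (b.tsupport_eq ▸ h))
      refine (contDiffAt_const (c := (0 : E))).congr_of_eventuallyEq ?_
      filter_upwards [notMem_tsupport_iff_eventuallyEq.1 hx'] with y hy
      simp [hy]
  have hsupp : HasCompactSupport fun x ↦ b x • (w x - w u) := b.hasCompactSupport.smul_right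
  have hcs : ContDiff ℝ ∞ fun x ↦ b x • (w x - w u) := by
    have := hw'.sub (contDiff_const (c := w u))
    simpa only [w', add_sub_cancel_left] using this
  have hL : ∃ L : ℝ≥0, ∀ x, ‖w' x‖ ≤ L := by
    obtain ⟨C, hC⟩ := hsupp.exists_bound_of_continuous hcs.continuous
    refine ⟨‖w u‖₊ + C.toNNReal, fun x ↦ ?_⟩
    refine (norm_add_le _ _).trans ?_
    push_cast
    exact add_le_add le_rfl ((hC x).trans (Real.le_coe_toNNReal C))
  have hK : ∃ K : ℝ≥0, LipschitzWith K w' := by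
    obtain ⟨K, hK⟩ :=
      (hcs.of_le (by norm_cast : (1 : WithTop ℕ∞) ≤ ∞)).lipschitzWith_of_hasCompactSupport
      hsupp one_ne_zero
    exact ⟨0 + K, (LipschitzWith.const (w u)).add hK⟩
  obtain ⟨L, hL⟩ := hL
  obtain ⟨K, hK⟩ := hK
  choose α hα0 hα using exists_integralCurve_of_lipschitzWith hK hL
  refine ⟨w', α, K, L, hw', ?_, hK, hL, fun x ↦ ?_, hα0, hα⟩
  · filter_upwards [Metric.closedBall_mem_nhds u b.rIn_pos] with x hx
    simp [w', b.one_of_mem_closedBall hx]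
  · have hu1 : ℓ (w u) = 1 := hℓ u (mem_of_mem_nhds hO)
    by_cases hx : x ∈ O
    · simp [w', hu1, hℓ x hx]
    · have : b x = 0 := by
        by_contra hne
        exact hx (interior_subset (hεO (b.tsupport_eq ▸ subset_tsupport _ hne)))
      simp [w', this, hu1]

end TransverseFlow

/-! ### Evolution of tangential curves under a projectable vector field -/

section TangentialGronwall

variable {E : Type*} [NormedAddCommGroup E] [NormedSpace ℝ E]

theorem gronwallBound_le_exp_mul_add {δ K ε x T : ℝ} (hK : 1 ≤ K) (hδ : 0 ≤ δ) (hε : 0 ≤ ε)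
    (hxT : x ≤ T) : gronwallBound δ K ε x ≤ Real.exp (K * T) * (δ + ε) := by
  rw [gronwallBound_of_K_ne_0 (by linarith)]
  have h1 : Real.exp (K * x) ≤ Real.exp (K * T) := Real.exp_le_exp.2 (by nlinarith)
  have h2 : ε / K ≤ ε := div_le_self hε hK
  have h3 : 0 ≤ ε / K := by positivity
  have h4 := Real.exp_pos (K * T)
  calc δ * Real.exp (K * x) + ε / K * (Real.exp (K * x) - 1)
      ≤ δ * Real.exp (K * T) + ε / K * Real.exp (K * T) := by
        gcongr; linarith
    _ ≤ δ * Real.exp (K * T) + ε * Real.exp (K * T) := by gcongr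
    _ = _ := by ring

/-- Class C² makes the derivative locally Lipschitz; the mean value inequality on a segment then
yields the second-order remainder. -/
theorem exists_quadratic_bound {v : E → E} {u : E} (hv : ContDiffAt ℝ 2 v u) :
    ∃ r > 0, ∃ C : ℝ, 1 ≤ C ∧ (∀ x ∈ Metric.ball u r, DifferentiableAt ℝ v x) ∧
      (∀ x ∈ Metric.ball u r, ‖fderiv ℝ v x‖ ≤ C) ∧
      ∀ x ∈ Metric.ball u r, ∀ y ∈ Metric.ball u r,
        ‖v y - v x - fderiv ℝ v x (y - x)‖ ≤ C * ‖y - x‖ ^ 2 := by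
  have h1 : ContDiffAt ℝ 1 (fderiv ℝ v) u := hv.fderiv_right (by norm_num)
  obtain ⟨K, s, hs, hK⟩ := h1.exists_lipschitzOnWith
  have hd : ∀ᶠ x in 𝓝 u, DifferentiableAt ℝ v x := by
    filter_upwards [hv.eventually (by simp)] with x hx
    exact hx.differentiableAt (by simp)
  obtain ⟨r, hr, hball⟩ := Metric.mem_nhds_iff.1 (Filter.inter_mem hs hd)
  refine ⟨r, hr, max 1 (max K (‖fderiv ℝ v u‖ + K * r)), le_max_left _ _,
    fun x hx ↦ (hball hx).2, fun x hx ↦ ?_, fun x hx y hy ↦ ?_⟩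
  · have := hK.dist_le_mul _ (hball hx).1 _ (hball (Metric.mem_ball_self hr)).1
    rw [dist_eq_norm] at this
    have h3 : ‖fderiv ℝ v x‖ ≤ ‖fderiv ℝ v u‖ + ‖fderiv ℝ v x - fderiv ℝ v u‖ := by
      rw [add_comm]
      simpa using norm_add_le (fderiv ℝ v x - fderiv ℝ v u) (fderiv ℝ v u)
    have h4 : (K : ℝ) * dist x u ≤ K * r := by gcongr; exact (Metric.mem_ball.1 hx).le
    exact le_max_of_le_right (le_max_of_le_right (by linarith))
  · have hseg : segment ℝ x y ⊆ Metric.ball u r := (convex_ball u r).segment_subset hx hy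
    have := (convex_segment x y).norm_image_sub_le_of_norm_hasFDerivWithin_le' (f := v)
      (f' := fderiv ℝ v) (φ := fderiv ℝ v x) (C := K * ‖y - x‖)
      (fun z hz ↦ (hball (hseg hz)).2.hasFDerivAt.hasFDerivWithinAt) (fun z hz ↦ ?_)
      (left_mem_segment ℝ x y) (right_mem_segment ℝ x y)
    · refine this.trans ?_
      rw [mul_assoc, ← sq]
      gcongr
      exact le_max_of_le_right (le_max_left _ _)
    · have := hK.dist_le_mul _ (hball (hseg hz)).1 _ (hball hx).1
      rw [dist_eq_norm] at this
      refine this.trans ?_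
      gcongr
      rw [dist_eq_norm]
      obtain ⟨θ, ⟨h0, h1⟩, rfl⟩ := (segment_eq_image' ℝ x y) ▸ hz
      rw [add_sub_cancel_left, norm_smul, Real.norm_of_nonneg h0]
      exact mul_le_of_le_one_left (norm_nonneg _) h1

/-- Two integral curves of `v` that start close to each other, and up to a quadratic error on the
same integral curve of `w`, stay so if `[v, w]` is a multiple of `w`. -/
theorem exists_tangential_gronwall {ℓ : E →L[ℝ] ℝ} {v w : E → E} {G : Set E} {L C T : ℝ}
    (hG : IsOpen G) (hC : 1 ≤ C) (hvC : ∀ x ∈ G, ‖fderiv ℝ v x‖ ≤ C)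
    (hvq : ∀ x ∈ G, ∀ y ∈ G, ‖v y - v x - fderiv ℝ v x (y - x)‖ ≤ C * ‖y - x‖ ^ 2)
    (hvL : ∀ x ∈ G, ∀ y ∈ G, ‖v y - v x‖ ≤ C * ‖y - x‖)
    (hwd : ∀ x ∈ G, DifferentiableAt ℝ w x) (hwL : ∀ x ∈ G, ‖w x‖ ≤ L) (hL : 0 ≤ L)
    (hℓ : ∀ x ∈ G, ℓ (w x) = 1)
    (hbr : ∀ x ∈ G, ∃ a : ℝ, fderiv ℝ v x (w x) - fderiv ℝ w x (v x) = a • w x) :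
    ∃ C' : ℝ, ∀ X Y : ℝ → E, ContinuousOn X (Icc 0 T) → ContinuousOn Y (Icc 0 T) →
      (∀ t ∈ Icc 0 T, X t ∈ G) → (∀ t ∈ Icc 0 T, Y t ∈ G) →
      (∀ t ∈ Ico 0 T, HasDerivWithinAt X (v (X t)) (Ici t) t) →
      (∀ t ∈ Ico 0 T, HasDerivWithinAt Y (v (Y t)) (Ici t) t) →
      ∀ t ∈ Icc 0 T, ‖Y t - X t‖ ≤ C' * ‖Y 0 - X 0‖ ∧
        ‖Y t - X t - ℓ (Y t - X t) • w (X t)‖ ≤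
          C' * (‖Y 0 - X 0 - ℓ (Y 0 - X 0) • w (X 0)‖ + ‖Y 0 - X 0‖ ^ 2) := by
  set A : ℝ := Real.exp (C * T) with hA
  set K : ℝ := (1 + ‖ℓ‖ * L) * C with hK
  have hK1 : 1 ≤ K := by
    have : 0 ≤ ‖ℓ‖ * L := by positivity
    rw [hK]; nlinarith
  refine ⟨A + Real.exp (K * T) * (1 + K * A ^ 2), fun X Y hXc hYc hXG hYG hX hY ↦ ?_⟩
  have hApos : 0 < A := Real.exp_pos _
  have hD : ∀ t ∈ Icc 0 T, ‖Y t - X t‖ ≤ A * ‖Y 0 - X 0‖ := by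
    intro t ht
    have := norm_le_gronwallBound_of_norm_deriv_right_le (f := fun t ↦ Y t - X t)
      (f' := fun t ↦ v (Y t) - v (X t)) (K := C) (ε := 0) (δ := ‖Y 0 - X 0‖)
      (hYc.sub hXc) (fun t ht ↦ (hY t ht).sub (hX t ht)) le_rfl
      (fun t ht ↦ by
        simpa using hvL _ (hXG t (Ico_subset_Icc_self ht)) _ (hYG t (Ico_subset_Icc_self ht))) t ht
    have h2 := this.trans (gronwallBound_le_exp_mul_add hC (norm_nonneg _) le_rfl
      (by linarith [ht.2] : t - 0 ≤ T))
    simpa using h2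
  have hwc : ContinuousOn (fun t ↦ w (X t)) (Icc 0 T) := fun t ht ↦
    (hwd _ (hXG t ht)).continuousAt.comp_continuousWithinAt (hXc t ht)
  -- Differentiating the constant ℓ ∘ w.
  have hℓw : ∀ x ∈ G, ∀ h, ℓ (fderiv ℝ w x h) = 0 := by
    intro x hx h
    have h1 : HasFDerivAt (fun y ↦ ℓ (w y)) (ℓ.comp (fderiv ℝ w x)) x :=
      ℓ.hasFDerivAt.comp x (hwd x hx).hasFDerivAt
    have h2 : HasFDerivAt (fun y ↦ ℓ (w y)) (0 : E →L[ℝ] ℝ) x :=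
      (hasFDerivAt_const (1 : ℝ) x).congr_of_eventuallyEq
        (Filter.eventuallyEq_of_mem (hG.mem_nhds hx) hℓ)
    simpa using congrArg (fun φ : E →L[ℝ] ℝ ↦ φ h) (h1.unique h2)
  -- The component of the displacement in ker ℓ, along the splitting by w (X t); it measures the
  -- failure of tangency.
  let z : ℝ → E := fun t ↦ Y t - X t - ℓ (Y t - X t) • w (X t)
  let z' : ℝ → E := fun t ↦ v (Y t) - v (X t) -
    (ℓ (Y t - X t) • fderiv ℝ w (X t) (v (X t)) + ℓ (v (Y t) - v (X t)) • w (X t))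
  have hz : ∀ t ∈ Ico 0 T, HasDerivWithinAt z (z' t) (Ici t) t := by
    intro t ht
    have hd := (hY t ht).sub (hX t ht)
    have hw :=
      (hwd _ (hXG t (Ico_subset_Icc_self ht))).hasFDerivAt.comp_hasDerivWithinAt t (hX t ht)
    exact hd.sub ((ℓ.hasFDerivAt.comp_hasDerivWithinAt t hd).smul hw)
  have hzc : ContinuousOn z (Icc 0 T) :=
    (hYc.sub hXc).sub ((ℓ.continuous.comp_continuousOn (hYc.sub hXc)).smul hwc)
  have hbound : ∀ t ∈ Ico 0 T, ‖z' t‖ ≤ K * ‖z t‖ + K * (A * ‖Y 0 - X 0‖) ^ 2 := by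
    intro t ht'
    have ht := Ico_subset_Icc_self ht'
    have hXt := hXG t ht
    obtain ⟨a, ha⟩ := hbr (X t) hXt
    set D := Y t - X t with hDdef
    set F := fderiv ℝ v (X t) with hF
    set R := v (Y t) - v (X t) - F D with hR
    have hzD : D = z t + ℓ D • w (X t) := by simp only [z, ← hDdef]; abel
    have hFw : F (w (X t)) = a • w (X t) + fderiv ℝ w (X t) (v (X t)) := by rw [← ha]; abel
    have hFD : F D = F (z t) + ℓ D • (a • w (X t) + fderiv ℝ w (X t) (v (X t))) := by
      conv_lhs => rw [hzD]
      rw [map_add, map_smul, hFw]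
    have hvv : v (Y t) - v (X t) =
        F (z t) + ℓ D • (a • w (X t) + fderiv ℝ w (X t) (v (X t))) + R := by
      rw [← hFD, hR]; abel
    have hℓvv : ℓ (v (Y t) - v (X t)) = ℓ (F (z t) + R) + ℓ D * a := by
      rw [hvv]
      simp only [map_add, map_smul, smul_eq_mul, hℓ _ hXt, hℓw _ hXt]; ring
    -- The bracket relation cancels every term linear in ℓ D. What remains is linear in z plus the
    -- quadratic remainder R.
    have hz't : z' t = (F (z t) + R) - ℓ (F (z t) + R) • w (X t) := by
      simp only [z', ← hDdef]
      rw [hℓvv, hvv]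
      module
    have hRn : ‖R‖ ≤ C * (A * ‖Y 0 - X 0‖) ^ 2 := by
      refine (hvq _ hXt _ (hYG t ht)).trans ?_
      gcongr
      exact hD t ht
    have hS : ‖F (z t) + R‖ ≤ C * ‖z t‖ + C * (A * ‖Y 0 - X 0‖) ^ 2 := by
      refine (norm_add_le _ _).trans (add_le_add ?_ hRn)
      exact (F.le_opNorm _).trans (by gcongr; exact hvC _ hXt)
    calc ‖z' t‖ ≤ ‖F (z t) + R‖ + ‖ℓ (F (z t) + R) • w (X t)‖ := by
          rw [hz't]; exact norm_sub_le _ _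
      _ ≤ ‖F (z t) + R‖ + (‖ℓ‖ * ‖F (z t) + R‖) * L := by
          rw [norm_smul]
          gcongr
          · exact ℓ.le_opNorm _
          · exact hwL _ hXt
      _ = (1 + ‖ℓ‖ * L) * ‖F (z t) + R‖ := by ring
      _ ≤ (1 + ‖ℓ‖ * L) * (C * ‖z t‖ + C * (A * ‖Y 0 - X 0‖) ^ 2) := by gcongr
      _ = _ := by rw [hK]; ring
  intro t ht
  have hexp : 0 ≤ Real.exp (K * T) * (1 + K * A ^ 2) := by positivity
  refine ⟨(hD t ht).trans (by gcongr; linarith), ?_⟩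
  have := (norm_le_gronwallBound_of_norm_deriv_right_le hzc hz le_rfl hbound t ht).trans
    (gronwallBound_le_exp_mul_add hK1 (norm_nonneg _) (by positivity)
      (by linarith [ht.2] : t - 0 ≤ T))
  refine this.trans ?_
  have hz0 : 0 ≤ ‖z 0‖ := norm_nonneg _
  have hE := Real.exp_pos (K * T)
  have hKA : 0 ≤ K * A ^ 2 := by positivity
  have hq : 0 ≤ ‖Y 0 - X 0‖ ^ 2 := by positivity
  calc Real.exp (K * T) * (‖z 0‖ + K * (A * ‖Y 0 - X 0‖) ^ 2)
      = Real.exp (K * T) * (‖z 0‖ + K * A ^ 2 * ‖Y 0 - X 0‖ ^ 2) := by ring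
    _ ≤ Real.exp (K * T) * ((1 + K * A ^ 2) * (‖z 0‖ + ‖Y 0 - X 0‖ ^ 2)) := by
        gcongr; nlinarith
    _ = Real.exp (K * T) * (1 + K * A ^ 2) * (‖z 0‖ + ‖Y 0 - X 0‖ ^ 2) := by ring
    _ ≤ (A + Real.exp (K * T) * (1 + K * A ^ 2)) * (‖z 0‖ + ‖Y 0 - X 0‖ ^ 2) := by
        gcongr; linarith

end TangentialGronwall

/-! ### Kernels of smooth families of symmetric forms -/

theorem ContDiffAt.clm_inverse_apply {D E F : Type*} [NormedAddCommGroup D] [NormedSpace ℝ D]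
    [NormedAddCommGroup E] [NormedSpace ℝ E] [NormedAddCommGroup F] [NormedSpace ℝ F]
    [CompleteSpace E] {n : WithTop ℕ∞} {P : D → E →L[ℝ] F} {u : D} (hP : ContDiffAt ℝ n P u)
    {e : E ≃L[ℝ] F} (he : (e : E →L[ℝ] F) = P u) (y : F) :
    ContDiffAt ℝ n (fun u ↦ ContinuousLinearMap.inverse (P u) y) u :=
  (ContDiffAt.comp u (he ▸ contDiffAt_map_inverse e) hP).clm_apply contDiffAt_const

/-- Choose ℓ equal to 1 on a kernel vector at u₀. The form P = G + ℓ ⊗ ℓ is invertible at u₀, hence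
nearby, and P n = ℓ(n) ℓ for n in the kernel. So P⁻¹ℓ spans the kernel, is normalized, and is smooth
because inversion is. -/
theorem exists_smooth_generator_ker {E : Type*} [NormedAddCommGroup E] [NormedSpace ℝ E]
    [FiniteDimensional ℝ E] {G : E → E →L[ℝ] E →L[ℝ] ℝ} {s : Set E} (hs : IsOpen s)
    (hG : ContDiffOn ℝ ∞ G s) (hsymm : ∀ u ∈ s, ∀ a b, G u a b = G u b a)
    (hker : ∀ u ∈ s, Module.finrank ℝ (LinearMap.ker (G u).toLinearMap) = 1) {u₀ : E}
    (hu₀ : u₀ ∈ s) :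
    ∃ (ℓ : E →L[ℝ] ℝ) (w : E → E) (O : Set E), IsOpen O ∧ u₀ ∈ O ∧ O ⊆ s ∧ ContDiffOn ℝ ∞ w O ∧
      (∀ u ∈ O, ℓ (w u) = 1) ∧ ∀ u ∈ O, ∀ ξ, G u ξ = 0 ↔ ∃ a : ℝ, ξ = a • w u := by
  have : CompleteSpace E := FiniteDimensional.complete ℝ E
  have gen : ∀ u ∈ s, ∃ n : E, n ≠ 0 ∧ G u n = 0 ∧ ∀ ξ, G u ξ = 0 → ∃ c : ℝ, c • n = ξ := by
    intro u hu
    obtain ⟨n, hn, hspan⟩ := finrank_eq_one_iff'.1 (hker u hu)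
    refine ⟨n, fun h ↦ hn (Subtype.ext h), by simp, fun ξ hξ ↦ ?_⟩
    obtain ⟨c, hc⟩ := hspan ⟨ξ, by simpa using hξ⟩
    exact ⟨c, by simpa using congrArg Subtype.val hc⟩
  obtain ⟨n₀, hn₀, hGn₀, hspan₀⟩ := gen u₀ hu₀
  obtain ⟨ℓ, hℓ⟩ : ∃ ℓ : E →L[ℝ] ℝ, ℓ n₀ = 1 := by
    obtain ⟨f, -, hf⟩ := exists_dual_vector ℝ n₀ (norm_ne_zero_iff.2 hn₀)
    refine ⟨(‖n₀‖⁻¹) • f, ?_⟩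
    simp [hf, norm_ne_zero_iff.2 hn₀]
  let P : E → E →L[ℝ] E →L[ℝ] ℝ := fun u ↦ G u + ℓ.smulRight ℓ
  have hP : ∀ u ξ, P u ξ = G u ξ + ℓ ξ • ℓ := fun u ξ ↦ rfl
  have hPs : ContDiffOn ℝ ∞ P s := hG.add contDiffOn_const
  have hinj : Function.Injective (P u₀).toLinearMap := by
    rw [← LinearMap.ker_eq_bot, LinearMap.ker_eq_bot']
    intro ξ hξ
    have hξ' : G u₀ ξ + ℓ ξ • ℓ = 0 := hξ
    -- Evaluate at n₀: by symmetry the G-term vanishes there.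
    have h1 : ℓ ξ = 0 := by
      have := congrArg (fun f : E →L[ℝ] ℝ ↦ f n₀) hξ'
      simpa [hsymm u₀ hu₀ ξ n₀, hGn₀, hℓ] using this
    obtain ⟨c, rfl⟩ := hspan₀ ξ (by simpa [h1] using hξ')
    have : c = 0 := by simpa [hℓ] using h1
    simp [this]
  have hdim : Module.finrank ℝ E = Module.finrank ℝ (E →L[ℝ] ℝ) := by
    rw [← (LinearMap.toContinuousLinearMap (𝕜 := ℝ) (E := E) (F' := ℝ)).finrank_eq]
    exact (Subspace.dual_finrank_eq).symm
  let e₀ : E ≃L[ℝ] E →L[ℝ] ℝ :=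
    (LinearEquiv.ofInjectiveOfFinrankEq (P u₀).toLinearMap hinj hdim).toContinuousLinearEquiv
  have he₀ : (e₀ : E →L[ℝ] E →L[ℝ] ℝ) = P u₀ := by ext x; rfl
  have hopen : IsOpen (s ∩ P ⁻¹' range ((↑) : (E ≃L[ℝ] E →L[ℝ] ℝ) → E →L[ℝ] E →L[ℝ] ℝ)) :=
    hPs.continuousOn.isOpen_inter_preimage hs (ContinuousLinearEquiv.isOpen (𝕜 := ℝ))
  have hℓ0 : ℓ ≠ 0 := by rintro rfl; simp at hℓ
  have key : ∀ u ∈ s, ∀ e : E ≃L[ℝ] E →L[ℝ] ℝ, (e : E →L[ℝ] E →L[ℝ] ℝ) = P u →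
      ℓ (e.symm ℓ) = 1 ∧ ∀ ξ, G u ξ = 0 ↔ ∃ a : ℝ, ξ = a • e.symm ℓ := by
    intro u hu e he
    have hee : ∀ ξ, e ξ = G u ξ + ℓ ξ • ℓ := fun ξ ↦ by
      rw [← hP, ← he]; rfl
    have hk : ∀ ξ, G u ξ = 0 → ξ = ℓ ξ • e.symm ℓ := fun ξ hξ ↦ by
      apply e.injective
      rw [hee, hξ, map_smul, e.apply_symm_apply, zero_add]
    obtain ⟨n, hn, hGn, -⟩ := gen u hu
    have hn' := hk n hGn
    have hℓn : ℓ n ≠ 0 := fun h ↦ hn (by rw [hn', h, zero_smul])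
    have hGw : G u (e.symm ℓ) = 0 := by
      have : e.symm ℓ = (ℓ n)⁻¹ • n := by
        conv_rhs => rw [hn']
        rw [smul_smul, ← hn', inv_mul_cancel₀ hℓn, one_smul]
      rw [this, map_smul, hGn, smul_zero]
    have h1 : ℓ (e.symm ℓ) = 1 := by
      have h2 := hee (e.symm ℓ)
      rw [e.apply_symm_apply, hGw, zero_add] at h2
      exact (smul_left_injective ℝ hℓ0 (by simpa using h2)).symm
    refine ⟨h1, fun ξ ↦ ⟨fun h ↦ ⟨_, hk ξ h⟩, ?_⟩⟩
    rintro ⟨a, rfl⟩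
    rw [map_smul, hGw, smul_zero]
  refine ⟨ℓ, fun u ↦ ContinuousLinearMap.inverse (P u) ℓ, _, hopen, ⟨hu₀, e₀, he₀⟩,
    inter_subset_left, ?_, ?_, ?_⟩
  · rintro u ⟨hu, e, he⟩
    have h1 : ContDiffAt ℝ ∞ P u := hPs.contDiffAt (hs.mem_nhds hu)
    exact (h1.clm_inverse_apply he ℓ).contDiffWithinAt
  · rintro u ⟨hu, e, he⟩
    simpa [← he] using (key u hu e he).1
  · rintro u ⟨hu, e, he⟩
    simpa [← he] using (key u hu e he).2

/-! ### The null distribution of an immersed hypersurface -/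

section NullDistribution

/-- In the immersion charts f is u ↦ (u, 0); the first projection gives a differentiable local left
inverse, and the chain rule applies. -/
theorem Manifold.IsImmersionAt.mfderiv_injective {E F : Type*} [NormedAddCommGroup E]
    [NormedSpace ℝ E] [NormedAddCommGroup F] [NormedSpace ℝ F] {M U : Type*}
    [TopologicalSpace M] [ChartedSpace E M] [TopologicalSpace U] [ChartedSpace F U]
    [IsManifold 𝓘(ℝ, E) ∞ M] [IsManifold 𝓘(ℝ, F) ∞ U] {f : M → U} {x : M}
    (h : Manifold.IsImmersionAt 𝓘(ℝ, E) 𝓘(ℝ, F) ∞ f x) :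
    Function.Injective (mfderiv 𝓘(ℝ, E) 𝓘(ℝ, F) f x) := by
  set e := h.domChart
  set e' := h.codChart
  let ρ : U → M := fun y ↦ e.symm (h.equiv.symm (e' y)).1
  have hfx : MDifferentiableAt 𝓘(ℝ, E) 𝓘(ℝ, F) f x := h.contMDiffAt.mdifferentiableAt (by simp)
  have hwr : ∀ y ∈ e.source, h.equiv.symm (e' (f y)) = (e y, 0) := by
    intro y hy
    have hmem : e y ∈ (e.extend 𝓘(ℝ, E)).target := by simpa using e.map_source hy
    have := h.writtenInCharts hmem
    simp only [Function.comp_apply, OpenPartialHomeomorph.extend_coe_symm,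
      OpenPartialHomeomorph.extend_coe, modelWithCornersSelf_coe, modelWithCornersSelf_coe_symm,
      id] at this
    rw [e.left_inv hy] at this
    rw [this, h.equiv.symm_apply_apply]
  have hρ : ρ ∘ f =ᶠ[𝓝 x] id := by
    filter_upwards [e.open_source.mem_nhds h.mem_domChart_source] with y hy
    simp [ρ, hwr y hy, e.left_inv hy]
  have hρd : MDifferentiableAt 𝓘(ℝ, F) 𝓘(ℝ, E) ρ (f x) := by
    have h1 : MDifferentiableAt 𝓘(ℝ, F) 𝓘(ℝ, F) e' (f x) :=
      mdifferentiableAt_of_mem_maximalAtlas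
        (IsManifold.maximalAtlas_subset_of_le (by simp) h.codChart_mem_maximalAtlas)
        h.mem_codChart_source
    have h2 : MDifferentiableAt 𝓘(ℝ, F) 𝓘(ℝ, E) (fun z : F ↦ (h.equiv.symm z).1) (e' (f x)) :=
      ((ContinuousLinearMap.fst ℝ E h.complement).comp
        (h.equiv.symm : F →L[ℝ] E × h.complement)).differentiableAt.mdifferentiableAt
    have h3 : MDifferentiableAt 𝓘(ℝ, E) 𝓘(ℝ, E) e.symm (h.equiv.symm (e' (f x))).1 := by
      rw [hwr x h.mem_domChart_source]
      exact mdifferentiableAt_symm_of_mem_maximalAtlas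
        (IsManifold.maximalAtlas_subset_of_le (by simp) h.domChart_mem_maximalAtlas)
        (e.map_source h.mem_domChart_source)
    exact MDifferentiableAt.comp (f x) h3 (h2.comp (f x) h1)
  have hcomp := mfderiv_comp x hρd hfx
  rw [hρ.mfderiv_eq, mfderiv_id] at hcomp
  intro a b hab
  have hc : ∀ a, mfderiv 𝓘(ℝ, F) 𝓘(ℝ, E) ρ (f x) (mfderiv 𝓘(ℝ, E) 𝓘(ℝ, F) f x a) = a :=
    fun a ↦ (DFunLike.congr_fun hcomp a).symm
  rw [← hc a, ← hc b, hab]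

theorem LorentzianMetric.eq_zero_of_form_eq_zero {n : ℕ} [NeZero n] {U : Type*}
    [TopologicalSpace U] [ChartedSpace (EuclideanSpace ℝ (Fin n)) U] [IsManifold (𝓡 n) ∞ U]
    (g : LorentzianMetric n U) (p : U) {v : TangentSpace (𝓡 n) p} (hv : g.form p v = 0) :
    v = 0 := by
  obtain ⟨b, hb⟩ := g.signature p
  apply b.repr.injective
  ext j
  have h1 : g.form p v (b j) = 0 := by rw [hv]; rfl
  rw [g.symm, ← b.sum_repr v, map_sum] at h1
  simp only [map_smul, hb, smul_eq_mul, mul_ite, mul_zero, Finset.sum_ite_eq,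
    Finset.mem_univ, if_true] at h1
  rw [map_zero, Finsupp.zero_apply]
  split_ifs at h1 <;> simpa using h1

variable {m : ℕ} {U : Type*} [TopologicalSpace U]
  [ChartedSpace (EuclideanSpace ℝ (Fin (m + 1))) U] [IsManifold (𝓡 (m + 1)) ∞ U]
  (g : LorentzianMetric (m + 1) U)
  {M : Type*} [TopologicalSpace M] [ChartedSpace (EuclideanSpace ℝ (Fin m)) M] (ι : M → U)

/-- The metric sends null vectors injectively into the annihilator of the image of the tangent
space, which has dimension (m + 1) - m. -/
theorem finrank_nullDistribution_le_one {x : M}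
    (hinj : Function.Injective (mfderiv (𝓡 m) (𝓡 (m + 1)) ι x)) :
    Module.finrank ℝ (nullDistribution (m := m) g ι x) ≤ 1 := by
  have : FiniteDimensional ℝ (TangentSpace (𝓡 m) x) :=
    inferInstanceAs (FiniteDimensional ℝ (EuclideanSpace ℝ (Fin m)))
  have : FiniteDimensional ℝ (TangentSpace (𝓡 (m + 1)) (ι x)) :=
    inferInstanceAs (FiniteDimensional ℝ (EuclideanSpace ℝ (Fin (m + 1))))
  have hd : Module.finrank ℝ (TangentSpace (𝓡 m) x) = m := finrank_euclideanSpace_fin (𝕜 := ℝ)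
  have hd' : Module.finrank ℝ (TangentSpace (𝓡 (m + 1)) (ι x)) = m + 1 :=
    finrank_euclideanSpace_fin (𝕜 := ℝ)
  set T := (mfderiv (𝓡 m) (𝓡 (m + 1)) ι x).toLinearMap
  let B : TangentSpace (𝓡 (m + 1)) (ι x) →ₗ[ℝ] Module.Dual ℝ (TangentSpace (𝓡 (m + 1)) (ι x)) :=
    { toFun := fun v ↦ (g.form (ι x) v).toLinearMap
      map_add' := fun a b ↦ by rw [map_add]; rfl
      map_smul' := fun c a ↦ by rw [map_smul]; rfl }
  have hB : Function.Injective B := by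
    rw [← LinearMap.ker_eq_bot, LinearMap.ker_eq_bot']
    intro v hv
    refine g.eq_zero_of_form_eq_zero (ι x) ?_
    ext w
    exact LinearMap.congr_fun hv w
  have hT : Function.Injective T := hinj
  have hfr : Module.finrank ℝ (LinearMap.range T) = m := by
    rw [LinearMap.finrank_range_of_inj hT, hd]
  have hann := Subspace.finrank_add_finrank_dualAnnihilator_eq (LinearMap.range T)
  rw [hfr, hd'] at hann
  have hle : (nullDistribution (m := m) g ι x).map (B ∘ₗ T) ≤
      (LinearMap.range T).dualAnnihilator := by
    rintro _ ⟨v, hv, rfl⟩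
    rw [Submodule.mem_dualAnnihilator]
    rintro _ ⟨w, rfl⟩
    exact hv w
  have h1 := Submodule.finrank_mono hle
  have h2 : Module.finrank ℝ ((nullDistribution (m := m) g ι x).map (B ∘ₗ T)) =
      Module.finrank ℝ (nullDistribution (m := m) g ι x) :=
    (Submodule.equivMapOfInjective (B ∘ₗ T) (hB.comp hT) _).finrank_eq.symm
  have h3 : Module.finrank ℝ (LinearMap.range T).dualAnnihilator = 1 := by omega
  rw [h2, h3] at h1
  exact h1

end NullDistribution

/-! ### Vector fields and distributions in a chart -/

section ChartDerivative

variable {E : Type*} [NormedAddCommGroup E] [NormedSpace ℝ E] {M : Type*} [TopologicalSpace M]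
  [ChartedSpace E M]

/-- The derivative of a chart, with values in the model space. -/
def chartDeriv (e : OpenPartialHomeomorph M E) (x : M) : TangentSpace 𝓘(ℝ, E) x →L[ℝ] E :=
  mfderiv 𝓘(ℝ, E) 𝓘(ℝ, E) e x

/-- The derivative of an inverse chart, defined on the model space. -/
def chartDerivSymm (e : OpenPartialHomeomorph M E) (u : E) :
    E →L[ℝ] TangentSpace 𝓘(ℝ, E) (e.symm u) :=
  mfderiv 𝓘(ℝ, E) 𝓘(ℝ, E) e.symm u

/-- A vector field on a manifold, read in a chart. -/
def chartField (e : OpenPartialHomeomorph M E) (V : ∀ x : M, TangentSpace 𝓘(ℝ, E) x) : E → E :=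
  VectorField.mpullback 𝓘(ℝ, E) 𝓘(ℝ, E) e.symm V

variable {e : OpenPartialHomeomorph M E}

theorem mdifferentiable_of_mem_maximalAtlas
    (he : e ∈ IsManifold.maximalAtlas 𝓘(ℝ, E) ∞ M) : e.MDifferentiable 𝓘(ℝ, E) 𝓘(ℝ, E) :=
  ⟨(contMDiffOn_of_mem_maximalAtlas he).mdifferentiableOn (by simp),
    (contMDiffOn_symm_of_mem_maximalAtlas he).mdifferentiableOn (by simp)⟩

theorem chartDeriv_comp_chartDerivSymm (he : e ∈ IsManifold.maximalAtlas 𝓘(ℝ, E) ∞ M) {u : E}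
    (hu : u ∈ e.target) : (chartDeriv e (e.symm u)).comp (chartDerivSymm e u) = .id ℝ E :=
  (mdifferentiable_of_mem_maximalAtlas he).comp_symm_deriv hu

theorem chartDeriv_chartDerivSymm (he : e ∈ IsManifold.maximalAtlas 𝓘(ℝ, E) ∞ M) {u : E}
    (hu : u ∈ e.target) (a : E) : chartDeriv e (e.symm u) (chartDerivSymm e u a) = a :=
  DFunLike.congr_fun (chartDeriv_comp_chartDerivSymm he hu) a

theorem chartDerivSymm_comp_chartDeriv (he : e ∈ IsManifold.maximalAtlas 𝓘(ℝ, E) ∞ M) {u : E}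
    (hu : u ∈ e.target) :
    (chartDerivSymm e u).comp (chartDeriv e (e.symm u)) =
      .id ℝ (TangentSpace 𝓘(ℝ, E) (e.symm u)) := by
  have h1 := mdifferentiable_of_mem_maximalAtlas he
  have h2 := h1.symm_comp_deriv (e.map_target hu)
  have h3 : ∀ u', u' = u → (mfderiv 𝓘(ℝ, E) 𝓘(ℝ, E) e.symm u' : E → E) =
      (mfderiv 𝓘(ℝ, E) 𝓘(ℝ, E) e.symm u : E → E) := by
    rintro _ rfl; rfl
  ext ξ
  exact (congrFun (h3 (e (e.symm u)) (e.right_inv hu)) _).symm.trans (DFunLike.congr_fun h2 ξ)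

theorem chartDerivSymm_chartDeriv (he : e ∈ IsManifold.maximalAtlas 𝓘(ℝ, E) ∞ M) {u : E}
    (hu : u ∈ e.target) (ξ : TangentSpace 𝓘(ℝ, E) (e.symm u)) :
    chartDerivSymm e u (chartDeriv e (e.symm u) ξ) = ξ :=
  DFunLike.congr_fun (chartDerivSymm_comp_chartDeriv he hu) ξ

theorem chartField_apply (he : e ∈ IsManifold.maximalAtlas 𝓘(ℝ, E) ∞ M) {u : E}
    (hu : u ∈ e.target) (V : ∀ x : M, TangentSpace 𝓘(ℝ, E) x) :
    chartField e V u = chartDeriv e (e.symm u) (V (e.symm u)) :=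
  DFunLike.congr_fun (ContinuousLinearMap.inverse_eq (f := chartDerivSymm e u)
    (chartDerivSymm_comp_chartDeriv he hu) (chartDeriv_comp_chartDerivSymm he hu)) (V (e.symm u))

theorem mpullback_chart_apply (he : e ∈ IsManifold.maximalAtlas 𝓘(ℝ, E) ∞ M) {u : E}
    (hu : u ∈ e.target) (w : E → E) :
    VectorField.mpullback 𝓘(ℝ, E) 𝓘(ℝ, E) e w (e.symm u) = chartDerivSymm e u (w u) := by
  have h1 : VectorField.mpullback 𝓘(ℝ, E) 𝓘(ℝ, E) e w (e.symm u) =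
      chartDerivSymm e u (w (e (e.symm u))) :=
    DFunLike.congr_fun (ContinuousLinearMap.inverse_eq (f := chartDeriv e (e.symm u))
      (chartDeriv_comp_chartDerivSymm he hu) (chartDerivSymm_comp_chartDeriv he hu))
      (w (e (e.symm u)))
  rw [h1, e.right_inv hu]

theorem isInvertible_mfderiv_chart (he : e ∈ IsManifold.maximalAtlas 𝓘(ℝ, E) ∞ M) {x : M}
    (hx : x ∈ e.source) : (mfderiv 𝓘(ℝ, E) 𝓘(ℝ, E) e x).IsInvertible :=
  ⟨(mdifferentiable_of_mem_maximalAtlas he).mfderiv hx, rfl⟩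

theorem isInvertible_mfderiv_chart_symm (he : e ∈ IsManifold.maximalAtlas 𝓘(ℝ, E) ∞ M) {u : E}
    (hu : u ∈ e.target) : (mfderiv 𝓘(ℝ, E) 𝓘(ℝ, E) e.symm u).IsInvertible :=
  ⟨(mdifferentiable_of_mem_maximalAtlas he).symm.mfderiv hu, rfl⟩

theorem contDiffAt_chartField [CompleteSpace E] [IsManifold 𝓘(ℝ, E) ∞ M]
    (he : e ∈ IsManifold.maximalAtlas 𝓘(ℝ, E) ∞ M)
    {u : E} (hu : u ∈ e.target) {V : ∀ x : M, TangentSpace 𝓘(ℝ, E) x}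
    (hV : ContMDiff 𝓘(ℝ, E) 𝓘(ℝ, E).tangent 2
      (fun x ↦ (⟨x, V x⟩ : TangentBundle 𝓘(ℝ, E) M))) :
    ContDiffAt ℝ 2 (chartField e V) u := by
  -- Pulling back a field costs one derivative of the chart, so class 2 needs class 3.
  have : IsManifold 𝓘(ℝ, E) (3 : WithTop ℕ∞) M :=
    IsManifold.of_le (n := ∞) (WithTop.coe_le_coe.2 (le_top : (3 : ℕ∞) ≤ ⊤))
  refine contMDiffAt_vectorSpace_iff_contDiffAt.1 ?_
  refine ContMDiffAt.mpullback_vectorField_preimage (n := 3) (hV _)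
    (((contMDiffOn_symm_of_mem_maximalAtlas he).contMDiffAt (e.open_target.mem_nhds hu)).of_le
      (WithTop.coe_le_coe.2 (le_top : (3 : ℕ∞) ≤ ⊤)))
    (isInvertible_mfderiv_chart_symm he hu) (by norm_num)

end ChartDerivative

/-! ### Line fields in normal form -/

section NormalForm

variable {E : Type*} [NormedAddCommGroup E] [NormedSpace ℝ E] {M : Type*} [TopologicalSpace M]
  [ChartedSpace E M]

/-- In the chart `e`, over the open set `O`, the distribution `N` is the line field spanned by `w`,
normalized by `ℓ (w u) = 1`. -/
structure IsNormalForm (N : ∀ x : M, Submodule ℝ (TangentSpace 𝓘(ℝ, E) x))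
    (e : OpenPartialHomeomorph M E) (ℓ : E →L[ℝ] ℝ) (w : E → E) (O : Set E) : Prop where
  isOpen : IsOpen O
  subset : O ⊆ e.target
  contDiffOn : ContDiffOn ℝ ∞ w O
  normalized : ∀ u ∈ O, ℓ (w u) = 1
  mem_iff : ∀ u ∈ O, ∀ ξ : TangentSpace 𝓘(ℝ, E) (e.symm u),
    ξ ∈ N (e.symm u) ↔ ∃ a : ℝ, chartDeriv e (e.symm u) ξ = a • w u

theorem IsNormalForm.chartDerivSymm_mem {N : ∀ x : M, Submodule ℝ (TangentSpace 𝓘(ℝ, E) x)}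
    {e : OpenPartialHomeomorph M E} {ℓ : E →L[ℝ] ℝ} {w : E → E} {O : Set E}
    (h : IsNormalForm N e ℓ w O)
    (he : e ∈ IsManifold.maximalAtlas 𝓘(ℝ, E) ∞ M) {u : E} (hu : u ∈ O) (a : ℝ) :
    chartDerivSymm e u (a • w u) ∈ N (e.symm u) :=
  (h.mem_iff u hu _).2 ⟨a, chartDeriv_chartDerivSymm he (h.subset hu) _⟩

theorem IsNormalForm.contMDiffOn_mpullback [CompleteSpace E] [IsManifold 𝓘(ℝ, E) ∞ M]
    {N : ∀ x : M, Submodule ℝ (TangentSpace 𝓘(ℝ, E) x)}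
    {e : OpenPartialHomeomorph M E} {ℓ : E →L[ℝ] ℝ} {w : E → E} {O : Set E}
    (h : IsNormalForm N e ℓ w O)
    (he : e ∈ IsManifold.maximalAtlas 𝓘(ℝ, E) ∞ M) :
    ContMDiffOn 𝓘(ℝ, E) 𝓘(ℝ, E).tangent ∞
      (fun x ↦ (⟨x, VectorField.mpullback 𝓘(ℝ, E) 𝓘(ℝ, E) e w x⟩ : TangentBundle 𝓘(ℝ, E) M))
      (e.source ∩ e ⁻¹' O) := by
  intro x hx
  refine ContMDiffAt.contMDiffWithinAt ?_
  refine ContMDiffAt.mpullback_vectorField_preimage (n := ∞) ?_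
    ((contMDiffOn_of_mem_maximalAtlas he).contMDiffAt (e.open_source.mem_nhds hx.1))
    (isInvertible_mfderiv_chart he hx.1) (by simp)
  exact contMDiffAt_vectorSpace_iff_contDiffAt.2 (h.contDiffOn.contDiffAt (h.isOpen.mem_nhds hx.2))

end NormalForm

/-! ### Projectability read in a chart -/

section Bracket

variable {m : ℕ} {M : Type*} [TopologicalSpace M] [T2Space M]
  [ChartedSpace (EuclideanSpace ℝ (Fin m)) M] [IsManifold (𝓡 m) ∞ M]

/-- Projectability speaks of global sections, so the local generator is multiplied by a bump
function equal to 1 near the point. The bracket is local and natural under the chart. -/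
theorem IsNormalForm.exists_bracket_eq_smul
    {N : ∀ x : M, Submodule ℝ (TangentSpace (𝓡 m) x)}
    {e : OpenPartialHomeomorph M (EuclideanSpace ℝ (Fin m))}
    {ℓ : EuclideanSpace ℝ (Fin m) →L[ℝ] ℝ}
    {w : EuclideanSpace ℝ (Fin m) → EuclideanSpace ℝ (Fin m)} {O : Set (EuclideanSpace ℝ (Fin m))}
    (h : IsNormalForm N e ℓ w O) (he : e ∈ IsManifold.maximalAtlas (𝓡 m) ∞ M)
    {V : ∀ x : M, TangentSpace (𝓡 m) x} (hV : IsVectorFieldOfClass 2 V) (hproj : IsProjectable N V)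
    {u : EuclideanSpace ℝ (Fin m)} (hu : u ∈ O) :
    ∃ a : ℝ, fderiv ℝ (chartField e V) u (w u) - fderiv ℝ w u (chartField e V u) = a • w u := by
  have hut := h.subset hu
  have hopen : IsOpen (e.source ∩ e ⁻¹' O) := e.isOpen_inter_preimage h.isOpen
  have hmem : e.symm u ∈ e.source ∩ e ⁻¹' O :=
    ⟨e.map_target hut, by rw [mem_preimage, e.right_inv hut]; exact hu⟩
  obtain ⟨f, -, hf⟩ := (SmoothBumpFunction.nhds_basis_tsupport (I := 𝓡 m) (e.symm u)).mem_iff.1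
    (hopen.mem_nhds hmem)
  let W₀ : ∀ x : M, TangentSpace (𝓡 m) x := VectorField.mpullback (𝓡 m) (𝓡 m) e w
  let W : ∀ x : M, TangentSpace (𝓡 m) x := fun x ↦ f x • W₀ x
  have hW : IsVectorFieldOfClass ∞ W :=
    ContMDiffOn.smul_section_of_tsupport f.contMDiff.contMDiffOn hopen hf
      (h.contMDiffOn_mpullback he)
  have hWN : ∀ x, W x ∈ N x := by
    intro x
    by_cases hx : x ∈ e.source ∩ e ⁻¹' O
    · obtain ⟨u', hu', rfl⟩ : ∃ u' ∈ O, e.symm u' = x := ⟨e x, hx.2, e.left_inv hx.1⟩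
      refine Submodule.smul_mem _ _ ?_
      have h1 : W₀ (e.symm u') = chartDerivSymm e u' (w u') :=
        mpullback_chart_apply he (h.subset hu') w
      rw [h1]
      simpa using h.chartDerivSymm_mem he hu' 1
    · have : f x = 0 := image_eq_zero_of_notMem_tsupport fun h' ↦ hx (hf h')
      simp [W, this]
  have two_le_infty : (2 : WithTop ℕ∞) ≤ ∞ := WithTop.coe_le_coe.2 (le_top : (2 : ℕ∞) ≤ ⊤)
  have : IsManifold (𝓡 m) (minSmoothness ℝ 2) M :=
    IsManifold.of_le (n := ∞) (by simpa using two_le_infty)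
  have hbr := (h.mem_iff u hu _).1 (hproj W ⟨hW, hWN⟩ (e.symm u))
  have hpb := VectorField.mpullback_mlieBracket (I := 𝓡 m) (I' := 𝓡 m) (n := ∞) (f := e.symm)
    (V := V) (W := W) (x₀ := u) ((hV _).mdifferentiableAt (by simp))
    ((hW _).mdifferentiableAt (by simp))
    ((contMDiffOn_symm_of_mem_maximalAtlas he).contMDiffAt (e.open_target.mem_nhds hut))
    (by simpa using two_le_infty)
  have hWw : chartField e W =ᶠ[𝓝 u] w := by
    have h1 : ∀ᶠ u' in 𝓝 u, f (e.symm u') = 1 :=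
      (e.continuousAt_symm hut).eventually f.eventuallyEq_one
    filter_upwards [h1, h.isOpen.mem_nhds hu] with u' h1 hu'
    rw [chartField_apply he (h.subset hu')]
    have h2 : W (e.symm u') = chartDerivSymm e u' (w u') := by
      simp only [W, h1, one_smul]
      exact mpullback_chart_apply he (h.subset hu') w
    rw [h2, chartDeriv_chartDerivSymm he (h.subset hu')]
  have hlie : chartField e (VectorField.mlieBracket (𝓡 m) V W) u =
      VectorField.lieBracketWithin ℝ (chartField e V) w univ u :=
    (hpb.trans ((EventuallyEq.refl _ _).mlieBracket_vectorField_eq hWw)).trans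
      (congrFun VectorField.mlieBracketWithin_eq_lieBracketWithin u)
  rw [chartField_apply he hut, VectorField.lieBracketWithin_univ, VectorField.lieBracket_eq] at hlie
  obtain ⟨a, ha⟩ := hbr
  -- The Lie bracket of V and w is Dw(V) - DV(w), opposite to the order in the conclusion.
  refine ⟨-a, ?_⟩
  rw [neg_smul, ← ha, hlie, neg_sub]

end Bracket

/-! ### Smooth generators of the null distribution -/

section NullNormalForm

variable {m : ℕ} {U : Type*} [TopologicalSpace U]
  [ChartedSpace (EuclideanSpace ℝ (Fin (m + 1))) U] [IsManifold (𝓡 (m + 1)) ∞ U]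
  (g : LorentzianMetric (m + 1) U)

/-- The pull-back of a Lorentzian metric by a map defined on a vector space. -/
def LorentzianMetric.pullbackForm {E : Type*} [NormedAddCommGroup E] [NormedSpace ℝ E]
    (f : E → U) (u : E) : E →L[ℝ] E →L[ℝ] ℝ :=
  ContinuousLinearMap.bilinearComp (E := EuclideanSpace ℝ (Fin (m + 1)))
    (F := EuclideanSpace ℝ (Fin (m + 1))) (g.form (f u))
    (mfderiv 𝓘(ℝ, E) (𝓡 (m + 1)) f u) (mfderiv 𝓘(ℝ, E) (𝓡 (m + 1)) f u)

/-- In finite dimension smoothness may be tested on fixed pairs a, b, where the form is g evaluated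
on two smooth sections along f. -/
theorem LorentzianMetric.contDiffOn_pullbackForm {E : Type*} [NormedAddCommGroup E]
    [NormedSpace ℝ E] [FiniteDimensional ℝ E] {f : E → U} {s : Set E} (hs : IsOpen s)
    (hf : ContMDiffOn 𝓘(ℝ, E) (𝓡 (m + 1)) ∞ f s) : ContDiffOn ℝ ∞ (g.pullbackForm f) s := by
  have hsec : ∀ a : E, ContMDiffOn 𝓘(ℝ, E) (𝓡 (m + 1)).tangent ∞
      (fun u ↦ (⟨f u, mfderiv 𝓘(ℝ, E) (𝓡 (m + 1)) f u a⟩ : TangentBundle (𝓡 (m + 1)) U)) s := by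
    intro a
    have h1 := hf.contMDiffOn_tangentMapWithin (m := ∞) (by simp) hs.uniqueMDiffOn
    have h2 : ContMDiffOn 𝓘(ℝ, E) 𝓘(ℝ, E).tangent ∞
        (fun u ↦ (⟨u, a⟩ : TangentBundle 𝓘(ℝ, E) E)) s :=
      contMDiffOn_vectorSpace_iff_contDiffOn.2 contDiffOn_const
    refine (h1.comp h2 fun u hu ↦ hu).congr fun u hu ↦ ?_
    simp only [Function.comp_apply, tangentMapWithin, mfderivWithin_of_isOpen hs hu]
  refine contDiffOn_clm_apply.2 fun a ↦ contDiffOn_clm_apply.2 fun b ↦ ?_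
  rw [← contMDiffOn_iff_contDiffOn]
  intro u hu
  have : ContMDiffWithinAt 𝓘(ℝ, E) ((𝓡 (m + 1)).prod 𝓘(ℝ)) ∞
      (fun u ↦ TotalSpace.mk' ℝ (E := Bundle.Trivial U ℝ) (f u)
        (g.form (f u) (mfderiv 𝓘(ℝ, E) (𝓡 (m + 1)) f u a)
          (mfderiv 𝓘(ℝ, E) (𝓡 (m + 1)) f u b))) s u := by
    apply ContMDiffWithinAt.clm_bundle_apply₂ (F₁ := EuclideanSpace ℝ (Fin (m + 1)))
      (F₂ := EuclideanSpace ℝ (Fin (m + 1)))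
    · exact ContMDiffAt.comp_contMDiffWithinAt u g.contMDiff.contMDiffAt (hf u hu)
    · exact hsec a u hu
    · exact hsec b u hu
  simp only [contMDiffWithinAt_totalSpace] at this
  exact this.2

variable {M : Type*} [TopologicalSpace M] [ChartedSpace (EuclideanSpace ℝ (Fin m)) M] {ι : M → U}

theorem exists_isNormalForm_nullDistribution (hι : ContMDiff (𝓡 m) (𝓡 (m + 1)) ∞ ι)
    (hrank : ∀ x, Module.finrank ℝ (nullDistribution (m := m) g ι x) = 1)
    {e : OpenPartialHomeomorph M (EuclideanSpace ℝ (Fin m))}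
    (he : e ∈ IsManifold.maximalAtlas (𝓡 m) ∞ M) {u₀ : EuclideanSpace ℝ (Fin m)}
    (hu₀ : u₀ ∈ e.target) :
    ∃ ℓ w O, u₀ ∈ O ∧ IsNormalForm (nullDistribution (m := m) g ι) e ℓ w O := by
  have hf : ContMDiffOn (𝓡 m) (𝓡 (m + 1)) ∞ (ι ∘ e.symm) e.target :=
    hι.comp_contMDiffOn (contMDiffOn_symm_of_mem_maximalAtlas he)
  have happ : ∀ u ∈ e.target, ∀ a b, g.pullbackForm (ι ∘ e.symm) u a b =
      inducedForm g ι (e.symm u) (chartDerivSymm e u a) (chartDerivSymm e u b) := by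
    intro u hu a b
    have h1 : mfderiv (𝓡 m) (𝓡 (m + 1)) (ι ∘ e.symm) u =
        (mfderiv (𝓡 m) (𝓡 (m + 1)) ι (e.symm u)).comp (mfderiv (𝓡 m) (𝓡 m) e.symm u) :=
      mfderiv_comp u ((hι _).mdifferentiableAt (by simp))
        ((mdifferentiable_of_mem_maximalAtlas he).mdifferentiableAt_symm hu)
    have h2 : g.pullbackForm (ι ∘ e.symm) u a b = g.form ((ι ∘ e.symm) u)
      (mfderiv (𝓡 m) (𝓡 (m + 1)) (ι ∘ e.symm) u a)
      (mfderiv (𝓡 m) (𝓡 (m + 1)) (ι ∘ e.symm) u b) := rfl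
    rw [h2, h1]
    rfl
  have hmem : ∀ u ∈ e.target, ∀ a, g.pullbackForm (ι ∘ e.symm) u a = 0 ↔
      chartDerivSymm e u a ∈ nullDistribution (m := m) g ι (e.symm u) := by
    intro u hu a
    constructor
    · intro h b
      rw [← chartDerivSymm_chartDeriv he hu b, ← happ u hu, h]
      rfl
    · intro h
      ext b
      rw [happ u hu]
      exact h _
  have hker : ∀ u ∈ e.target, Module.finrank ℝ
      (LinearMap.ker (g.pullbackForm (ι ∘ e.symm) u).toLinearMap) = 1 := by
    intro u hu
    let D : EuclideanSpace ℝ (Fin m) ≃ₗ[ℝ] TangentSpace (𝓡 m) (e.symm u) :=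
      LinearEquiv.ofLinearMap (chartDerivSymm e u).toLinearMap (chartDeriv e (e.symm u)).toLinearMap
        (by ext ξ; exact chartDerivSymm_chartDeriv he hu ξ)
        (by ext ξ : 1; exact chartDeriv_chartDerivSymm he hu ξ)
    rw [← hrank (e.symm u)]
    have h1 : (LinearMap.ker (g.pullbackForm (ι ∘ e.symm) u).toLinearMap).map D.toLinearMap =
        nullDistribution (m := m) g ι (e.symm u) := by
      ext ξ
      constructor
      · rintro ⟨a, ha, rfl⟩
        exact (hmem u hu a).1 ha
      · intro hξ
        refine ⟨D.symm ξ, (hmem u hu _).2 ?_, D.apply_symm_apply ξ⟩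
        have : chartDerivSymm e u (D.symm ξ) = ξ := D.apply_symm_apply ξ
        rwa [this]
    rw [← h1]
    exact (D.submoduleMap _).finrank_eq
  obtain ⟨ℓ, w, O, hO, huO, hOs, hw, hℓ, hk⟩ := exists_smooth_generator_ker e.open_target
    (g.contDiffOn_pullbackForm e.open_target hf)
    (fun u hu a b ↦ by rw [happ u hu, happ u hu]; exact g.symm _ _ _) hker hu₀
  refine ⟨ℓ, w, O, huO, hO, hOs, hw, hℓ, fun u hu ξ ↦ ?_⟩
  rw [← hk u hu, hmem u (hOs hu), chartDerivSymm_chartDeriv he (hOs hu)]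

end NullNormalForm

/-! ### Flow boxes of a line field -/

section TangentCurve

variable {E : Type*} [NormedAddCommGroup E] [NormedSpace ℝ E] {M : Type*} [TopologicalSpace M]
  [ChartedSpace E M]

/-- `γ` is differentiable within `J` with velocity in the distribution `N`. -/
def IsTangentCurveOn (N : ∀ x : M, Submodule ℝ (TangentSpace 𝓘(ℝ, E) x)) (γ : ℝ → M)
    (J : Set ℝ) : Prop :=
  ∀ s ∈ J, ∃ ξ ∈ N (γ s),
    HasMFDerivWithinAt 𝓘(ℝ, ℝ) 𝓘(ℝ, E) γ J s ((1 : ℝ →L[ℝ] ℝ).smulRight ξ)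

theorem IsTangentCurveOn.mono {N : ∀ x : M, Submodule ℝ (TangentSpace 𝓘(ℝ, E) x)} {γ : ℝ → M}
    {J J' : Set ℝ} (h : IsTangentCurveOn N γ J) (hJ : J' ⊆ J) : IsTangentCurveOn N γ J' :=
  fun s hs ↦ (h s (hJ hs)).imp fun _ hξ ↦ ⟨hξ.1, hξ.2.mono hJ⟩

theorem IsTangentCurveOn.continuousOn {N : ∀ x : M, Submodule ℝ (TangentSpace 𝓘(ℝ, E) x)}
    {γ : ℝ → M} {J : Set ℝ} (h : IsTangentCurveOn N γ J) : ContinuousOn γ J :=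
  fun s hs ↦ by
    obtain ⟨ξ, -, hξ⟩ := h s hs
    exact hξ.continuousWithinAt

theorem hasDerivWithinAt_chart_comp {e : OpenPartialHomeomorph M E}
    (he : e ∈ IsManifold.maximalAtlas 𝓘(ℝ, E) ∞ M) {γ : ℝ → M} {J : Set ℝ} {s : ℝ}
    (hs : γ s ∈ e.source) {ξ : TangentSpace 𝓘(ℝ, E) (γ s)}
    (h : HasMFDerivWithinAt 𝓘(ℝ, ℝ) 𝓘(ℝ, E) γ J s ((1 : ℝ →L[ℝ] ℝ).smulRight ξ)) :
    HasDerivWithinAt (fun s ↦ e (γ s)) (chartDeriv e (γ s) ξ) J s := by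
  have h1 := ((mdifferentiable_of_mem_maximalAtlas he).mdifferentiableAt hs).hasMFDerivAt
  have h2 : HasFDerivWithinAt (fun s ↦ e (γ s))
      ((chartDeriv e (γ s)).comp ((1 : ℝ →L[ℝ] ℝ).smulRight ξ)) J s :=
    (h1.comp_hasMFDerivWithinAt s h).hasFDerivWithinAt
  refine h2.hasDerivWithinAt.congr_deriv ?_
  have h4 : ((1 : ℝ →L[ℝ] ℝ).smulRight ξ) 1 = ξ := by simp
  exact congrArg (chartDeriv e (γ s)) h4

theorem HasDerivWithinAt.hasMFDerivWithinAt_chart_symm_comp {e : OpenPartialHomeomorph M E}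
    (he : e ∈ IsManifold.maximalAtlas 𝓘(ℝ, E) ∞ M) {c : ℝ → E} {J : Set ℝ} {s : ℝ} {a : E}
    (h : HasDerivWithinAt c a J s) (hs : c s ∈ e.target) :
    HasMFDerivWithinAt 𝓘(ℝ, ℝ) 𝓘(ℝ, E) (fun s ↦ e.symm (c s)) J s
      ((1 : ℝ →L[ℝ] ℝ).smulRight (chartDerivSymm e (c s) a)) := by
  have h1 := ((mdifferentiable_of_mem_maximalAtlas he).mdifferentiableAt_symm hs).hasMFDerivAt
  refine HasMFDerivWithinAt.congr_mfderiv
    (h1.comp_hasMFDerivWithinAt s h.hasFDerivWithinAt.hasMFDerivWithinAt) ?_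
  ext
  change chartDerivSymm e (c s) (ContinuousLinearMap.toSpanSingleton ℝ a 1) =
    (1 : ℝ →L[ℝ] ℝ) 1 • chartDerivSymm e (c s) a
  simp

theorem eq_of_hasDerivWithinAt_zero {f : ℝ → E} {J : Set ℝ} (hJ : Convex ℝ J)
    (h : ∀ s ∈ J, HasDerivWithinAt f 0 J s) {s t : ℝ} (hs : s ∈ J) (ht : t ∈ J) : f s = f t := by
  have := hJ.norm_image_sub_le_of_norm_hasDerivWithin_le (f := f) (C := 0) h (by simp) ht hs
  simpa [sub_eq_zero] using this

end TangentCurve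

section FlowBox

variable {E : Type*} [NormedAddCommGroup E] [NormedSpace ℝ E] {M : Type*} [TopologicalSpace M]
  [ChartedSpace E M]

/-- A chart in which the line field `N` is spanned by a vector field with a complete flow, together
with a ball on which the flow stays in the domain of the chart. -/
structure FlowBox (N : ∀ x : M, Submodule ℝ (TangentSpace 𝓘(ℝ, E) x)) where
  /-- The chart. -/
  chart : OpenPartialHomeomorph M E
  /-- The linear form normalizing the vector field. -/
  form : E →L[ℝ] ℝ
  /-- The vector field spanning the line field. -/
  field : E → E
  /-- The flow of the vector field. -/
  flow : E → ℝ → E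
  /-- A Lipschitz constant of the vector field. -/
  lip : ℝ≥0
  /-- A bound for the vector field. -/
  bound : ℝ≥0
  /-- The open set where the vector field spans the line field. -/
  region : Set E
  /-- The centre of the box. -/
  center : E
  /-- The radius of the box. -/
  radius : ℝ
  mem_maximalAtlas : chart ∈ IsManifold.maximalAtlas 𝓘(ℝ, E) ∞ M
  contDiff_field : ContDiff ℝ ∞ field
  isTransverseFlow : IsTransverseFlow form field flow lip bound
  isNormalForm : IsNormalForm N chart form field region
  radius_pos : 0 < radius
  flow_mem : ∀ z ∈ Metric.ball center radius, ∀ z' ∈ Metric.ball center radius,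
    ∀ s ∈ Icc (0 : ℝ) 1, flow z (s * (form z' - form z)) ∈ region

variable {N : ∀ x : M, Submodule ℝ (TangentSpace 𝓘(ℝ, E) x)}

theorem IsNormalForm.congr {e : OpenPartialHomeomorph M E} {ℓ : E →L[ℝ] ℝ} {w w' : E → E}
    {O O' : Set E} (h : IsNormalForm N e ℓ w O) (hO' : IsOpen O') (hsub : O' ⊆ O)
    (hw : EqOn w' w O') : IsNormalForm N e ℓ w' O' where
  isOpen := hO'
  subset := hsub.trans h.subset
  contDiffOn := (h.contDiffOn.mono hsub).congr hw
  normalized u hu := by rw [hw hu, h.normalized u (hsub hu)]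
  mem_iff u hu ξ := by rw [hw hu, h.mem_iff u (hsub hu)]

theorem IsNormalForm.exists_chartDeriv_eq {e : OpenPartialHomeomorph M E} {ℓ : E →L[ℝ] ℝ}
    {w : E → E} {O : Set E} (h : IsNormalForm N e ℓ w O) {x : M} (hx : x ∈ e.source)
    (hxO : e x ∈ O) {ξ : TangentSpace 𝓘(ℝ, E) x} (hξ : ξ ∈ N x) :
    ∃ a : ℝ, chartDeriv e x ξ = a • w (e x) := by
  obtain ⟨u, hu, rfl⟩ : ∃ u ∈ O, e.symm u = x := ⟨e x, hxO, e.left_inv hx⟩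
  rw [e.right_inv (h.subset hu)]
  exact (h.mem_iff u hu ξ).1 hξ

/-- Two points of a ball of radius ρ are at distance at most 2ρ, so the flow lines concerned move at
most L * ‖ℓ‖ * 2ρ. The radius r / (1 + 2 L ‖ℓ‖) keeps them in the r-ball where the global field
agrees with w. -/
theorem IsNormalForm.exists_flowBox [FiniteDimensional ℝ E] {e : OpenPartialHomeomorph M E}
    {ℓ : E →L[ℝ] ℝ} {w : E → E} {O : Set E} (h : IsNormalForm N e ℓ w O)
    (he : e ∈ IsManifold.maximalAtlas 𝓘(ℝ, E) ∞ M) {x : M} (hx : x ∈ e.source) (hxO : e x ∈ O) :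
    ∃ b : FlowBox N, x ∈ b.chart.source ∧ b.chart x = b.center := by
  obtain ⟨w', α, K, L, hw', hev, hα⟩ :=
    exists_isTransverseFlow (h.isOpen.mem_nhds hxO) h.contDiffOn h.normalized
  obtain ⟨r, hr, hball⟩ := Metric.mem_nhds_iff.1 (inter_mem (h.isOpen.mem_nhds hxO) hev)
  have hc : 0 < 1 + 2 * (L * ‖ℓ‖) := by positivity
  refine ⟨⟨e, ℓ, w', α, K, L, Metric.ball (e x) r, e x, r / (1 + 2 * (L * ‖ℓ‖)), he, hw', hα,
    h.congr Metric.isOpen_ball (fun u hu ↦ (hball hu).1) (fun u hu ↦ (hball hu).2),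
    by positivity, ?_⟩, hx, rfl⟩
  intro z hz z' hz' s hs
  set ρ := r / (1 + 2 * (L * ‖ℓ‖)) with hρ
  have hρr : ρ * (1 + 2 * (L * ‖ℓ‖)) = r := div_mul_cancel₀ r hc.ne'
  have h1 : |s * (ℓ z' - ℓ z)| ≤ ‖ℓ‖ * (2 * ρ) := by
    rw [abs_mul, abs_of_nonneg hs.1, ← map_sub, ← Real.norm_eq_abs]
    have h3 : ‖z' - z‖ ≤ 2 * ρ := by
      rw [← dist_eq_norm]
      have := dist_triangle_right z' z (e x)
      rw [Metric.mem_ball] at hz hz'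
      linarith
    calc s * ‖ℓ (z' - z)‖ ≤ 1 * (‖ℓ‖ * (2 * ρ)) := by
          gcongr
          · exact hs.2
          · exact (ℓ.le_opNorm _).trans (by gcongr)
      _ = _ := one_mul _
  have h2 := hα.dist_le_abs z (s * (ℓ z' - ℓ z)) 0
  rw [hα.zero, sub_zero] at h2
  rw [Metric.mem_ball] at hz ⊢
  calc dist (α z (s * (ℓ z' - ℓ z))) (e x) ≤ dist (α z (s * (ℓ z' - ℓ z))) z + dist z (e x) :=
        dist_triangle _ _ _
    _ < L * (‖ℓ‖ * (2 * ρ)) + ρ := by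
        refine add_lt_add_of_le_of_lt (h2.trans ?_) hz
        gcongr
    _ = r := by rw [← hρr]; ring

namespace FlowBox

variable (b : FlowBox N)

/-- The domain of a flow box. -/
def domain : Set M := b.chart.source ∩ b.chart ⁻¹' Metric.ball b.center b.radius

/-- The projection of a flow box along the leaves of the line field. -/
def proj (x : M) : E := flowProj b.form b.flow (b.form b.center) (b.chart x)

theorem isOpen_domain : IsOpen b.domain := b.chart.isOpen_inter_preimage Metric.isOpen_ball

theorem continuousOn_proj : ContinuousOn b.proj b.domain :=
  (b.isTransverseFlow.continuous_flowProj b.center).comp_continuousOn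
    (b.chart.continuousOn.mono inter_subset_left)

theorem ball_subset_region : Metric.ball b.center b.radius ⊆ b.region := fun z hz ↦ by
  simpa [b.isTransverseFlow.zero] using b.flow_mem z hz z hz 0 (by simp)

theorem chart_symm_mem_domain {z : E} (hz : z ∈ Metric.ball b.center b.radius) :
    b.chart.symm z ∈ b.domain := by
  have ht := b.isNormalForm.subset (b.ball_subset_region hz)
  exact ⟨b.chart.map_target ht, by rwa [mem_preimage, b.chart.right_inv ht]⟩

variable {b}

-- In the chart the velocity of a tangent curve is a multiple of w, which is the first-order
-- tangency needed by `hasDerivWithinAt_flowProj_comp`.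
open Asymptotics in
theorem hasDerivWithinAt_proj_comp {γ : ℝ → M} {J : Set ℝ} {s : ℝ}
    (hγ : IsTangentCurveOn N γ J) (hs : s ∈ J) (hsb : γ s ∈ b.domain) :
    HasDerivWithinAt (fun s ↦ b.proj (γ s)) 0 J s := by
  obtain ⟨ξ, hξ, hd⟩ := hγ s hs
  obtain ⟨a, ha⟩ := b.isNormalForm.exists_chartDeriv_eq hsb.1 (b.ball_subset_region hsb.2) hξ
  have hc := hasDerivWithinAt_chart_comp b.mem_maximalAtlas hsb.1 hd
  rw [ha] at hc
  have hP := hc.sub ((b.form.hasFDerivAt.comp_hasDerivWithinAt s hc).smul_const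
    (b.field (b.chart (γ s))))
  refine b.isTransverseFlow.hasDerivWithinAt_flowProj_comp b.center
    (c := fun s ↦ b.chart (γ s)) hc.hasFDerivWithinAt.isBigO_sub ?_
  refine (hasDerivWithinAt_iff_isLittleO.1 hP).congr_left fun t ↦ ?_
  simp only [Function.comp_apply, map_smul, b.isTransverseFlow.normalized, Pi.sub_apply, map_sub,
    smul_eq_mul, mul_one, sub_self, smul_zero, sub_zero, sub_smul]
  abel

theorem proj_eq_of_isTangentCurveOn {γ : ℝ → M} {J : Set ℝ} (hJ : Convex ℝ J)
    (hγ : IsTangentCurveOn N γ J) (hb : ∀ s ∈ J, γ s ∈ b.domain) {s t : ℝ} (hs : s ∈ J)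
    (ht : t ∈ J) : b.proj (γ s) = b.proj (γ t) :=
  eq_of_hasDerivWithinAt_zero (f := fun s ↦ b.proj (γ s)) hJ
    (fun s hs ↦ hasDerivWithinAt_proj_comp hγ hs (hb s hs)) hs ht

theorem eventually_proj_eq_of_isTangentCurveOn {γ : ℝ → M} {J : Set ℝ} (hJ : Convex ℝ J)
    (hγ : IsTangentCurveOn N γ J) {s₀ : ℝ} (hs₀ : s₀ ∈ J) (hb : γ s₀ ∈ b.domain) :
    ∀ᶠ s in 𝓝[J] s₀, γ s ∈ b.domain ∧ b.proj (γ s) = b.proj (γ s₀) := by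
  have hdom : ∀ᶠ s in 𝓝[J] s₀, γ s ∈ b.domain :=
    (hγ.continuousOn s₀ hs₀).eventually (b.isOpen_domain.mem_nhds hb)
  obtain ⟨ε, hε, hball⟩ := Metric.mem_nhdsWithin_iff.1 hdom
  filter_upwards [inter_mem_nhdsWithin J (Metric.ball_mem_nhds s₀ hε)] with s hs
  refine ⟨hball ⟨hs.2, hs.1⟩, ?_⟩
  exact proj_eq_of_isTangentCurveOn ((convex_ball s₀ ε).inter hJ) (hγ.mono inter_subset_right)
    (fun s hs ↦ hball hs) ⟨hs.2, hs.1⟩ ⟨Metric.mem_ball_self hε, hs₀⟩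

theorem isTangentCurveOn_flow {z : E} {τ : ℝ} {J : Set ℝ}
    (h : ∀ s ∈ J, b.flow z (s * τ) ∈ b.region) :
    IsTangentCurveOn N (fun s ↦ b.chart.symm (b.flow z (s * τ))) J := by
  intro s hs
  have h1 : HasDerivWithinAt (fun s ↦ b.flow z (s * τ)) (τ • b.field (b.flow z (s * τ))) J s := by
    have h2 : HasDerivAt (fun s : ℝ ↦ s * τ) τ s := by simpa using (hasDerivAt_id s).mul_const τ
    exact ((b.isTransverseFlow.hasDerivAt z (s * τ)).scomp s h2).hasDerivWithinAt
  exact ⟨_, b.isNormalForm.chartDerivSymm_mem b.mem_maximalAtlas (h s hs) τ,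
    h1.hasMFDerivWithinAt_chart_symm_comp b.mem_maximalAtlas (b.isNormalForm.subset (h s hs))⟩

theorem flow_eq_of_proj_eq {x y : M} (h : b.proj x = b.proj y) :
    b.chart y = b.flow (b.chart x) (b.form (b.chart y) - b.form (b.chart x)) :=
  b.isTransverseFlow.eq_flow_of_flowProj_eq h

end FlowBox

end FlowBox

/-! ### Plaques and tangent arcs -/

section TangentArc

variable {m : ℕ} {M : Type*} [TopologicalSpace M] [ChartedSpace (EuclideanSpace ℝ (Fin m)) M]
  {N : ∀ x : M, Submodule ℝ (TangentSpace (𝓡 m) x)}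

theorem ContMDiffOn.isTangentCurveOn {γ : ℝ → M}
    (hγ : ContMDiffOn 𝓘(ℝ, ℝ) (𝓡 m) ∞ γ (Icc 0 1))
    (h : ∀ t ∈ Icc (0 : ℝ) 1, mfderivWithin 𝓘(ℝ, ℝ) (𝓡 m) γ (Icc 0 1) t (1 : ℝ) ∈ N (γ t)) :
    IsTangentCurveOn N γ (Icc 0 1) := by
  intro s hs
  refine ⟨_, h s hs, ?_⟩
  refine ((hγ s hs).mdifferentiableWithinAt (by simp)).hasMFDerivWithinAt.congr_mfderiv ?_
  ext
  exact (one_smul ℝ (mfderivWithin 𝓘(ℝ, ℝ) (𝓡 m) γ (Icc 0 1) s (1 : ℝ))).symm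

/-- Equal projections put both points on one flow line; rescaling its time by τ to [0, 1] gives the
arc. -/
theorem FlowBox.joinedByTangentArc {b : FlowBox N} {x y : M} (hx : x ∈ b.domain)
    (hy : y ∈ b.domain) (h : b.proj x = b.proj y) : JoinedByTangentArc N x y := by
  set τ := b.form (b.chart y) - b.form (b.chart x) with hτ
  have hmem : ∀ s ∈ Icc (0 : ℝ) 1, b.flow (b.chart x) (s * τ) ∈ b.region :=
    b.flow_mem _ hx.2 _ hy.2
  have htan := FlowBox.isTangentCurveOn_flow hmem
  refine ⟨fun s ↦ b.chart.symm (b.flow (b.chart x) (s * τ)), ?_, ?_, ?_, fun t ht ↦ ?_⟩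
  · have h1 : ContDiff ℝ ∞ (fun s : ℝ ↦ b.flow (b.chart x) (s * τ)) :=
      (b.isTransverseFlow.contDiff_flow b.contDiff_field _).comp (contDiff_id.mul contDiff_const)
    exact (contMDiffOn_symm_of_mem_maximalAtlas b.mem_maximalAtlas).comp h1.contMDiff.contMDiffOn
      fun s hs ↦ b.isNormalForm.subset (hmem s hs)
  · simp [b.isTransverseFlow.zero, b.chart.left_inv hx.1]
  · simp only [one_mul]
    rw [hτ, ← flow_eq_of_proj_eq h, b.chart.left_inv hy.1]
  · obtain ⟨ξ, hξ, hd⟩ := htan t ht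
    rw [hd.mfderivWithin ((uniqueDiffOn_Icc_zero_one t ht).uniqueMDiffWithinAt)]
    have h4 : ((1 : ℝ →L[ℝ] ℝ).smulRight ξ) 1 = ξ := by simp
    exact h4.symm ▸ hξ

end TangentArc

/-! ### The plaque atlas of a line field -/

theorem dimH_setOf_form_eq_le {E : Type*} [NormedAddCommGroup E] [NormedSpace ℝ E]
    [FiniteDimensional ℝ E] {ℓ : E →L[ℝ] ℝ} (hℓ : ℓ ≠ 0) (u : E) :
    dimH {x | ℓ x = ℓ u} ≤ ((Module.finrank ℝ E - 1 : ℕ) : ENNReal) := by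
  let f : LinearMap.ker ℓ.toLinearMap → E := fun k ↦ (k : E) + u
  have hf : Isometry f := Isometry.of_dist_eq fun a b ↦ by simp [f, Subtype.dist_eq]
  have himage : {x | ℓ x = ℓ u} ⊆ f '' univ := by
    intro x hx
    have hx' : ℓ x = ℓ u := hx
    exact ⟨⟨x - u, by simp [hx']⟩, mem_univ _, by simp [f]⟩
  have hℓ' : ℓ.toLinearMap ≠ 0 := fun h ↦ hℓ (by ext x; exact LinearMap.congr_fun h x)
  have hrank := Module.Dual.finrank_ker_add_one_of_ne_zero hℓ'
  calc dimH {x | ℓ x = ℓ u} ≤ dimH (f '' univ) := dimH_mono himage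
    _ = dimH (univ : Set (LinearMap.ker ℓ.toLinearMap)) := hf.dimH_image _
    _ = ((Module.finrank ℝ (LinearMap.ker ℓ.toLinearMap) : ℕ) : ENNReal) :=
        Real.dimH_univ_eq_finrank _
    _ ≤ _ := by
        have : Module.finrank ℝ (LinearMap.ker ℓ.toLinearMap) ≤ Module.finrank ℝ E - 1 := by omega
        exact_mod_cast this

namespace FlowBox

variable {E : Type*} [NormedAddCommGroup E] [NormedSpace ℝ E] {M : Type*} [TopologicalSpace M]
  [ChartedSpace E M] {N : ∀ x : M, Submodule ℝ (TangentSpace 𝓘(ℝ, E) x)}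

theorem form_proj (b : FlowBox N) (x : M) : b.form (b.proj x) = b.form b.center :=
  b.isTransverseFlow.form_flowProj _ _

theorem proj_chart_symm_flow (b : FlowBox N) {z : E} {τ : ℝ} (h : b.flow z τ ∈ b.chart.target) :
    b.proj (b.chart.symm (b.flow z τ)) = flowProj b.form b.flow (b.form b.center) z := by
  rw [proj, b.chart.right_inv h, b.isTransverseFlow.flowProj_flow]

theorem proj_chart_symm_of_form_eq (b : FlowBox N) {z : E} (hz : z ∈ b.chart.target)
    (h : b.form z = b.form b.center) : b.proj (b.chart.symm z) = z := by
  rw [proj, b.chart.right_inv hz, b.isTransverseFlow.flowProj_of_form_eq h]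

theorem dist_flow_le (b : FlowBox N) (z a : E) {s : ℝ} (hs : s ∈ Icc (0 : ℝ) 1) :
    dist (b.flow z (s * (b.form a - b.form z))) a ≤ (b.bound * ‖b.form‖ + 1) * dist z a := by
  have h1 := b.isTransverseFlow.dist_le_abs z (s * (b.form a - b.form z)) 0
  rw [b.isTransverseFlow.zero, sub_zero, abs_mul, abs_of_nonneg hs.1] at h1
  have h2 : |b.form a - b.form z| ≤ ‖b.form‖ * dist z a := by
    rw [← map_sub, ← Real.norm_eq_abs, dist_comm, dist_eq_norm]
    exact b.form.le_opNorm _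
  have h3 : s * |b.form a - b.form z| ≤ 1 * (‖b.form‖ * dist z a) := by
    gcongr
    exact hs.2
  calc dist (b.flow z (s * (b.form a - b.form z))) a
      ≤ dist (b.flow z (s * (b.form a - b.form z))) z + dist z a := dist_triangle _ _ _
    _ ≤ b.bound * (1 * (‖b.form‖ * dist z a)) + dist z a := by
        gcongr
        exact h1.trans (by gcongr)
    _ = _ := by ring

theorem exists_lipschitzOnWith_proj_chart_symm [FiniteDimensional ℝ E] [IsManifold 𝓘(ℝ, E) ∞ M]
    (b b' : FlowBox N) {z : M}
    (hz : z ∈ b.domain ∩ b'.domain) :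
    ∃ η > 0, ∃ K : ℝ≥0, Metric.ball (b.chart z) η ⊆ Metric.ball b.center b.radius ∧
      (∀ y ∈ Metric.ball (b.chart z) η, b.chart.symm y ∈ b'.domain) ∧
      LipschitzOnWith K (fun y ↦ b'.proj (b.chart.symm y)) (Metric.ball (b.chart z) η) := by
  have htar : b.chart z ∈ b.chart.target := b.chart.map_source hz.1.1
  have hleft := b.chart.left_inv hz.1.1
  have h1 : ContDiffAt ℝ 1 (b'.chart ∘ b.chart.symm) (b.chart z) := by
    have h2 : ContMDiffAt 𝓘(ℝ, E) 𝓘(ℝ, E) ∞ (b'.chart ∘ b.chart.symm) (b.chart z) := by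
      refine ContMDiffAt.comp (b.chart z) (I' := 𝓘(ℝ, E)) ?_
        ((contMDiffOn_symm_of_mem_maximalAtlas b.mem_maximalAtlas).contMDiffAt
          (b.chart.open_target.mem_nhds htar))
      rw [hleft]
      exact (contMDiffOn_of_mem_maximalAtlas b'.mem_maximalAtlas).contMDiffAt
        (b'.chart.open_source.mem_nhds hz.2.1)
    exact h2.contDiffAt.of_le (WithTop.coe_le_coe.2 (le_top : (1 : ℕ∞) ≤ ⊤))
  obtain ⟨K₁, s, hs, hK₁⟩ := h1.exists_lipschitzOnWith
  obtain ⟨K₂, hK₂⟩ := b'.isTransverseFlow.exists_lipschitzOnWith_flowProj b'.center b'.radius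
  have hdom : b.chart.symm ⁻¹' b'.domain ∈ 𝓝 (b.chart z) := by
    refine b.chart.continuousAt_symm htar (b'.isOpen_domain.mem_nhds ?_)
    rw [hleft]; exact hz.2
  obtain ⟨η, hη, hball⟩ := Metric.mem_nhds_iff.1
    (inter_mem (inter_mem hs hdom) (Metric.isOpen_ball.mem_nhds hz.1.2))
  refine ⟨η, hη, K₂ * K₁, fun y hy ↦ (hball hy).2, fun y hy ↦ (hball hy).1.2, ?_⟩
  refine hK₂.comp (hK₁.mono fun y hy ↦ (hball hy).1.1) fun y hy ↦ ?_
  exact Metric.ball_subset_closedBall (hball hy).1.2.2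

/-- Slide each point along its flow line to the level of ℓ through z. This leaves the second
projection unchanged, and the endpoint is a Lipschitz function of the first projection. -/
theorem exists_dist_proj_le [FiniteDimensional ℝ E] [IsManifold 𝓘(ℝ, E) ∞ M]
    (b b' : FlowBox N) {z : M} (hz : z ∈ b.domain ∩ b'.domain) :
    ∃ O ∈ 𝓝 z, ∃ K : ℝ≥0, ∀ x ∈ O, ∀ y ∈ O,
      dist (b'.proj x) (b'.proj y) ≤ K * dist (b.proj x) (b.proj y) := by
  obtain ⟨η, hη, K, hηb, hηb', hK⟩ := exists_lipschitzOnWith_proj_chart_symm b b' hz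
  set a := b.chart z with ha
  set κ : ℝ := b.bound * ‖b.form‖ + 1 with hκ
  have hκpos : 0 < κ := by positivity
  -- Sliding multiplies the distance to a by at most κ, so the arcs stay in the η-ball.
  let O : Set M := b.chart.source ∩ b.chart ⁻¹' Metric.ball a (η / κ)
  have hO : O ∈ 𝓝 z := (b.chart.isOpen_inter_preimage Metric.isOpen_ball).mem_nhds
    ⟨hz.1.1, Metric.mem_ball_self (by positivity)⟩
  have harc : ∀ x ∈ O, ∀ s ∈ Icc (0 : ℝ) 1,
      b.flow (b.chart x) (s * (b.form a - b.form (b.chart x))) ∈ Metric.ball a η := by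
    intro x hx s hs
    refine Metric.mem_ball.2 ((b.dist_flow_le _ a hs).trans_lt ?_)
    have hx2 : dist (b.chart x) a < η / κ := hx.2
    rw [← hκ]
    calc κ * dist (b.chart x) a < κ * (η / κ) := by gcongr
      _ = η := by field_simp
  have hend : ∀ x ∈ O, b.flow (b.proj x) (b.form a - b.form b.center) ∈ Metric.ball a η ∧
      b'.proj x = b'.proj (b.chart.symm (b.flow (b.proj x) (b.form a - b.form b.center))) := by
    intro x hx
    have h1 : b.flow (b.proj x) (b.form a - b.form b.center) =
        b.flow (b.chart x) (1 * (b.form a - b.form (b.chart x))) := by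
      rw [one_mul]
      exact b.isTransverseFlow.flow_flowProj _ _ _
    refine ⟨h1 ▸ harc x hx 1 (by simp), ?_⟩
    have htan : IsTangentCurveOn N
        (fun s ↦ b.chart.symm (b.flow (b.chart x) (s * (b.form a - b.form (b.chart x)))))
        (Icc (0 : ℝ) 1) :=
      isTangentCurveOn_flow fun s hs ↦ b.ball_subset_region (hηb (harc x hx s hs))
    have h2 := proj_eq_of_isTangentCurveOn (b := b') (convex_Icc (0 : ℝ) 1) htan
      (fun s hs ↦ hηb' _ (harc x hx s hs)) (s := 0) (t := 1) (by simp) (by simp)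
    simp only [zero_mul, b.isTransverseFlow.zero, b.chart.left_inv hx.1] at h2
    rw [h2, h1]
  refine ⟨O, hO, K * (Real.exp (b.lip * |b.form a - b.form b.center|)).toNNReal,
    fun x hx y hy ↦ ?_⟩
  rw [(hend x hx).2, (hend y hy).2]
  refine (hK.dist_le_mul _ (hend x hx).1 _ (hend y hy).1).trans ?_
  rw [NNReal.coe_mul, mul_assoc, Real.coe_toNNReal _ (Real.exp_nonneg _)]
  gcongr
  rw [mul_comm]
  exact b.isTransverseFlow.dist_le _ _ _

theorem continuousAt_chart_symm_flow (b : FlowBox N) {x : M} {τ : ℝ}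
    (hx : x ∈ b.chart.source) (h : b.flow (b.chart x) τ ∈ b.chart.target) :
    ContinuousAt (fun y ↦ b.chart.symm (b.flow (b.chart y) τ)) x := by
  have h1 : ContinuousAt (fun y ↦ b.flow (b.chart y) τ) x :=
    (b.isTransverseFlow.continuous_flow_left τ).continuousAt.comp (b.chart.continuousAt hx)
  exact ContinuousAt.comp (f := fun y ↦ b.flow (b.chart y) τ) (b.chart.continuousAt_symm h) h1

/-- The transversal is a closed disc of half the radius in the hyperplane through the centre, on
which the projection is the chart itself. -/
theorem exists_isCompact_transversal [FiniteDimensional ℝ E] (b : FlowBox N) {x : M}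
    (hx : x ∈ b.chart.source) (hxb : b.chart x = b.center) :
    x ∈ b.domain ∧ ∃ S ⊆ b.domain, IsCompact S ∧ x ∈ S ∧ InjOn b.proj S ∧
      ∃ ε > 0, ∀ z ∈ b.domain, dist (b.proj z) (b.proj x) < ε →
        ∃ z' ∈ S, b.proj z' = b.proj z := by
  have hr := b.radius_pos
  let D : Set E := {z | b.form z = b.form b.center} ∩ Metric.closedBall b.center (b.radius / 2)
  have hDball : D ⊆ Metric.ball b.center b.radius := fun z hz ↦
    Metric.closedBall_subset_ball (by linarith) hz.2
  have hDt : D ⊆ b.chart.target := fun z hz ↦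
    b.isNormalForm.subset (b.ball_subset_region (hDball hz))
  have hD : IsCompact D := (isCompact_closedBall _ _).inter_left
    (isClosed_eq b.form.continuous continuous_const)
  have hproj : ∀ z ∈ D, b.proj (b.chart.symm z) = z := fun z hz ↦
    b.proj_chart_symm_of_form_eq (hDt hz) hz.1
  have hcD : b.center ∈ D := ⟨rfl, Metric.mem_closedBall_self (by positivity)⟩
  have hxe : b.chart.symm b.center = x := by rw [← hxb, b.chart.left_inv hx]
  refine ⟨⟨hx, by rw [mem_preimage, hxb]; exact Metric.mem_ball_self hr⟩, b.chart.symm '' D, ?_,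
    hD.image_of_continuousOn (b.chart.continuousOn_symm.mono hDt), ⟨_, hcD, hxe⟩, ?_,
    b.radius / 2, by positivity, fun z hz hzx ↦ ?_⟩
  · rintro _ ⟨z, hz, rfl⟩
    exact b.chart_symm_mem_domain (hDball hz)
  · rintro _ ⟨z, hz, rfl⟩ _ ⟨z', hz', rfl⟩ h
    rw [hproj z hz, hproj z' hz'] at h
    rw [h]
  · have hpx : b.proj x = b.center := by rw [← hxe, hproj _ hcD]
    rw [hpx] at hzx
    have : b.proj z ∈ D := ⟨b.form_proj z, Metric.mem_closedBall.2 hzx.le⟩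
    exact ⟨_, ⟨_, this, rfl⟩, hproj _ this⟩

end FlowBox

/-! ### Assembling the plaque atlas -/

section LeafAtlas

variable {m : ℕ} {M : Type*} [TopologicalSpace M] [ChartedSpace (EuclideanSpace ℝ (Fin m)) M]
  {N : ∀ x : M, Submodule ℝ (TangentSpace (𝓡 m) x)}

theorem FlowBox.leafSetoid_rel {b : FlowBox N} {x y : M} (hx : x ∈ b.domain) (hy : y ∈ b.domain)
    (h : b.proj x = b.proj y) : leafSetoid N x y :=
  Relation.EqvGen.rel _ _ (b.joinedByTangentArc hx hy h)

theorem plaqueAtlas_flowBox [IsManifold (𝓡 m) ∞ M]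
    (hbox : ∀ x, ∃ b : FlowBox N, x ∈ b.chart.source ∧ b.chart x = b.center) :
    PlaqueAtlas (leafSetoid N) (fun b : FlowBox N ↦ b.domain) (fun b ↦ b.proj) (m - 1) where
  isOpen b := b.isOpen_domain
  continuousOn b := b.continuousOn_proj
  rel b x hx y hy h := b.leafSetoid_rel hx hy h
  generated := by
    intro J' hJ' x y hxy
    have hxy' : Relation.EqvGen (JoinedByTangentArc N) x y := hxy
    induction hxy' with
    | rel x y h =>
      obtain ⟨γ, hγ, rfl, rfl, htan⟩ := h
      have hcurve := hγ.isTangentCurveOn htan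
      -- Locally the arc stays in one plaque of a box from J'; connectedness of the interval chains
      -- these plaques.
      refine isPreconnected_Icc.induction₂ (s := Icc (0 : ℝ) 1)
        (fun s t ↦ Relation.EqvGen (SamePlaque (fun b : FlowBox N ↦ b.domain) (fun b ↦ b.proj) J')
          (γ s) (γ t)) (fun s hs ↦ ?_) (fun _ _ _ _ _ _ h1 h2 ↦ h1.trans _ _ _ h2)
        (fun _ _ _ _ h ↦ h.symm) (by simp) (by simp)
      obtain ⟨b, hb, hsb⟩ := hJ' (γ s)
      filter_upwards [b.eventually_proj_eq_of_isTangentCurveOn (convex_Icc _ _) hcurve hs hsb]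
        with t ht
      exact Relation.EqvGen.rel _ _ ⟨b, hb, hsb, ht.1, ht.2.symm⟩
    | refl x => exact Relation.EqvGen.refl x
    | symm x y h ih => exact (ih h).symm
    | trans x y z h1 h2 ih1 ih2 => exact (ih1 h1).trans _ _ _ (ih2 h2)
  lipschitz b b' z hz := b.exists_dist_proj_le b' hz
  plaque_open := by
    intro b y hy z hz hyz O hO
    have hflow := FlowBox.flow_eq_of_proj_eq hyz
    -- Flowing for this fixed time carries y to z, preserves plaques and is continuous in the
    -- starting point.
    set τ := b.form (b.chart z) - b.form (b.chart y)
    have htar : b.flow (b.chart y) τ ∈ b.chart.target := hflow ▸ b.chart.map_source hz.1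
    have hcont := b.continuousAt_chart_symm_flow hy.1 htar
    have hval : b.chart.symm (b.flow (b.chart y) τ) = z := by
      rw [← hflow, b.chart.left_inv hz.1]
    have h1 : ∀ᶠ y' in 𝓝 y, b.chart.symm (b.flow (b.chart y') τ) ∈ O ∩ b.domain :=
      hcont.eventually (by simp only [hval]; exact inter_mem hO (b.isOpen_domain.mem_nhds hz))
    have h2 : ∀ᶠ y' in 𝓝 y, b.flow (b.chart y') τ ∈ b.chart.target :=
      ((b.isTransverseFlow.continuous_flow_left τ).continuousAt.comp
        (b.chart.continuousAt hy.1)).eventually (b.chart.open_target.mem_nhds htar)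
    filter_upwards [h1, h2, b.isOpen_domain.mem_nhds hy] with y' h1 h2 h3
    exact ⟨_, h1.1, b.leafSetoid_rel h3 h1.2 (b.proj_chart_symm_flow h2).symm⟩
  exists_transversal x := by
    obtain ⟨b, hx, hxb⟩ := hbox x
    exact ⟨b, b.exists_isCompact_transversal hx hxb⟩
  dimH_le b := by
    have hℓ : b.form ≠ 0 := fun h ↦ by
      have := b.isTransverseFlow.normalized b.center
      simp [h] at this
    have h1 := dimH_setOf_form_eq_le hℓ b.center
    rw [finrank_euclideanSpace_fin] at h1
    refine (dimH_mono ?_).trans h1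
    rintro _ ⟨x, -, rfl⟩
    exact b.form_proj x

/-- The transversal coordinate of one box is locally a function of that of the other, so local
constancy along a curve does not depend on the box. -/
theorem FlowBox.eventually_proj_eq_of_mem [IsManifold (𝓡 m) ∞ M] (b b' : FlowBox N)
    {γ : ℝ → M} {J : Set ℝ} {s₀ : ℝ}
    (hγ : ContinuousWithinAt γ J s₀) (hb : γ s₀ ∈ b.domain) (hb' : γ s₀ ∈ b'.domain)
    (h : ∀ᶠ s in 𝓝[J] s₀, b.proj (γ s) = b.proj (γ s₀)) :
    ∀ᶠ s in 𝓝[J] s₀, b'.proj (γ s) = b'.proj (γ s₀) := by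
  obtain ⟨O, hO, K, hK⟩ := b.exists_dist_proj_le b' ⟨hb, hb'⟩
  filter_upwards [h, hγ hO] with s hs hsO
  have := hK _ hsO _ (mem_of_mem_nhds hO)
  rwa [hs, dist_self, mul_zero, dist_le_zero] at this

end LeafAtlas

/-! ### Invariance of the leaves under a projectable evolution -/

/-- Continuous induction. The hypothesis allows any start t₁ near t, also before it, so the supremum
is crossed without assuming Q closed. -/
theorem forall_nonneg_of_local_propagation {Q : ℝ → Prop} (h0 : Q 0)
    (h : ∀ t ≥ 0, ∃ ε > 0, ∀ t₁ ≥ 0, ∀ t₂, t₁ ≤ t₂ → |t₁ - t| < ε → |t₂ - t| < ε → Q t₁ → Q t₂)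
    {t : ℝ} (ht : 0 ≤ t) : Q t := by
  let S : Set ℝ := {t | 0 ≤ t ∧ ∀ t' ∈ Icc 0 t, Q t'}
  have h0S : (0 : ℝ) ∈ S := ⟨le_rfl, fun t' ht' ↦ by
    rw [Icc_self] at ht'
    rwa [mem_singleton_iff.1 ht']⟩
  by_contra hQ
  have hb : BddAbove S := ⟨t, fun x hx ↦ by
    by_contra hlt
    exact hQ (hx.2 t ⟨ht, (not_le.1 hlt).le⟩)⟩
  set σ := sSup S
  have hσ0 : 0 ≤ σ := le_csSup hb h0S
  obtain ⟨ε, hε, hprop⟩ := h σ hσ0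
  obtain ⟨t₁, ht₁, hlt⟩ := exists_lt_of_lt_csSup ⟨0, h0S⟩ (by linarith : σ - ε < sSup S)
  have ht₁σ : t₁ ≤ σ := le_csSup hb ht₁
  have hmem : σ + ε / 2 ∈ S := by
    refine ⟨by linarith, fun t' ht' ↦ ?_⟩
    rcases le_total t' t₁ with h1 | h1
    · exact ht₁.2 t' ⟨ht'.1, h1⟩
    · exact hprop t₁ ht₁.1 t' h1 (by rw [abs_lt]; constructor <;> linarith)
        (by rw [abs_lt]; constructor <;> linarith [ht'.2]) (ht₁.2 t₁ ⟨ht₁.1, le_rfl⟩)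
  linarith [le_csSup hb hmem]

section Evolution

variable {m : ℕ} {M : Type*} [TopologicalSpace M] [T2Space M]
  [ChartedSpace (EuclideanSpace ℝ (Fin m)) M] [IsManifold (𝓡 m) ∞ M]
  {N : ∀ x : M, Submodule ℝ (TangentSpace (𝓡 m) x)} {V : ∀ x : M, TangentSpace (𝓡 m) x}

/-- Near each point, tangential Gronwall estimates hold for the evolution read in a flow box. -/
theorem FlowBox.exists_tangential_estimate (b : FlowBox N) (hV : IsVectorFieldOfClass 2 V)
    (hproj : IsProjectable N V) {φ : Flow ℝ≥0 M} (hφ : IsEvolutionOf φ V) {x₀ : M}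
    (hx₀ : x₀ ∈ b.domain) :
    ∃ O ∈ 𝓝 x₀, ∃ δ > 0, ∃ C' : ℝ,
      (∀ x ∈ O, ∀ t : ℝ≥0, t ≤ δ → φ t x ∈ b.domain) ∧
      ∀ x ∈ O, ∀ y ∈ O, ∀ t : ℝ≥0, t ≤ δ →
        ‖b.chart (φ t y) - b.chart (φ t x)‖ ≤ C' * ‖b.chart y - b.chart x‖ ∧
        ‖b.chart (φ t y) - b.chart (φ t x) -
          b.form (b.chart (φ t y) - b.chart (φ t x)) • b.field (b.chart (φ t x))‖ ≤
        C' * (‖b.chart y - b.chart x - b.form (b.chart y - b.chart x) • b.field (b.chart x)‖ +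
          ‖b.chart y - b.chart x‖ ^ 2) := by
  set e := b.chart with he
  set v := chartField e V with hv
  have hreg : ∀ z ∈ Metric.ball b.center b.radius, z ∈ e.target := fun z hz ↦
    b.isNormalForm.subset (b.ball_subset_region hz)
  obtain ⟨r, hr, C, hC, hvd, hvC, hvq⟩ := exists_quadratic_bound
    (contDiffAt_chartField b.mem_maximalAtlas (hreg _ hx₀.2) hV)
  obtain ⟨r', hr', hball⟩ := Metric.mem_nhds_iff.1
    (inter_mem (Metric.ball_mem_nhds (e x₀) hr) (Metric.isOpen_ball.mem_nhds hx₀.2))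
  set G := Metric.ball (e x₀) r' with hG
  have hvL : ∀ x ∈ G, ∀ y ∈ G, ‖v y - v x‖ ≤ C * ‖y - x‖ := fun x hx y hy ↦
    (convex_ball _ _).norm_image_sub_le_of_norm_fderiv_le (𝕜 := ℝ)
      (fun z hz ↦ hvd z (hball hz).1) (fun z hz ↦ hvC z (hball hz).1) hx hy
  have hdom : e.source ∩ e ⁻¹' G ∈ 𝓝 x₀ :=
    (e.isOpen_inter_preimage Metric.isOpen_ball).mem_nhds ⟨hx₀.1, Metric.mem_ball_self hr'⟩
  -- Joint continuity at time 0 gives one δ valid for all starting points near x₀.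
  have hcont : ∀ᶠ q : ℝ≥0 × M in 𝓝 0 ×ˢ 𝓝 x₀, φ q.1 q.2 ∈ e.source ∩ e ⁻¹' G := by
    rw [← nhds_prod_eq]
    have h1 : ContinuousAt (fun q : ℝ≥0 × M ↦ φ q.1 q.2) (0, x₀) :=
      (φ.continuous continuous_fst continuous_snd).continuousAt
    exact h1 (by simpa only [Flow.map_zero_apply] using hdom)
  obtain ⟨P, hP, O, hO, hPO⟩ := Filter.mem_prod_iff.1 hcont
  obtain ⟨δ, hδ, hδP⟩ : ∃ δ > 0, ∀ t : ℝ≥0, t ≤ δ → t ∈ P := by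
    obtain ⟨ε, hε, hball⟩ := Metric.mem_nhds_iff.1 hP
    refine ⟨⟨ε / 2, by positivity⟩, by exact (half_pos hε : (0:ℝ) < ε / 2), fun t ht ↦ hball ?_⟩
    rw [Metric.mem_ball, NNReal.dist_eq, NNReal.coe_zero, sub_zero, abs_of_nonneg (by exact t.2)]
    have : (t : ℝ) ≤ ε / 2 := ht
    linarith
  have hmem : ∀ x ∈ O, ∀ t : ℝ≥0, t ≤ δ → φ t x ∈ e.source ∩ e ⁻¹' G := fun x hx t ht ↦
    hPO (mk_mem_prod (hδP t ht) hx)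
  obtain ⟨C', hC'⟩ := exists_tangential_gronwall (ℓ := b.form) (v := v) (w := b.field) (G := G)
    (L := b.bound) (C := C) (T := δ) Metric.isOpen_ball hC (fun x hx ↦ hvC x (hball hx).1)
    (fun x hx y hy ↦ hvq x (hball hx).1 y (hball hy).1) hvL
    (fun x hx ↦ (b.contDiff_field.differentiable (by simp)) x)
    (fun x _ ↦ b.isTransverseFlow.norm_le x) b.bound.2 (fun x _ ↦ b.isTransverseFlow.normalized x)
    (fun x hx ↦ b.isNormalForm.exists_bracket_eq_smul b.mem_maximalAtlas hV hproj
      (b.ball_subset_region (hball hx).2))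
  have hsol : ∀ x ∈ O, ∀ t ∈ Icc (0 : ℝ) δ,
      HasDerivWithinAt (fun t : ℝ ↦ e (φ t.toNNReal x)) (v (e (φ t.toNNReal x))) (Ici 0) t := by
    intro x hx t ht
    have hm := hmem x hx t.toNNReal (Real.toNNReal_le_iff_le_coe.2 ht.2)
    have h1 := hasDerivWithinAt_chart_comp b.mem_maximalAtlas (γ := fun t : ℝ ↦ φ t.toNNReal x)
      hm.1 (hφ x t ht.1)
    refine h1.congr_deriv ?_
    rw [hv, chartField_apply b.mem_maximalAtlas (e.map_source hm.1), e.left_inv hm.1]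
  refine ⟨O, hO, δ, hδ, C', fun x hx t ht ↦ ?_, fun x hx y hy t ht ↦ ?_⟩
  · have := hmem x hx t ht
    exact ⟨this.1, (hball this.2).2⟩
  · have hXc : ∀ x ∈ O, ContinuousOn (fun t : ℝ ↦ e (φ t.toNNReal x)) (Icc 0 δ) :=
      fun x hx t ht ↦ (hsol x hx t ht).continuousWithinAt.mono Icc_subset_Ici_self
    have hXG : ∀ x ∈ O, ∀ t ∈ Icc (0 : ℝ) δ, e (φ t.toNNReal x) ∈ G := fun x hx t ht ↦
      (hmem x hx t.toNNReal (Real.toNNReal_le_iff_le_coe.2 ht.2)).2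
    have hXd : ∀ x ∈ O, ∀ t ∈ Ico (0 : ℝ) δ, HasDerivWithinAt (fun t : ℝ ↦ e (φ t.toNNReal x))
        (v (e (φ t.toNNReal x))) (Ici t) t := fun x hx t ht ↦
      (hsol x hx t (Ico_subset_Icc_self ht)).mono (Ici_subset_Ici.2 ht.1)
    have := hC' (fun t : ℝ ↦ e (φ t.toNNReal x)) (fun t : ℝ ↦ e (φ t.toNNReal y)) (hXc x hx)
      (hXc y hy) (hXG x hx) (hXG y hy) (hXd x hx) (hXd y hy) t ⟨t.2, ht⟩
    simpa only [Real.toNNReal_coe, Real.toNNReal_zero, Flow.map_zero_apply] using this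

open Asymptotics in
/-- For a short time, the evolution maps plaques of a flow box into plaques. -/
theorem FlowBox.exists_proj_evolution_eq (b : FlowBox N) (hV : IsVectorFieldOfClass 2 V)
    (hproj : IsProjectable N V) {φ : Flow ℝ≥0 M} (hφ : IsEvolutionOf φ V) {x₀ : M}
    (hx₀ : x₀ ∈ b.domain) :
    ∃ O ∈ 𝓝 x₀, ∃ δ > 0, (∀ x ∈ O, ∀ t : ℝ≥0, t ≤ δ → φ t x ∈ b.domain) ∧
      ∀ x ∈ O, ∀ y ∈ O, b.proj x = b.proj y → ∀ t : ℝ≥0, t ≤ δ →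
        b.proj (φ t x) = b.proj (φ t y) := by
  obtain ⟨O, hO, δ, hδ, C', hdom, hest⟩ := b.exists_tangential_estimate hV hproj hφ hx₀
  set e := b.chart with he
  set a := e x₀ with ha
  have htar : a ∈ e.target := e.map_source hx₀.1
  have hOa : e.symm ⁻¹' O ∩ Metric.ball b.center b.radius ∈ 𝓝 a := by
    refine inter_mem (e.continuousAt_symm htar ?_) (Metric.isOpen_ball.mem_nhds hx₀.2)
    rw [e.left_inv hx₀.1]; exact hO
  obtain ⟨η, hη, hball⟩ := Metric.mem_nhds_iff.1 hOa
  set κ : ℝ := 1 + 2 * (b.bound * ‖b.form‖) with hκ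
  have hκpos : 0 < κ := by positivity
  let O' : Set M := e.source ∩ e ⁻¹' Metric.ball a (η / κ)
  have hO' : O' ∈ 𝓝 x₀ := (e.isOpen_inter_preimage Metric.isOpen_ball).mem_nhds
    ⟨hx₀.1, Metric.mem_ball_self (by positivity)⟩
  refine ⟨O ∩ O', inter_mem hO hO', δ, hδ, fun x hx ↦ hdom x hx.1, fun x hx y hy hxy t ht ↦ ?_⟩
  set τ := b.form (e y) - b.form (e x) with hτ
  set c₀ : ℝ → EuclideanSpace ℝ (Fin m) := fun s ↦ b.flow (e x) (s * τ) with hc₀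
  have harc : ∀ s ∈ Icc (0 : ℝ) 1, c₀ s ∈ Metric.ball a η := by
    intro s hs
    have hx2 : dist (e x) a < η / κ := hx.2.2
    have hy2 : dist (e y) a < η / κ := hy.2.2
    have h1 := b.isTransverseFlow.dist_le_abs (e x) (s * τ) 0
    rw [b.isTransverseFlow.zero, sub_zero, abs_mul, abs_of_nonneg hs.1] at h1
    have h2 : |τ| ≤ ‖b.form‖ * (2 * (η / κ)) := by
      rw [hτ, ← map_sub, ← Real.norm_eq_abs]
      refine (b.form.le_opNorm _).trans ?_
      gcongr
      rw [← dist_eq_norm]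
      linarith [dist_triangle_right (e y) (e x) a]
    have h3 : s * |τ| ≤ 1 * (‖b.form‖ * (2 * (η / κ))) := by
      gcongr
      exact hs.2
    rw [Metric.mem_ball]
    calc dist (c₀ s) a ≤ dist (c₀ s) (e x) + dist (e x) a := dist_triangle _ _ _
      _ < b.bound * (1 * (‖b.form‖ * (2 * (η / κ)))) + η / κ :=
          add_lt_add_of_le_of_lt (h1.trans (by gcongr)) hx2
      _ = κ * (η / κ) := by rw [hκ]; ring
      _ = η := by field_simp
  have hc₀t : ∀ s ∈ Icc (0 : ℝ) 1, c₀ s ∈ e.target := fun s hs ↦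
    b.isNormalForm.subset (b.ball_subset_region (hball (harc s hs)).2)
  have hc₀d : ∀ s, HasDerivAt c₀ (τ • b.field (c₀ s)) s := by
    intro s
    have h2 : HasDerivAt (fun s : ℝ ↦ s * τ) τ s := by simpa using (hasDerivAt_id s).mul_const τ
    exact (b.isTransverseFlow.hasDerivAt (e x) (s * τ)).scomp s h2
  -- The evolved plaque arc. Differentiability of `φ t` in space is not needed: comparing the orbits
  -- of c₀ s₀ and c₀ s shows that c has increments O(s - s₀) and stays tangent to w up to o(s - s₀),
  -- so its projection has zero derivative.
  let c : ℝ → EuclideanSpace ℝ (Fin m) := fun s ↦ e (φ t (e.symm (c₀ s)))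
  have hcd : ∀ s₀ ∈ Icc (0 : ℝ) 1, HasDerivWithinAt
      (fun s ↦ flowProj b.form b.flow (b.form b.center) (c s)) 0 (Icc 0 1) s₀ := by
    intro s₀ hs₀
    have hev : ∀ᶠ s in 𝓝[Icc 0 1] s₀, s ∈ Icc (0 : ℝ) 1 := self_mem_nhdsWithin
    have hO₁ : (fun s ↦ c₀ s - c₀ s₀) =O[𝓝[Icc 0 1] s₀] fun s ↦ s - s₀ :=
      (hc₀d s₀).hasDerivWithinAt.hasFDerivWithinAt.isBigO_sub
    have ho₁ : (fun s ↦ c₀ s - c₀ s₀ - b.form (c₀ s - c₀ s₀) • b.field (c₀ s₀))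
        =o[𝓝[Icc 0 1] s₀] fun s ↦ s - s₀ := by
      have hP := ((hc₀d s₀).sub ((b.form.hasFDerivAt.comp_hasDerivAt s₀ (hc₀d s₀)).smul_const
        (b.field (c₀ s₀)))).hasDerivWithinAt (s := Icc 0 1)
      refine (hasDerivWithinAt_iff_isLittleO.1 hP).congr_left fun t ↦ ?_
      simp only [Function.comp_apply, map_smul, b.isTransverseFlow.normalized, Pi.sub_apply,
        map_sub, smul_eq_mul, mul_one, sub_self, smul_zero, sub_zero, sub_smul]
      abel
    have hs0 : Tendsto (fun s ↦ s - s₀) (𝓝[Icc 0 1] s₀) (𝓝 0) := by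
      have : Tendsto (fun s : ℝ ↦ s - s₀) (𝓝 s₀) (𝓝 (s₀ - s₀)) :=
        (continuous_id.sub continuous_const).tendsto s₀
      rw [sub_self] at this
      exact this.mono_left nhdsWithin_le_nhds
    have hsq : (fun s ↦ ‖c₀ s - c₀ s₀‖ ^ 2) =o[𝓝[Icc 0 1] s₀] fun s ↦ s - s₀ := by
      have h1 : (fun s ↦ ‖c₀ s - c₀ s₀‖ ^ 2) =O[𝓝[Icc 0 1] s₀] fun s ↦ (s - s₀) ^ 2 :=
        hO₁.norm_left.pow 2
      refine h1.trans_isLittleO ?_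
      have h2 : (fun s : ℝ ↦ (s - s₀) * (s - s₀)) =o[𝓝[Icc 0 1] s₀] fun s ↦ 1 * (s - s₀) :=
        ((isLittleO_one_iff ℝ).2 hs0).mul_isBigO (isBigO_refl _ _)
      simpa [sq] using h2
    have key : ∀ s ∈ Icc (0 : ℝ) 1, _ := fun s hs ↦
      hest (e.symm (c₀ s₀)) (hball (harc s₀ hs₀)).1 (e.symm (c₀ s)) (hball (harc s hs)).1 t ht
    refine b.isTransverseFlow.hasDerivWithinAt_flowProj_comp b.center (c := c) ?_ ?_
    · refine IsBigO.trans (IsBigO.of_bound C' ?_) hO₁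
      filter_upwards [hev] with s hs
      have := (key s hs).1
      rwa [e.right_inv (hc₀t s hs), e.right_inv (hc₀t s₀ hs₀)] at this
    · refine IsBigO.trans_isLittleO (IsBigO.of_bound C' ?_) (ho₁.norm_left.add hsq)
      filter_upwards [hev] with s hs
      have := (key s hs).2
      rw [e.right_inv (hc₀t s hs), e.right_inv (hc₀t s₀ hs₀)] at this
      rwa [Real.norm_of_nonneg (by positivity)]
  have hconst := eq_of_hasDerivWithinAt_zero (convex_Icc (0 : ℝ) 1) hcd
    (s := 0) (t := 1) (by simp) (by simp)
  have h0 : e.symm (c₀ 0) = x := by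
    simp [hc₀, b.isTransverseFlow.zero, e.left_inv hx.2.1]
  have h1 : e.symm (c₀ 1) = y := by
    simp only [hc₀, one_mul]
    rw [hτ, ← flow_eq_of_proj_eq hxy, e.left_inv hy.2.1]
  simp only [c, h0, h1] at hconst
  exact hconst

/-- A semiflow generated by a projectable vector field maps leaves into leaves. -/
theorem leafSetoid_evolution (hbox : ∀ x, ∃ b : FlowBox N, x ∈ b.domain)
    (hV : IsVectorFieldOfClass 2 V) (hproj : IsProjectable N V) {φ : Flow ℝ≥0 M}
    (hφ : IsEvolutionOf φ V) (t : ℝ≥0) {x y : M} (hxy : leafSetoid N x y) :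
    leafSetoid N (φ t x) (φ t y) := by
  have hxy' : Relation.EqvGen (JoinedByTangentArc N) x y := hxy
  induction hxy' with
  | rel x y h =>
    obtain ⟨γ, hγ, rfl, rfl, htan⟩ := h
    have hcurve := hγ.isTangentCurveOn htan
    have hcont : ∀ t : ℝ≥0, ContinuousOn (fun s ↦ φ t (γ s)) (Icc 0 1) := fun t ↦
      (φ.continuous continuous_const continuous_id).comp_continuousOn hcurve.continuousOn
    -- For fixed s₀ the local constancy in s is propagated in time. The neighbourhood of s₀ may
    -- depend on T, and quantifying over all boxes permits a change of box at each step.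
    have hloc : ∀ s₀ ∈ Icc (0 : ℝ) 1, ∀ T : ℝ, 0 ≤ T → ∀ b : FlowBox N,
        φ T.toNNReal (γ s₀) ∈ b.domain → ∀ᶠ s in 𝓝[Icc 0 1] s₀,
          b.proj (φ T.toNNReal (γ s)) = b.proj (φ T.toNNReal (γ s₀)) := by
      intro s₀ hs₀ T hT
      refine forall_nonneg_of_local_propagation (Q := fun T ↦ ∀ b : FlowBox N,
        φ T.toNNReal (γ s₀) ∈ b.domain → ∀ᶠ s in 𝓝[Icc 0 1] s₀,
          b.proj (φ T.toNNReal (γ s)) = b.proj (φ T.toNNReal (γ s₀))) ?_ ?_ hT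
      · intro b hb
        simp only [Real.toNNReal_zero, Flow.map_zero_apply] at hb ⊢
        exact (b.eventually_proj_eq_of_isTangentCurveOn (convex_Icc _ _) hcurve hs₀ hb).mono
          fun s hs ↦ hs.2
      · intro t₀ ht₀
        obtain ⟨b, hb⟩ := hbox (φ t₀.toNNReal (γ s₀))
        obtain ⟨O', hO', δ, hδ, hdom, hstep⟩ := b.exists_proj_evolution_eq hV hproj hφ hb
        obtain ⟨O, hOO', hOo, hO⟩ := mem_nhds_iff.1 hO'
        have hct : Continuous (fun t : ℝ ↦ φ t.toNNReal (γ s₀)) :=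
          φ.continuous continuous_real_toNNReal continuous_const
        obtain ⟨ε, hε, hball⟩ := Metric.mem_nhds_iff.1 (hct.continuousAt (hOo.mem_nhds hO))
        -- Both times lie within δ / 2 of t₀, so the step between them is at most δ.
        refine ⟨min ε (δ / 2), lt_min hε (by positivity), fun t₁ ht₁ t₂ h12 h1 h2 hQ b' hb' ↦ ?_⟩
        have hO₁ : φ t₁.toNNReal (γ s₀) ∈ O :=
          hball (by rw [Metric.mem_ball, Real.dist_eq]; exact h1.trans_le (min_le_left _ _))
        have hle : (t₂ - t₁).toNNReal ≤ δ := by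
          rw [Real.toNNReal_le_iff_le_coe]
          have h3 := (abs_lt.1 (h1.trans_le (min_le_right _ _))).1
          have h4 := (abs_lt.1 (h2.trans_le (min_le_right _ _))).2
          linarith
        have hadd : ∀ z, φ t₂.toNNReal z = φ (t₂ - t₁).toNNReal (φ t₁.toNNReal z) := by
          intro z
          rw [← Flow.map_add, ← Real.toNNReal_add (by linarith) ht₁, sub_add_cancel]
        have hb₁ : φ t₁.toNNReal (γ s₀) ∈ b.domain := by
          simpa using hdom _ (hOO' hO₁) 0 zero_le
        have hb₂ : φ t₂.toNNReal (γ s₀) ∈ b.domain := by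
          rw [hadd]; exact hdom _ (hOO' hO₁) _ hle
        refine b.eventually_proj_eq_of_mem b' (γ := fun s ↦ φ t₂.toNNReal (γ s))
          (hcont _ s₀ hs₀) hb₂ hb' ?_
        filter_upwards [hQ b hb₁, hcont t₁.toNNReal s₀ hs₀ (hOo.mem_nhds hO₁)] with s hs hsO
        rw [hadd, hadd]
        exact hstep _ (hOO' hsO) _ (hOO' hO₁) hs _ hle
    refine isPreconnected_Icc.induction₂ (s := Icc (0 : ℝ) 1)
      (fun s s' ↦ leafSetoid N (φ t (γ s)) (φ t (γ s'))) (fun s hs ↦ ?_)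
      (fun _ _ _ _ _ _ h1 h2 ↦ (leafSetoid N).trans h1 h2) (fun _ _ _ _ h ↦ (leafSetoid N).symm h)
      (by simp) (by simp)
    obtain ⟨b, hb⟩ := hbox (φ t (γ s))
    have h1 := hloc s hs t t.2 b (by simpa using hb)
    filter_upwards [h1, hcont t s hs (b.isOpen_domain.mem_nhds hb)] with s' h1 h2
    rw [Real.toNNReal_coe] at h1
    exact b.leafSetoid_rel hb h2 h1.symm
  | refl x => exact (leafSetoid N).refl _
  | symm x y h ih => exact (leafSetoid N).symm (ih h)
  | trans x y z h1 h2 ih1 ih2 => exact (leafSetoid N).trans (ih1 h1) (ih2 h2)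

end Evolution

/-! ### The dimension of the reduced attractor -/

theorem coveringDimLE_of_isEmpty (X : Type*) [TopologicalSpace X] [IsEmpty X] (d : WithBot ℕ∞) :
    CoveringDimLE X d := fun _ _ _ _ ↦
  ⟨∅, finite_empty, by simp, by rw [sUnion_empty, univ_eq_empty_iff.2 ‹_›], by simp,
    fun x ↦ isEmptyElim x⟩

theorem exists_flowBox_nullDistribution {m : ℕ} {U : Type*} [TopologicalSpace U]
    [ChartedSpace (EuclideanSpace ℝ (Fin (m + 1))) U] [IsManifold (𝓡 (m + 1)) ∞ U]
    (g : LorentzianMetric (m + 1) U) {M : Type*} [TopologicalSpace M]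
    [ChartedSpace (EuclideanSpace ℝ (Fin m)) M] [IsManifold (𝓡 m) ∞ M] {ι : M → U}
    (hι : ContMDiff (𝓡 m) (𝓡 (m + 1)) ∞ ι)
    (hrank : ∀ x, Module.finrank ℝ (nullDistribution (m := m) g ι x) = 1) (x : M) :
    ∃ b : FlowBox (nullDistribution (m := m) g ι), x ∈ b.chart.source ∧ b.chart x = b.center := by
  have he : chartAt (EuclideanSpace ℝ (Fin m)) x ∈ IsManifold.maximalAtlas (𝓡 m) ∞ M :=
    IsManifold.chart_mem_maximalAtlas x
  obtain ⟨ℓ, w, O, hO, h⟩ := exists_isNormalForm_nullDistribution g hι hrank he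
    (mem_chart_target _ x)
  exact h.exists_flowBox he (mem_chart_source _ x) hO

end

theorem theorem2 {m k : ℕ} (hk : 1 ≤ k)
    -- the ambient Lorentzian phase space and the regular constraint function
    {U : Type*} [TopologicalSpace U] [T2Space U] [SecondCountableTopology U]
    [ChartedSpace (EuclideanSpace ℝ (Fin (m + 1))) U] [IsManifold (𝓡 (m + 1)) ∞ U]
    (g : LorentzianMetric (m + 1) U)
    (Φ : U → ℝ) (hΦ : ContMDiff (𝓡 (m + 1)) 𝓘(ℝ, ℝ) ∞ Φ)
    (hreg : ∀ p, Φ p = 0 → mfderiv (𝓡 (m + 1)) 𝓘(ℝ, ℝ) Φ p ≠ 0)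
    -- the constraint manifold, embedded in `U` as the zero set of `Φ`
    {M : Type*} [MetricSpace M] [ChartedSpace (EuclideanSpace ℝ (Fin m)) M]
    [IsManifold (𝓡 m) ∞ M]
    (ι : M → U) (hι : Manifold.IsSmoothEmbedding (𝓡 m) (𝓡 (m + 1)) ∞ ι)
    (hrange : Set.range ι = Φ ⁻¹' {0})
    -- the induced form has constant corank `k`
    (hrank : ∀ x, Module.finrank ℝ (nullDistribution (m := m) g ι x) = k)
    -- the intrinsic evolution
    (V : ∀ x : M, TangentSpace (𝓡 m) x) (hV : IsVectorFieldOfClass 2 V)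
    (φ : Flow ℝ≥0 M) (hφ : IsEvolutionOf φ V)
    (hac : IsAsymptoticallyCompact φ) (habs : HasBoundedAbsorbingSet φ)
    -- the null foliation
    (hinv : IsInvolutive (nullDistribution (m := m) g ι))
    (hcompact : ∀ x, IsCompact (leaf (nullDistribution (m := m) g ι) x))
    (hemb : ∀ x, IsEmbeddedSubmanifold (m := m) k (leaf (nullDistribution (m := m) g ι) x))
    (hT2 : T2Space (LeafSpace (nullDistribution (m := m) g ι)))
    (hproj : IsProjectable (nullDistribution (m := m) g ι) V) :
    -- the global attractor exists and is unique
    ∃ A : Set M, IsGlobalAttractor φ A ∧ (∀ A', IsGlobalAttractor φ A' → A' = A) ∧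
      -- its projection is compact
      IsCompact (leafProj (nullDistribution (m := m) g ι) '' A) ∧
      -- there is a unique reduced semiflow, and the projected attractor is invariant under it
      (∃! ψ : Flow ℝ≥0 (LeafSpace (nullDistribution (m := m) g ι)),
        Flow.IsSemiconjugacy (leafProj (nullDistribution (m := m) g ι)) φ ψ) ∧
      (∀ ψ : Flow ℝ≥0 (LeafSpace (nullDistribution (m := m) g ι)),
        Flow.IsSemiconjugacy (leafProj (nullDistribution (m := m) g ι)) φ ψ →
        ∀ t, ψ t '' (leafProj (nullDistribution (m := m) g ι) '' A) =
          leafProj (nullDistribution (m := m) g ι) '' A) ∧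
      -- the dimension bound
      coveringDim (leafProj (nullDistribution (m := m) g ι) '' A) ≤ ((m - k : ℕ) : WithBot ℕ∞) := by
  set N := nullDistribution (m := m) g ι with hN
  obtain ⟨A, hA⟩ := exists_isGlobalAttractor hac habs
  have hAc : IsCompact (leafProj N '' A) := hA.isCompact.image continuous_quotient_mk'
  -- On an empty M the rank condition says nothing about k, so the reduction to k = 1 needs a point.
  by_cases hM : IsEmpty M
  · have : IsEmpty (leafProj N '' A) := by
      rw [isEmpty_coe_sort, image_eq_empty]
      exact eq_empty_of_isEmpty A
    exact ⟨A, hA, fun A' hA' ↦ hA.eq hA', hAc,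
      existsUnique_isSemiconjugacy_quotient φ (leafSetoid N) fun t x ↦ isEmptyElim x,
      fun ψ hψ t ↦ hψ.image_invariant (hA.invariant t), sInf_le (coveringDimLE_of_isEmpty _ _)⟩
  have hle : ∀ x, Module.finrank ℝ (N x) ≤ 1 := fun x ↦
    finrank_nullDistribution_le_one g ι (hι.isImmersion.isImmersionAt x).mfderiv_injective
  obtain rfl : k = 1 := by
    obtain ⟨x⟩ := not_isEmpty_iff.1 hM
    have := hle x
    rw [hrank x] at this
    omega
  have hbox := exists_flowBox_nullDistribution g hι.contMDiff hrank
  have hatlas := plaqueAtlas_flowBox hbox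
  have : SecondCountableTopology M := hι.isEmbedding.secondCountableTopology
  refine ⟨A, hA, fun A' hA' ↦ hA.eq hA', hAc,
    existsUnique_isSemiconjugacy_quotient φ (leafSetoid N) fun t x y hxy ↦
      leafSetoid_evolution (fun x ↦ (hbox x).imp fun b hb ↦
        (b.exists_isCompact_transversal hb.1 hb.2).1) hV hproj hφ t hxy,
    fun ψ hψ t ↦ hψ.image_invariant (hA.invariant t), sInf_le (hatlas.coveringDimLE hAc)⟩
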